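/- Let $D$ be a non-split (that is, nonempty and connected) alternating link diagram on the sphere, possibly the crossingless diagram of the unknot, with a chosen ordering of its crossings. Let $\overline{\mathcal C}(D)$ be the unshifted Khovanov complex of $D$: with $A=\mathbb Z[X]/(X^2)$, $\deg 1=1$, $\deg X=-1$, the group $\overline{\mathcal C}^{i}(D)$ is the direct sum, over all sets $S$ of $i$ crossings, of $A^{\otimes\{\text{circles of } D(S)\}}$ with its grading raised by $i$, where $D(S)$ is obtained from $D$ by $1$-resolving the crossings in $S$ and $0$-resolving all others; the differential is the signed sum of the maps induced by changing one $0$-resolution to a $1$-resolution, which are the multiplication of $A$ when two circles merge and the comultiplication $\Delta(1)=1\otimes X+X\otimes 1$, $\Delta(X)=X\otimes X$ when a circle splits. Let $\overline{\mathcal H}^{i,j}(D)$ be its cohomology in cohomological degree $i$ and internal degree $j$ (no shift depending on an orientation is applied). Then there are integers $s$ and $p\le m$ such that 1. $\overline{\mathcal H}^{i,j}(D)\otimes_{\mathbb Z}\mathbb Q=0$ unless $p\le i\le m$ and $j=2i-s-1$ (the diagonal) or $j=2i-s+1$ (the subdiagonal); 2. the top is on the diagonal: $\dim_{\mathbb Q}\overline{\mathcal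 H}^{p,\,2p-s-1}(D)\otimes_{\mathbb Z}\mathbb Q=1$; 3. the bottom is on the subdiagonal: $\dim_{\mathbb Q}\overline{\mathcal H}^{m,\,2m-s+1}(D)\otimes_{\mathbb Z}\mathbb Q=1$. -/

import Mathlib

open scoped TensorProduct

/-- The half-edges (darts) at the crossings of a link diagram.  At the crossing `c` the four darts
`(c, 0), (c, 1), (c, 2), (c, 3)` follow each other counterclockwise; `(c, 0)` and `(c, 2)` are
the two ends of the under-passing strand, `(c, 1)` and `(c, 3)` those of the over-passing strand. -/
abbrev Dart (ι : Type*) : Type _ := ι × ZMod 4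

/-- An unoriented link diagram on the sphere, with crossings indexed by `ι` (meant to be finite),
given as a planar diagram code: a four-valent combinatorial map with over/under information,
together with a number of crossingless circles. -/
structure LinkDiagram (ι : Type*) where
  /-- the other half of the edge to which a dart belongs -/
  edge : Dart ι → Dart ι
  edge_edge : ∀ d, edge (edge d) = d
  edge_ne : ∀ d, edge d ≠ d
  /-- the number of components of the diagram that are circles without crossings -/
  loops : ℕ
  /-- Every connected component of the underlying four-valent graph is drawn on a sphere.  By
  Euler's formula `V - E + F = 2 * (number of components)`, where `E = 2 * V` and the faces are
  the orbits of `d ↦` (next dart counterclockwise after `edge d`). -/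
  planar :
    Nat.card (Quot fun d e : Dart ι => e = ((edge d).1, (edge d).2 + 1)) =
      Nat.card ι + 2 * Nat.card (Quot fun c c' : ι => ∃ k k', edge (c, k) = (c', k'))

/-- The two standard generators `1` and `X` of `A = ℤ[X]/(X²)`. -/
inductive Label : Type
  | one : Label
  | X : Label
  deriving DecidableEq

namespace Label

instance : Fintype Label := ⟨{one, X}, fun x => by cases x <;> simp⟩

/-- The grading of `A`: `deg 1 = 1`, `deg X = -1`. -/
def deg : Label → ℤ
  | one => 1
  | X => -1

/-- `mulCoeff u v w` is the coefficient of `w` in the product `u * v` in `A`. -/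
def mulCoeff : Label → Label → Label → ℤ
  | one, one, one => 1
  | one, X, X => 1
  | X, one, X => 1
  | _, _, _ => 0

/-- `comulCoeff u v w` is the coefficient of `v ⊗ w` in `Δ u`, where `Δ 1 = 1 ⊗ X + X ⊗ 1` and
`Δ X = X ⊗ X`. -/
def comulCoeff : Label → Label → Label → ℤ
  | one, one, X => 1
  | one, X, one => 1
  | X, X, X => 1
  | _, _, _ => 0

end Label

namespace LinkDiagram

variable {ι : Type*}

/-- The connected components of the diagram, as a subset of the sphere. -/
abbrev Piece (D : LinkDiagram ι) : Type _ :=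
  (Quot fun c c' : ι => ∃ k k', D.edge (c, k) = (c', k')) ⊕ Fin D.loops

/-- A diagram is non-split if it is nonempty and connected. -/
def Nonsplit (D : LinkDiagram ι) : Prop := Nat.card D.Piece = 1

/-- The dart lies on the over-passing strand of its crossing. -/
def IsOver (d : Dart ι) : Prop := d.2 = 1 ∨ d.2 = 3

/-- A diagram is alternating if over- and under-passings alternate along every component, i.e.
if every edge has one over-passing and one under-passing end. -/
def Alternating (D : LinkDiagram ι) : Prop := ∀ d, IsOver (D.edge d) ↔ ¬ IsOver d

section Cube

variable [LinearOrder ι]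

/-- The dart joined to `d` at its crossing in the resolution `D(S)`, in which the crossings in
`S` are `1`-resolved and all others are `0`-resolved.  The `0`-resolution joins `0` with `1` and `2`
with `3` (it merges the two regions swept out when the over-passing strand is turned
counterclockwise); the `1`-resolution joins `0` with `3` and `1` with `2`. -/
def resolve (S : Finset ι) (d : Dart ι) : Dart ι :=
  (d.1, if d.1 ∈ S then 3 - d.2 else 1 - d.2)

/-- The circles of the resolution `D(S)`. -/
abbrev Circle (D : LinkDiagram ι) (S : Finset ι) : Type _ :=
  (Quot fun d e : Dart ι => e = D.edge d ∨ e = resolve S d) ⊕ Fin D.loops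

/-- The circle of `D(S)` that passes through a dart. -/
def circleOf (D : LinkDiagram ι) (S : Finset ι) (d : Dart ι) : D.Circle S :=
  Sum.inl (Quot.mk _ d)

/-- The standard generators of the unshifted complex: a resolution `D(S)`, and for every one of its
circles a generator of the corresponding tensor factor `A`. -/
abbrev State (D : LinkDiagram ι) : Type _ := Σ S : Finset ι, (D.Circle S → Label)

/-- The cohomological degree `|S|`. -/
def State.hdeg {D : LinkDiagram ι} (s : D.State) : ℤ := s.1.card

/-- The states `s` and `t` carry the same labels on the circles that do not pass by the
crossing `a`. -/
def AgreeAway (D : LinkDiagram ι) (a : ι) (s t : D.State) : Prop :=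
  (∀ d : Dart ι, (∀ k, D.circleOf s.1 d ≠ D.circleOf s.1 (a, k)) →
    t.2 (D.circleOf t.1 d) = s.2 (D.circleOf s.1 d)) ∧
  ∀ n : Fin D.loops, t.2 (Sum.inr n) = s.2 (Sum.inr n)

open scoped Classical in
/-- The coefficient of `t` in the image of `s` under the map induced by changing the `0`-resolution
of `a` to the `1`-resolution: multiplication if two circles are merged, comultiplication if a circle
is split into two.  (In a planar diagram one of the two always happens.) -/
noncomputable def changeCoeff (D : LinkDiagram ι) (a : ι) (s t : D.State) : ℤ :=
  if D.circleOf s.1 (a, 0) ≠ D.circleOf s.1 (a, 2) then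
    Label.mulCoeff (s.2 (D.circleOf s.1 (a, 0))) (s.2 (D.circleOf s.1 (a, 2)))
      (t.2 (D.circleOf t.1 (a, 0)))
  else if D.circleOf t.1 (a, 0) ≠ D.circleOf t.1 (a, 2) then
    Label.comulCoeff (s.2 (D.circleOf s.1 (a, 0)))
      (t.2 (D.circleOf t.1 (a, 0))) (t.2 (D.circleOf t.1 (a, 2)))
  else 0

variable [Fintype ι]

open scoped Classical in
/-- The quantum degree: the degree in `A ⊗ ⋯ ⊗ A`, raised by `|S|`. -/
noncomputable def State.qdeg {D : LinkDiagram ι} (s : D.State) : ℤ :=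
  haveI := Fintype.ofFinite (D.Circle s.1)
  s.1.card + ∑ z, (s.2 z).deg

open scoped Classical in
/-- The coefficient of `t` in `d s`.  The edge of the cube from `S` to `S ∪ {a}` carries the sign
`(-1) ^ #{b ∈ S | a < b}`. -/
noncomputable def incidence (D : LinkDiagram ι) (s t : D.State) : ℤ :=
  ∑ a : ι, if a ∉ s.1 ∧ t.1 = insert a s.1 ∧ D.AgreeAway a s t then
    (-1) ^ (s.1.filter fun b => a < b).card * D.changeCoeff a s t else 0

/-- The standard generators in bidegree `(i, j)`. -/
abbrev Generator (D : LinkDiagram ι) (i j : ℤ) : Type _ :=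
  {s : D.State // s.hdeg = i ∧ s.qdeg = j}

noncomputable instance (D : LinkDiagram ι) (i j : ℤ) : Fintype (D.Generator i j) :=
  Fintype.ofFinite _

/-- The group `C̄^{i,j}(D)` of the unshifted Khovanov complex: the free abelian group on the
standard generators of bidegree `(i, j)`. -/
abbrev Cochain (D : LinkDiagram ι) (i j : ℤ) : Type _ := D.Generator i j → ℤ

/-- The coboundary map `C̄^{i,j}(D) → C̄^{i',j}(D)`, of interest for `i' = i + 1`
(and zero otherwise). -/
noncomputable def d (D : LinkDiagram ι) (i i' j : ℤ) : D.Cochain i j →ₗ[ℤ] D.Cochain i' j :=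
  Matrix.mulVecLin (Matrix.of fun t s => D.incidence s.1 t.1)

/-- The cohomology `H̄^{i,j}(D)` of the unshifted Khovanov complex: cocycles modulo
coboundaries. -/
abbrev KhBar (D : LinkDiagram ι) (i j : ℤ) : Type _ :=
  LinearMap.ker (D.d i (i + 1) j) ⧸
    (LinearMap.range (D.d (i - 1) i j)).submoduleOf (LinearMap.ker (D.d i (i + 1) j))

end Cube

end LinkDiagram

namespace Equiv.Perm

variable {α : Type*} [DecidableEq α]

theorem mul_swap_pow_apply (g : Perm α) {x y : α} {n : ℕ}
    (h : ∀ i, 1 ≤ i → i < n → (g ^ i) y ≠ x ∧ (g ^ i) y ≠ y) {i : ℕ} (hi : 1 ≤ i) (hin : i ≤ n) :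
    ((g * swap x y) ^ i) x = (g ^ i) y := by
  induction i, hi using Nat.le_induction with
  | base => simp
  | succ i hi ih =>
    obtain ⟨h1, h2⟩ := h i hi (by omega)
    rw [pow_succ', mul_apply, ih (by omega), mul_apply, swap_apply_of_ne_of_ne h1 h2, pow_succ' g,
      mul_apply]

/-- Multiplication by the transposition of two points splits their common cycle, or merges
their two cycles. -/
theorem sameCycle_mul_swap_iff [Finite α] (g : Perm α) {x y : α} (hxy : x ≠ y) :
    (g * swap x y).SameCycle x y ↔ ¬ g.SameCycle x y := by
  constructor
  · rintro hw hg
    have hex : ∃ n, 1 ≤ n ∧ (g ^ n) x = y := by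
      obtain ⟨n, hn⟩ := hg.exists_pow_eq'
      refine ⟨n, Nat.one_le_iff_ne_zero.2 ?_, hn.2⟩
      rintro rfl
      exact hxy (by simpa using hn.2)
    classical
    set n := Nat.find hex with hn
    obtain ⟨hn1, hny⟩ := Nat.find_spec hex
    have key : ∀ i, 1 ≤ i → i < n → (g ^ i) x ≠ y ∧ (g ^ i) x ≠ x := by
      refine fun i hi hin => ⟨fun h => Nat.find_min hex hin ⟨hi, h⟩, fun h => ?_⟩
      refine Nat.find_min hex (m := n - i) (by omega) ⟨by omega, ?_⟩
      have h2 : (g ^ (n - i)) ((g ^ i) x) = y := by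
        rw [← mul_apply, ← pow_add, Nat.sub_add_cancel hin.le]
        exact hny
      rwa [h] at h2
    have hpow : ∀ i, 1 ≤ i → i ≤ n → ((g * swap x y) ^ i) y = (g ^ i) x := by
      intro i hi hin
      rw [swap_comm]
      exact mul_swap_pow_apply g key hi hin
    obtain ⟨j, hj⟩ := hw.symm.exists_pow_eq'
    have hfix : ((g * swap x y) ^ n) y = y := (hpow n hn1 le_rfl).trans hny
    have hmod : ((g * swap x y) ^ (j % n)) y = x := by
      have h3 : ((g * swap x y) ^ (n * (j / n))) y = y := by
        rw [pow_mul]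
        exact pow_apply_eq_self_of_apply_eq_self hfix _
      have h4 := hj.2
      rw [← Nat.mod_add_div j n, pow_add, mul_apply, h3] at h4
      exact h4
    rcases Nat.eq_zero_or_pos (j % n) with h0 | h0
    · rw [h0] at hmod
      exact hxy (by simpa using hmod.symm)
    · have hlt := Nat.mod_lt j hn1
      rw [hpow _ h0 hlt.le] at hmod
      exact (key _ h0 hlt).2 hmod
  · intro hg
    have hex : ∃ n, 1 ≤ n ∧ (g ^ n) y = y :=
      ⟨orderOf g, orderOf_pos g, by rw [pow_orderOf_eq_one]; rfl⟩
    classical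
    set n := Nat.find hex with hn
    obtain ⟨hn1, hny⟩ := Nat.find_spec hex
    refine ⟨n, ?_⟩
    rw [zpow_natCast, mul_swap_pow_apply g (n := n) ?_ hn1 le_rfl]
    · exact hny
    · refine fun i hi hin => ⟨fun h => hg ?_, fun h => Nat.find_min hex hin ⟨hi, h⟩⟩
      exact SameCycle.symm ⟨i, by rw [zpow_natCast]; exact h⟩

end Equiv.Perm

/-- `g` is obtained from `f` by identifying exactly the two different classes of `x` and `y`. -/
structure Merges {P α β : Type*} (f : P → α) (g : P → β) (x y : P) : Prop where
  surj_left : Function.Surjective f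
  surj_right : Function.Surjective g
  ne : f x ≠ f y
  eq_iff : ∀ u v, g u = g v ↔ f u = f v ∨ (f u = f x ∨ f u = f y) ∧ (f v = f x ∨ f v = f y)

namespace Merges

variable {P α β : Type*} {f : P → α} {g : P → β} {x y : P}

theorem eq (h : Merges f g x y) : g x = g y := (h.eq_iff x y).2 (by simp)

theorem eq_of_eq (h : Merges f g x y) {u v : P} (huv : f u = f v) : g u = g v :=
  (h.eq_iff u v).2 (Or.inl huv)

theorem right_eq_iff (h : Merges f g x y) (u : P) : g u = g x ↔ f u = f x ∨ f u = f y := by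
  rw [h.eq_iff]
  constructor
  · rintro (h | h)
    · exact Or.inl h
    · exact h.1
  · exact fun h => Or.inr ⟨h, Or.inl rfl⟩

theorem eq_of_right_eq (h : Merges f g x y) {u v : P} (hu : f u ≠ f x) (hu' : f u ≠ f y)
    (huv : g u = g v) : f u = f v := by
  rcases (h.eq_iff u v).1 huv with h | h
  · exact h
  · tauto

@[to_additive]
theorem prod_eq [Fintype α] [Fintype β] [DecidableEq α] [DecidableEq β] (h : Merges f g x y)
    {M : Type*} [CommMonoid M] (F : α → M) (G : β → M)
    (hFG : ∀ u, f u ≠ f x → f u ≠ f y → G (g u) = F (f u)) :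
    ∏ z ∈ (Finset.univ.erase (f x)).erase (f y), F z = ∏ z ∈ Finset.univ.erase (g x), G z := by
  have sf := Function.surjInv_eq h.surj_left
  have sg := Function.surjInv_eq h.surj_right
  refine Finset.prod_bij' (fun z _ => g (Function.surjInv h.surj_left z))
    (fun z _ => f (Function.surjInv h.surj_right z)) ?_ ?_ ?_ ?_ ?_
  · intro z hz
    simp only [Finset.mem_erase, Finset.mem_univ, and_true] at hz ⊢
    rw [Ne, h.right_eq_iff, sf]
    tauto
  · intro z hz
    simp only [Finset.mem_erase, Finset.mem_univ, and_true] at hz ⊢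
    have := h.right_eq_iff (Function.surjInv h.surj_right z)
    rw [sg] at this
    tauto
  · intro z hz
    simp only [Finset.mem_erase, Finset.mem_univ, and_true] at hz
    have := h.eq_of_right_eq (u := Function.surjInv h.surj_left z)
      (v := Function.surjInv h.surj_right (g (Function.surjInv h.surj_left z)))
      (by rw [sf]; exact hz.2) (by rw [sf]; exact hz.1)
      (by rw [sg])
    rw [← this, sf]
  · intro z hz
    have := h.eq_of_eq (u := Function.surjInv h.surj_left (f (Function.surjInv h.surj_right z)))
      (v := Function.surjInv h.surj_right z) (by rw [sf])
    rw [this, sg]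
  · intro z hz
    simp only [Finset.mem_erase, Finset.mem_univ, and_true] at hz
    rw [hFG, sf] <;> rw [sf] <;> tauto

@[to_additive]
theorem prod_left [Fintype α] [DecidableEq α] (h : Merges f g x y)
    {M : Type*} [CommMonoid M] (F : α → M) :
    ∏ z, F z = F (f x) * (F (f y) * ∏ z ∈ (Finset.univ.erase (f x)).erase (f y), F z) := by
  rw [Finset.mul_prod_erase _ _ (by simp [h.ne.symm]), Finset.mul_prod_erase _ _ (by simp)]

theorem card_eq [Finite α] [Finite β] (h : Merges f g x y) : Nat.card α = Nat.card β + 1 := by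
  classical
  have := Fintype.ofFinite α
  have := Fintype.ofFinite β
  have h2 := h.sum_eq (fun _ => 1) (fun _ => 1) (fun _ _ _ => rfl)
  simp only [Finset.sum_const, smul_eq_mul, mul_one] at h2
  rw [Finset.card_erase_of_mem (by simp [h.ne.symm]), Finset.card_erase_of_mem (by simp),
    Finset.card_erase_of_mem (by simp), Finset.card_univ, Finset.card_univ] at h2
  have h3 : 1 < Fintype.card α := Fintype.one_lt_card_iff.2 ⟨_, _, h.ne⟩
  have h4 : 0 < Fintype.card β := Fintype.card_pos_iff.2 ⟨g x⟩
  rw [Nat.card_eq_fintype_card, Nat.card_eq_fintype_card]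
  omega

open scoped Classical in
/-- Functions on the right that extend a given function on the classes away from `x` and `y`
are determined by their value at `x`. -/
theorem sum_right [Fintype β] [DecidableEq β] (h : Merges f g x y) {L M : Type*} [Fintype L]
    [AddCommMonoid M] (l : α → L) (c : L → M) :
    (∑ t : β → L, if ∀ u, f u ≠ f x → f u ≠ f y → t (g u) = l (f u) then c (t (g x)) else 0) =
      ∑ k, c k := by
  rw [← Finset.sum_filter]
  refine Finset.sum_bij' (fun t _ => t (g x))
    (fun k _ z => if z = g x then k else l (f (Function.surjInv h.surj_right z)))
    (fun _ _ => Finset.mem_univ _) ?_ ?_ ?_ (fun _ _ => rfl)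
  · intro k _
    refine Finset.mem_filter.2 ⟨Finset.mem_univ _, fun u hu hu' => ?_⟩
    have h1 : g u ≠ g x := by rw [Ne, h.right_eq_iff]; tauto
    beta_reduce
    rw [if_neg h1, h.eq_of_right_eq hu hu' (Function.surjInv_eq h.surj_right (g u)).symm]
  · intro t ht
    have ht := (Finset.mem_filter.1 ht).2
    ext z
    by_cases hz : z = g x
    · rw [if_pos hz, hz]
    · have hz' := Function.surjInv_eq h.surj_right z
      have h1 := h.right_eq_iff (Function.surjInv h.surj_right z)
      rw [hz'] at h1
      rw [if_neg hz, ← ht _ (by tauto) (by tauto), hz']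
  · intro k _
    exact if_pos rfl

open scoped Classical in
/-- Functions on the left that extend a given function on the classes away from `x` and `y`
are determined by their values at `x` and `y`. -/
theorem sum_left' [Fintype α] [DecidableEq α] (h : Merges f g x y) {L M : Type*} [Fintype L]
    [AddCommMonoid M] (l : β → L) (c : L → L → M) :
    (∑ t : α → L, if ∀ u, f u ≠ f x → f u ≠ f y → t (f u) = l (g u)
      then c (t (f x)) (t (f y)) else 0) = ∑ j, ∑ k, c j k := by
  rw [← Finset.sum_filter, ← Finset.sum_product' (f := c)]
  have sf := Function.surjInv_eq h.surj_left
  refine Finset.sum_bij' (fun t _ => (t (f x), t (f y)))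
    (fun k _ z => if z = f x then k.1 else if z = f y then k.2 else
      l (g (Function.surjInv h.surj_left z)))
    (fun _ _ => Finset.mem_product.2 ⟨Finset.mem_univ _, Finset.mem_univ _⟩) ?_ ?_ ?_
    (fun _ _ => rfl)
  · intro k _
    refine Finset.mem_filter.2 ⟨Finset.mem_univ _, fun u hu hu' => ?_⟩
    beta_reduce
    rw [if_neg hu, if_neg hu', h.eq_of_eq (sf (f u))]
  · intro t ht
    have ht := (Finset.mem_filter.1 ht).2
    ext z
    by_cases hz : z = f x
    · rw [if_pos hz, hz]
    · by_cases hz' : z = f y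
      · rw [if_neg hz, if_pos hz', hz']
      · rw [if_neg hz, if_neg hz', ← ht _ (by rwa [sf]) (by rwa [sf]), sf]
  · intro k _
    simp [h.ne.symm]

end Merges

namespace LinkDiagram

variable {ι : Type*} (D : LinkDiagram ι)

/-- The points from which the circles of all resolutions are glued: the darts and the crossingless
circles. -/
abbrev Point : Type _ := Dart ι ⊕ Fin D.loops

/-- The point given by the `k`-th dart at the crossing `a`. -/
def corner (a : ι) (k : ZMod 4) : D.Point := Sum.inl (a, k)

section

variable [LinearOrder ι]

theorem resolve_resolve (S : Finset ι) (d : Dart ι) : resolve S (resolve S d) = d := by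
  obtain ⟨a, k⟩ := d
  by_cases h : a ∈ S <;> simp [resolve, h]

theorem isOver_resolve (S : Finset ι) (d : Dart ι) : IsOver (resolve S d) ↔ ¬ IsOver d := by
  obtain ⟨a, k⟩ := d
  have h1 : ∀ k : ZMod 4, (3 - k = 1 ∨ 3 - k = 3) ↔ ¬ (k = 1 ∨ k = 3) := by decide
  have h2 : ∀ k : ZMod 4, (1 - k = 1 ∨ 1 - k = 3) ↔ ¬ (k = 1 ∨ k = 3) := by decide
  by_cases h : a ∈ S
  · simpa [resolve, h, IsOver] using h1 k
  · simpa [resolve, h, IsOver] using h2 k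

/-- The circle of `D(S)` through a point. -/
def circ (S : Finset ι) : D.Point → D.Circle S := Sum.map (Quot.mk _) id

theorem circ_surjective (S : Finset ι) : Function.Surjective (D.circ S) := by
  rintro (z | n)
  · obtain ⟨d, rfl⟩ := Quot.exists_rep z
    exact ⟨Sum.inl d, rfl⟩
  · exact ⟨Sum.inr n, rfl⟩

/-- The function on points is constant along the circles of `D(S)`. -/
structure Respects {β : Type*} (S : Finset ι) (f : D.Point → β) : Prop where
  edge : ∀ d, f (Sum.inl (D.edge d)) = f (Sum.inl d)
  resolve : ∀ d, f (Sum.inl (resolve S d)) = f (Sum.inl d)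

variable {D} {β γ : Type*} {S S' : Finset ι} {f : D.Point → β}

theorem respects_circ (S : Finset ι) : D.Respects S (D.circ S) where
  edge d := by
    refine congrArg Sum.inl (Eq.symm (Quot.sound ?_))
    exact Or.inl rfl
  resolve d := by
    refine congrArg Sum.inl (Eq.symm (Quot.sound ?_))
    exact Or.inr rfl

namespace Respects

theorem comp (hf : D.Respects S f) (g : β → γ) : D.Respects S (g ∘ f) where
  edge d := congrArg g (hf.edge d)
  resolve d := congrArg g (hf.resolve d)

theorem eq_of_circ_eq (hf : D.Respects S f) {u v : D.Point} (h : D.circ S u = D.circ S v) :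
    f u = f v := by
  let F : D.Circle S → β := Sum.elim (Quot.lift (fun d => f (Sum.inl d)) (by
    rintro d e (rfl | rfl)
    · exact (hf.edge d).symm
    · exact (hf.resolve d).symm)) (fun n => f (Sum.inr n))
  have hF : ∀ u, F (D.circ S u) = f u := by
    rintro (d | n) <;> rfl
  rw [← hF u, ← hF v, h]

theorem corner_of_notMem (hf : D.Respects S f) {a : ι} (ha : a ∉ S) :
    f (D.corner a 1) = f (D.corner a 0) ∧ f (D.corner a 3) = f (D.corner a 2) := by
  have h0 := hf.resolve (a, 0)
  have h2 := hf.resolve (a, 2)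
  simp only [LinkDiagram.resolve, ha, if_false, sub_zero] at h0 h2
  rw [show (1 : ZMod 4) - 2 = 3 from rfl] at h2
  exact ⟨h0, h2⟩

theorem corner_of_mem (hf : D.Respects S f) {a : ι} (ha : a ∈ S) :
    f (D.corner a 3) = f (D.corner a 0) ∧ f (D.corner a 1) = f (D.corner a 2) := by
  have h0 := hf.resolve (a, 0)
  have h2 := hf.resolve (a, 2)
  simp only [LinkDiagram.resolve, ha, if_true, sub_zero] at h0 h2
  rw [show (3 : ZMod 4) - 2 = 1 from rfl] at h2
  exact ⟨h0, h2⟩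

theorem corner_eq_or (hf : D.Respects S f) (a : ι) (k : ZMod 4) :
    f (D.corner a k) = f (D.corner a 0) ∨ f (D.corner a k) = f (D.corner a 2) := by
  have hk : ∀ k : ZMod 4, k = 0 ∨ k = 1 ∨ k = 2 ∨ k = 3 := by decide
  by_cases ha : a ∈ S
  · obtain ⟨h3, h1⟩ := hf.corner_of_mem ha
    rcases hk k with rfl | rfl | rfl | rfl <;> simp [h1, h3]
  · obtain ⟨h1, h3⟩ := hf.corner_of_notMem ha
    rcases hk k with rfl | rfl | rfl | rfl <;> simp [h1, h3]

theorem change (hf : D.Respects S f) {a : ι} (h : ∀ b, b ≠ a → (b ∈ S ↔ b ∈ S'))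
    (ha : f (D.corner a 0) = f (D.corner a 2)) : D.Respects S' f where
  edge := hf.edge
  resolve := by
    rintro ⟨b, k⟩
    by_cases hb : b = a
    · subst hb
      have key : ∀ k, f (D.corner b k) = f (D.corner b 0) := fun k => by
        rcases hf.corner_eq_or b k with h | h <;> simp [h, ha]
      exact (key _).trans (key k).symm
    · rw [← hf.resolve (b, k)]
      simp only [LinkDiagram.resolve, h b hb]

end Respects

theorem merges_circ {a : ι} (h : ∀ b, b ≠ a → (b ∈ S ↔ b ∈ S'))
    (hS : D.circ S (D.corner a 0) ≠ D.circ S (D.corner a 2))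
    (hS' : D.circ S' (D.corner a 0) = D.circ S' (D.corner a 2)) :
    Merges (D.circ S) (D.circ S') (D.corner a 0) (D.corner a 2) where
  surj_left := D.circ_surjective S
  surj_right := D.circ_surjective S'
  ne := hS
  eq_iff u v := by
    have hr : D.Respects S (D.circ S') :=
      (respects_circ S').change (fun b hb => (h b hb).symm) hS'
    constructor
    · intro huv
      classical
      let m : D.Circle S → D.Circle S := fun z =>
        if z = D.circ S (D.corner a 2) then D.circ S (D.corner a 0) else z
      have hm : D.Respects S' (m ∘ D.circ S) := by
        refine ((respects_circ S).comp m).change h ?_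
        simp [m, hS]
      have h1 := hm.eq_of_circ_eq huv
      simp only [Function.comp_apply, m] at h1
      split_ifs at h1 with h2 h3 h3
      · exact Or.inl (h2.trans h3.symm)
      · exact Or.inr ⟨Or.inr h2, Or.inl h1.symm⟩
      · exact Or.inr ⟨Or.inl h1, Or.inr h3⟩
      · exact Or.inl h1
    · rintro (huv | ⟨hu, hv⟩)
      · exact hr.eq_of_circ_eq huv
      · have key : ∀ w, (D.circ S w = D.circ S (D.corner a 0) ∨
            D.circ S w = D.circ S (D.corner a 2)) → D.circ S' w = D.circ S' (D.corner a 0) := by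
          rintro w (hw | hw)
          · exact hr.eq_of_circ_eq hw
          · exact (hr.eq_of_circ_eq hw).trans hS'.symm
        exact (key u hu).trans (key v hv).symm

/-- The two strands of the resolved crossing `a` belong to the same circle of `D(S)`. -/
def SameAt (D : LinkDiagram ι) (S : Finset ι) (a : ι) : Prop :=
  D.circ S (D.corner a 0) = D.circ S (D.corner a 2)

open scoped Classical in
/-- The permutation that moves every under-dart along its circle in `D(S)` to the next
under-dart, and fixes the over-darts. -/
noncomputable def underPerm (halt : D.Alternating) (S : Finset ι) : Equiv.Perm (Dart ι) where
  toFun d := if IsOver d then d else D.edge (resolve S d)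
  invFun d := if IsOver d then d else resolve S (D.edge d)
  left_inv d := by
    have h1 := halt (resolve S d)
    have h2 := isOver_resolve S d
    by_cases hd : IsOver d
    · simp [hd]
    · simp [hd, h1, h2, D.edge_edge, resolve_resolve]
  right_inv d := by
    have h1 := halt d
    have h2 := isOver_resolve S (D.edge d)
    by_cases hd : IsOver d
    · simp [hd]
    · simp [hd, h1, h2, D.edge_edge, resolve_resolve]

theorem underPerm_apply (halt : D.Alternating) {d : Dart ι} (hd : ¬ IsOver d) :
    underPerm halt S d = D.edge (resolve S d) := by
  simp [underPerm, hd]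

theorem underPerm_apply_of_isOver (halt : D.Alternating) {d : Dart ι} (hd : IsOver d) :
    underPerm halt S d = d := by
  simp [underPerm, hd]

theorem underPerm_insert (halt : D.Alternating) {a : ι} (ha : a ∉ S) :
    underPerm halt (insert a S) = underPerm halt S * Equiv.swap (a, 0) (a, 2) := by
  have h0 : ¬ IsOver ((a, 0) : Dart ι) := by
    rw [IsOver]; show ¬ ((0 : ZMod 4) = 1 ∨ (0 : ZMod 4) = 3); decide
  have h2 : ¬ IsOver ((a, 2) : Dart ι) := by
    rw [IsOver]; show ¬ ((2 : ZMod 4) = 1 ∨ (2 : ZMod 4) = 3); decide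
  ext1 d
  rw [Equiv.Perm.mul_apply]
  by_cases hd : IsOver d
  · rw [Equiv.swap_apply_of_ne_of_ne, underPerm_apply_of_isOver halt hd,
      underPerm_apply_of_isOver halt hd]
    · rintro rfl; exact h0 hd
    · rintro rfl; exact h2 hd
  · rw [underPerm_apply halt hd]
    by_cases hda : d.1 = a
    · obtain ⟨b, k⟩ := d
      obtain rfl : b = a := hda
      have hk : ∀ k : ZMod 4, ¬ (k = 1 ∨ k = 3) → k = 0 ∨ k = 2 := by decide
      rcases hk k hd with rfl | rfl
      · rw [Equiv.swap_apply_left, underPerm_apply halt h2]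
        simp only [resolve, Finset.mem_insert_self, if_true, ha, if_false]
        rfl
      · rw [Equiv.swap_apply_right, underPerm_apply halt h0]
        simp only [resolve, Finset.mem_insert_self, if_true, ha, if_false]
        rfl
    · rw [Equiv.swap_apply_of_ne_of_ne, underPerm_apply halt hd]
      · simp [resolve, hda]
      · rintro rfl; exact hda rfl
      · rintro rfl; exact hda rfl

theorem circ_eq_iff_sameCycle (halt : D.Alternating) {d e : Dart ι} (hd : ¬ IsOver d)
    (he : ¬ IsOver e) :
    D.circ S (Sum.inl d) = D.circ S (Sum.inl e) ↔ (underPerm halt S).SameCycle d e := by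
  classical
  constructor
  · intro h
    let f : D.Point → Quotient (Equiv.Perm.SameCycle.setoid (underPerm halt S)) ⊕ Fin D.loops :=
      Sum.map (fun d => Quotient.mk _ (if IsOver d then resolve S d else d)) id
    have hf : D.Respects S f := by
      constructor
      · intro d
        refine congrArg Sum.inl (Quotient.sound ?_)
        show (underPerm halt S).SameCycle _ _
        have h1 := halt d
        by_cases hd : IsOver d
        · have h2 : ¬ IsOver (resolve S d) := by rw [isOver_resolve]; exact not_not.2 hd
          rw [if_pos hd, if_neg (by tauto)]
          refine Equiv.Perm.SameCycle.symm ⟨1, ?_⟩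
          rw [zpow_one, underPerm_apply halt h2, resolve_resolve]
        · rw [if_neg hd, if_pos (h1.2 hd)]
          refine ⟨1, ?_⟩
          rw [zpow_one, underPerm_apply halt, resolve_resolve, D.edge_edge]
          rw [isOver_resolve]
          tauto
      · intro d
        have h1 := isOver_resolve S d
        by_cases hd : IsOver d
        · have h2 : ¬ IsOver (resolve S d) := by tauto
          simp [f, hd, h2]
        · have h2 : IsOver (resolve S d) := h1.2 hd
          simp [f, hd, h2, resolve_resolve]
    have h1 := hf.eq_of_circ_eq h
    simp only [f, Sum.map_inl, hd, he, if_false, Sum.inl.injEq] at h1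
    exact Quotient.exact h1
  · have key : ∀ d, D.circ S (Sum.inl (underPerm halt S d)) = D.circ S (Sum.inl d) := by
      intro d
      by_cases hd : IsOver d
      · rw [underPerm_apply_of_isOver halt hd]
      · rw [underPerm_apply halt hd, (respects_circ S).edge, (respects_circ S).resolve]
    rintro ⟨n, rfl⟩
    have hz : ∀ n : ℤ, D.circ S (Sum.inl ((underPerm halt S ^ n) d)) = D.circ S (Sum.inl d) := by
      intro n
      induction n using Int.induction_on with
      | zero => simp
      | succ n ih => rw [add_comm, zpow_add, zpow_one, Equiv.Perm.mul_apply, key, ih]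
      | pred n ih =>
        rw [← ih, ← key ((underPerm halt S ^ (-(n : ℤ) - 1)) d), ← Equiv.Perm.mul_apply,
          ← zpow_one_add]
        congr 3
        ring_nf
    exact (hz n).symm

theorem sameAt_insert_iff [Finite ι] (halt : D.Alternating) {a : ι} (ha : a ∉ S) :
    D.SameAt (insert a S) a ↔ ¬ D.SameAt S a := by
  have h0 : ¬ IsOver ((a, 0) : Dart ι) := by
    rw [IsOver]; show ¬ ((0 : ZMod 4) = 1 ∨ (0 : ZMod 4) = 3); decide
  have h2 : ¬ IsOver ((a, 2) : Dart ι) := by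
    rw [IsOver]; show ¬ ((2 : ZMod 4) = 1 ∨ (2 : ZMod 4) = 3); decide
  rw [SameAt, SameAt, corner, corner, circ_eq_iff_sameCycle halt h0 h2,
    circ_eq_iff_sameCycle halt h0 h2, underPerm_insert halt ha]
  have : Finite (ZMod 4) := inferInstanceAs (Finite (Fin 4))
  refine Equiv.Perm.sameCycle_mul_swap_iff _ ?_
  intro h
  have h02 : (0 : ZMod 4) ≠ 2 := by decide
  exact h02 (Prod.ext_iff.1 h).2

theorem merges_insert [Finite ι] (halt : D.Alternating) {a : ι} (ha : a ∉ S)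
    (hs : ¬ D.SameAt S a) :
    Merges (D.circ S) (D.circ (insert a S)) (D.corner a 0) (D.corner a 2) :=
  merges_circ (fun b hb => by simp [hb]) hs ((sameAt_insert_iff halt ha).2 hs)

theorem splits_insert [Finite ι] (halt : D.Alternating) {a : ι} (ha : a ∉ S)
    (hs : D.SameAt S a) :
    Merges (D.circ (insert a S)) (D.circ S) (D.corner a 0) (D.corner a 2) :=
  merges_circ (fun b hb => by simp [hb])
    (fun h => (sameAt_insert_iff halt ha).1 h hs) hs

end

end LinkDiagram

theorem Nat.card_eq_of_kernel_eq {P α β : Type*} {f : P → α} {g : P → β}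
    (hf : Function.Surjective f) (hg : Function.Surjective g)
    (h : ∀ u v, f u = f v ↔ g u = g v) : Nat.card α = Nat.card β := by
  refine Nat.card_congr (Equiv.ofBijective (fun z => g (Function.surjInv hf z)) ⟨?_, ?_⟩)
  · intro z w hzw
    have := (h _ _).2 hzw
    rwa [Function.surjInv_eq hf, Function.surjInv_eq hf] at this
  · intro z
    obtain ⟨u, rfl⟩ := hg z
    exact ⟨f u, (h _ _).1 (Function.surjInv_eq hf _)⟩

namespace LinkDiagram

variable {ι : Type*} [LinearOrder ι] (D : LinkDiagram ι)

/-- The equivalence relation on points whose classes are the components of the graph with the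
circles of `D(∅)` as vertices and the crossings in `S` as edges. -/
def link (S : Finset ι) : Setoid D.Point :=
  Relation.EqvGen.setoid fun u v =>
    D.circ ∅ u = D.circ ∅ v ∨ ∃ a ∈ S, u = D.corner a 0 ∧ v = D.corner a 2

/-- The components of the graph with the circles of `D(∅)` as vertices and the crossings in `S` as
edges. -/
abbrev Comp (S : Finset ι) : Type _ := Quotient (D.link S)

/-- The component to which a point belongs. -/
def cmp (S : Finset ι) (u : D.Point) : D.Comp S := Quotient.mk _ u

/-- The crossing `a` joins two circles of `D(∅)` in the same component of the graph given by `S`. -/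
def LinkedAt (S : Finset ι) (a : ι) : Prop :=
  D.cmp S (D.corner a 0) = D.cmp S (D.corner a 2)

variable {D} {S S' : Finset ι} {β : Type*} {f : D.Point → β}

theorem cmp_surjective (S : Finset ι) : Function.Surjective (D.cmp S) := Quotient.mk_surjective

theorem eq_of_cmp_eq (hf : D.Respects ∅ f) (h : ∀ a ∈ S, f (D.corner a 0) = f (D.corner a 2))
    {u v : D.Point} (huv : D.cmp S u = D.cmp S v) : f u = f v := by
  have h1 : Relation.EqvGen _ u v := Quotient.exact huv
  clear huv
  induction h1 with
  | rel u v h1 =>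
    rcases h1 with h1 | ⟨a, ha, rfl, rfl⟩
    · exact hf.eq_of_circ_eq h1
    · exact h a ha
  | refl u => rfl
  | symm u v _ ih => exact ih.symm
  | trans u v w _ _ ih1 ih2 => exact ih1.trans ih2

theorem cmp_eq_of_circ_empty_eq {u v : D.Point} (h : D.circ ∅ u = D.circ ∅ v) :
    D.cmp S u = D.cmp S v := Quotient.sound (Relation.EqvGen.rel _ _ (Or.inl h))

theorem linkedAt_of_mem {a : ι} (ha : a ∈ S) : D.LinkedAt S a :=
  Quotient.sound (Relation.EqvGen.rel _ _ (Or.inr ⟨a, ha, rfl, rfl⟩))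

theorem respects_empty_cmp (S : Finset ι) : D.Respects ∅ (D.cmp S) where
  edge d := cmp_eq_of_circ_empty_eq ((respects_circ ∅).edge d)
  resolve d := cmp_eq_of_circ_empty_eq ((respects_circ ∅).resolve d)

theorem cmp_corner {a : ι} (h : D.LinkedAt S a) (k : ZMod 4) :
    D.cmp S (D.corner a k) = D.cmp S (D.corner a 0) := by
  rcases (respects_empty_cmp S).corner_eq_or a k with hk | hk
  · exact hk
  · exact hk.trans (Eq.symm h)

theorem respects_cmp (S : Finset ι) : D.Respects S (D.cmp S) where
  edge := (respects_empty_cmp S).edge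
  resolve := by
    rintro ⟨a, k⟩
    by_cases ha : a ∈ S
    · exact (cmp_corner (linkedAt_of_mem ha) _).trans (cmp_corner (linkedAt_of_mem ha) k).symm
    · rw [← (respects_empty_cmp S).resolve (a, k)]
      simp [resolve, ha]

theorem cmp_mono (h : S ⊆ S') {u v : D.Point} (huv : D.cmp S u = D.cmp S v) :
    D.cmp S' u = D.cmp S' v :=
  eq_of_cmp_eq (respects_empty_cmp S') (fun _ ha => linkedAt_of_mem (h ha)) huv

theorem LinkedAt.mono {a : ι} (h : S ⊆ S') (ha : D.LinkedAt S a) : D.LinkedAt S' a :=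
  cmp_mono h ha

theorem linkedAt_of_sameAt {a : ι} (h : D.SameAt S a) : D.LinkedAt S a :=
  (respects_cmp S).eq_of_circ_eq h

theorem merges_cmp {a : ι} (ha : ¬ D.LinkedAt S a) :
    Merges (D.cmp S) (D.cmp (insert a S)) (D.corner a 0) (D.corner a 2) where
  surj_left := cmp_surjective S
  surj_right := cmp_surjective _
  ne := ha
  eq_iff u v := by
    have hmono : ∀ {u v}, D.cmp S u = D.cmp S v → D.cmp (insert a S) u = D.cmp (insert a S) v :=
      cmp_mono (Finset.subset_insert a S)
    have hmem : D.LinkedAt (insert a S) a := linkedAt_of_mem (Finset.mem_insert_self a S)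
    constructor
    · intro huv
      classical
      let m : D.Comp S → D.Comp S := fun z =>
        if z = D.cmp S (D.corner a 2) then D.cmp S (D.corner a 0) else z
      have h1 := eq_of_cmp_eq (f := m ∘ D.cmp S) ((respects_empty_cmp S).comp m) (by
        intro b hb
        rcases Finset.mem_insert.1 hb with rfl | hb
        · have : D.cmp S (D.corner b 0) ≠ D.cmp S (D.corner b 2) := ha
          simp [m, this]
        · exact congrArg m (linkedAt_of_mem hb)) huv
      simp only [Function.comp_apply, m] at h1
      split_ifs at h1 with h2 h3 h3
      · exact Or.inl (h2.trans h3.symm)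
      · exact Or.inr ⟨Or.inr h2, Or.inl h1.symm⟩
      · exact Or.inr ⟨Or.inl h1, Or.inr h3⟩
      · exact Or.inl h1
    · rintro (huv | ⟨hu, hv⟩)
      · exact hmono huv
      · have key : ∀ w, (D.cmp S w = D.cmp S (D.corner a 0) ∨
            D.cmp S w = D.cmp S (D.corner a 2)) →
            D.cmp (insert a S) w = D.cmp (insert a S) (D.corner a 0) := by
          rintro w (hw | hw)
          · exact hmono hw
          · exact (hmono hw).trans (Eq.symm hmem)
        exact (key u hu).trans (key v hv).symm

theorem cmp_insert_iff {a : ι} (ha : D.LinkedAt S a) (u v : D.Point) :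
    D.cmp (insert a S) u = D.cmp (insert a S) v ↔ D.cmp S u = D.cmp S v := by
  refine ⟨eq_of_cmp_eq (respects_empty_cmp S) ?_, cmp_mono (Finset.subset_insert a S)⟩
  intro b hb
  rcases Finset.mem_insert.1 hb with rfl | hb
  · exact ha
  · exact linkedAt_of_mem hb

variable (D) in
/-- The number of circles of `D(S)`. -/
noncomputable def circles (S : Finset ι) : ℕ := Nat.card (D.Circle S)

variable (D) in
/-- The number of components of the graph with the circles of `D(∅)` as vertices and the crossings
in `S` as edges. -/
noncomputable def comps (S : Finset ι) : ℕ := Nat.card (D.Comp S)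

theorem comps_insert_of_linkedAt {a : ι} (ha : D.LinkedAt S a) :
    D.comps (insert a S) = D.comps S :=
  Nat.card_eq_of_kernel_eq (cmp_surjective _) (cmp_surjective _) (cmp_insert_iff ha)

theorem comps_empty : D.comps ∅ = D.circles ∅ := by
  refine Nat.card_eq_of_kernel_eq (cmp_surjective _) (D.circ_surjective _) fun u v => ⟨?_, ?_⟩
  · exact eq_of_cmp_eq (respects_circ ∅) (by simp)
  · exact cmp_eq_of_circ_empty_eq

variable [Fintype ι]

theorem finite_dart : Finite (Dart ι) :=
  have : Finite (ZMod 4) := inferInstanceAs (Finite (Fin 4))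
  inferInstance

instance : Finite D.Point :=
  have : Finite (Dart ι) := finite_dart
  inferInstance

instance (S : Finset ι) : Finite (D.Circle S) := Finite.of_surjective _ (D.circ_surjective S)

instance (S : Finset ι) : Finite (D.Comp S) := Finite.of_surjective _ (cmp_surjective S)

theorem comps_insert_of_not_linkedAt {a : ι} (ha : ¬ D.LinkedAt S a) :
    D.comps S = D.comps (insert a S) + 1 := (merges_cmp ha).card_eq

theorem circles_insert_of_not_sameAt (halt : D.Alternating) {a : ι} (ha : a ∉ S)
    (hs : ¬ D.SameAt S a) : D.circles S = D.circles (insert a S) + 1 :=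
  (merges_insert halt ha hs).card_eq

theorem circles_insert_of_sameAt (halt : D.Alternating) {a : ι} (ha : a ∉ S)
    (hs : D.SameAt S a) : D.circles (insert a S) = D.circles S + 1 :=
  (splits_insert halt ha hs).card_eq

theorem comps_univ : D.comps Finset.univ = Nat.card D.Piece := by
  let g : D.Point → D.Piece := Sum.map (fun d => Quot.mk _ d.1) id
  refine Nat.card_eq_of_kernel_eq (cmp_surjective _) (g := g) ?_ fun u v => ⟨?_, ?_⟩
  · rintro (z | n)
    · obtain ⟨a, rfl⟩ := Quot.exists_rep z
      exact ⟨D.corner a 0, rfl⟩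
    · exact ⟨Sum.inr n, rfl⟩
  · refine eq_of_cmp_eq (f := g) ⟨fun d => ?_, fun d => rfl⟩ fun a _ => rfl
    refine congrArg Sum.inl (Eq.symm (Quot.sound ?_))
    exact ⟨d.2, (D.edge d).2, rfl⟩
  · intro h
    have hl : ∀ a, D.LinkedAt Finset.univ a := fun a => linkedAt_of_mem (Finset.mem_univ a)
    let F : D.Piece → D.Comp Finset.univ := Sum.elim
      (Quot.lift (fun a => D.cmp Finset.univ (D.corner a 0)) (by
        rintro a b ⟨k, l, hkl⟩
        have h1 := (respects_empty_cmp (D := D) Finset.univ).edge (a, k)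
        rw [hkl] at h1
        exact (cmp_corner (hl a) k).symm.trans (h1.symm.trans (cmp_corner (hl b) l))))
      (fun n => D.cmp Finset.univ (Sum.inr n))
    have hF : ∀ u, F (g u) = D.cmp Finset.univ u := by
      rintro (⟨a, k⟩ | n)
      · exact (cmp_corner (hl a) k).symm
      · rfl
    rw [← hF u, ← hF v, h]

theorem resolve_empty_of_not_isOver {d : Dart ι} (hd : ¬ IsOver d) :
    resolve ∅ d = (d.1, d.2 + 1) := by
  have h : ∀ k : ZMod 4, ¬ (k = 1 ∨ k = 3) → 1 - k = k + 1 := by decide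
  simp [resolve, h d.2 hd]

theorem resolve_univ_of_isOver {d : Dart ι} (hd : IsOver d) :
    resolve Finset.univ d = (d.1, d.2 + 1) := by
  have h : ∀ k : ZMod 4, (k = 1 ∨ k = 3) → 3 - k = k + 1 := by decide
  simp [resolve, h d.2 hd]

open scoped Classical in
/-- The faces of an alternating diagram are the circles of the two extreme resolutions. -/
theorem card_faces (halt : D.Alternating) :
    Nat.card (Quot fun d e : Dart ι => e = ((D.edge d).1, (D.edge d).2 + 1)) =
      Nat.card (Quot fun d e : Dart ι => e = D.edge d ∨ e = resolve ∅ d) +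
      Nat.card (Quot fun d e : Dart ι => e = D.edge d ∨ e = resolve Finset.univ d) := by
  have : Finite (Dart ι) := finite_dart
  rw [← Nat.card_sum]
  set rf := fun d e : Dart ι => e = ((D.edge d).1, (D.edge d).2 + 1) with hrf
  have hface : ∀ d, Quot.mk rf (D.edge d) = Quot.mk rf (d.1, d.2 + 1) := fun d => by
    refine Quot.sound ?_
    simp only [hrf, D.edge_edge]
  refine Nat.card_congr
    { toFun := Quot.lift (fun d => if IsOver d then Sum.inl (Quot.mk _ d) else
        Sum.inr (Quot.mk _ d)) ?_
      invFun := Sum.elim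
        (Quot.lift (fun d => if IsOver d then Quot.mk rf d else Quot.mk rf (D.edge d)) ?_)
        (Quot.lift (fun d => if IsOver d then Quot.mk rf (D.edge d) else Quot.mk rf d) ?_)
      left_inv := ?_
      right_inv := ?_ }
  · rintro d e rfl
    by_cases hd : IsOver d
    · have h1 : ¬ IsOver (D.edge d) := fun h => (halt d).1 h hd
      have h2 := isOver_resolve ∅ (D.edge d)
      rw [← resolve_empty_of_not_isOver h1, if_pos hd, if_pos (h2.2 h1)]
      refine congrArg Sum.inl ((Quot.sound (b := D.edge d) (Or.inl rfl)).trans ?_)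
      exact Quot.sound (Or.inr rfl)
    · have h1 : IsOver (D.edge d) := (halt d).2 hd
      have h2 := isOver_resolve Finset.univ (D.edge d)
      rw [← resolve_univ_of_isOver h1, if_neg hd, if_neg (fun h => h2.1 h h1)]
      refine congrArg Sum.inr ((Quot.sound (b := D.edge d) (Or.inl rfl)).trans ?_)
      exact Quot.sound (Or.inr rfl)
  · rintro d e (rfl | rfl)
    · have h1 := halt d
      by_cases hd : IsOver d
      · rw [if_pos hd, if_neg (fun h => h1.1 h hd), D.edge_edge]
      · rw [if_neg hd, if_pos (h1.2 hd)]
    · have h1 := isOver_resolve ∅ d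
      by_cases hd : IsOver d
      · have h2 : ¬ IsOver (resolve ∅ d) := fun h => h1.1 h hd
        rw [if_pos hd, if_neg h2, hface, ← resolve_empty_of_not_isOver h2, resolve_resolve]
      · rw [if_neg hd, if_pos (h1.2 hd), hface, ← resolve_empty_of_not_isOver hd]
  · rintro d e (rfl | rfl)
    · have h1 := halt d
      by_cases hd : IsOver d
      · rw [if_pos hd, if_neg (fun h => h1.1 h hd)]
      · rw [if_neg hd, if_pos (h1.2 hd), D.edge_edge]
    · have h1 := isOver_resolve Finset.univ d
      by_cases hd : IsOver d
      · have h2 : ¬ IsOver (resolve Finset.univ d) := fun h => h1.1 h hd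
        rw [if_pos hd, if_neg h2, hface, ← resolve_univ_of_isOver hd]
      · have h2 : IsOver (resolve Finset.univ d) := h1.2 hd
        rw [if_neg hd, if_pos h2, hface, ← resolve_univ_of_isOver h2, resolve_resolve]
  · intro z
    obtain ⟨d, rfl⟩ := Quot.exists_rep z
    by_cases hd : IsOver d <;> simp [hd]
  · rintro (z | z) <;> obtain ⟨d, rfl⟩ := Quot.exists_rep z
    · by_cases hd : IsOver d
      · simp [hd]
      · have h1 : IsOver (D.edge d) := (halt d).2 hd
        simp only [Sum.elim_inl, hd, if_false, h1, if_true]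
        exact congrArg Sum.inl (Eq.symm (Quot.sound (Or.inl rfl)))
    · by_cases hd : IsOver d
      · have h1 : ¬ IsOver (D.edge d) := fun h => (halt d).1 h hd
        simp only [Sum.elim_inr, hd, if_false, h1, if_true]
        exact congrArg Sum.inr (Eq.symm (Quot.sound (Or.inl rfl)))
      · simp [hd]

theorem circles_empty_add_circles_univ (halt : D.Alternating) :
    D.circles ∅ + D.circles Finset.univ = Fintype.card ι + 2 * Nat.card D.Piece := by
  have : Finite (Dart ι) := finite_dart
  have h := D.planar
  rw [card_faces halt, Nat.card_eq_fintype_card (α := ι)] at h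
  rw [circles, circles, Nat.card_sum, Nat.card_sum, Nat.card_sum, Nat.card_eq_fintype_card (α := Fin _),
    Fintype.card_fin]
  omega

variable (D) in
/-- Twice the genus of the surface obtained from the discs bounded by the circles of `D(∅)`
by attaching a band at each crossing in `S`, and closing it up. -/
noncomputable def defect (S : Finset ι) : ℤ :=
  2 * D.comps S + S.card - D.circles ∅ - D.circles S

theorem defect_insert (halt : D.Alternating) {a : ι} (ha : a ∉ S) :
    D.defect S ≤ D.defect (insert a S) ∧
      (D.LinkedAt S a → ¬ D.SameAt S a → D.defect S < D.defect (insert a S)) := by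
  rw [defect, defect, Finset.card_insert_of_notMem ha]
  by_cases hl : D.LinkedAt S a
  · rw [comps_insert_of_linkedAt hl]
    by_cases hs : D.SameAt S a
    · rw [circles_insert_of_sameAt halt ha hs]
      push_cast
      exact ⟨by linarith, fun _ h => absurd hs h⟩
    · rw [circles_insert_of_not_sameAt halt ha hs]
      push_cast
      exact ⟨by linarith, fun _ _ => by linarith⟩
  · have hs : ¬ D.SameAt S a := fun h => hl (linkedAt_of_sameAt h)
    rw [comps_insert_of_not_linkedAt hl, circles_insert_of_not_sameAt halt ha hs]
    push_cast
    exact ⟨by linarith, fun h => absurd h hl⟩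

theorem defect_mono (halt : D.Alternating) (h : S ⊆ S') : D.defect S ≤ D.defect S' := by
  suffices key : ∀ T, D.defect S ≤ D.defect (S ∪ T) by
    have := key S'
    rwa [Finset.union_eq_right.2 h] at this
  intro T
  induction T using Finset.induction_on with
  | empty => simp
  | insert a T _ ih =>
    rw [Finset.union_insert]
    by_cases ha : a ∈ S ∪ T
    · rwa [Finset.insert_eq_self.2 ha]
    · exact ih.trans (defect_insert halt ha).1

theorem defect_eq_zero (halt : D.Alternating) (S : Finset ι) : D.defect S = 0 := by
  have h0 : D.defect ∅ = 0 := by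
    rw [defect, comps_empty, Finset.card_empty]
    push_cast
    ring
  have h1 : D.defect Finset.univ = 0 := by
    have h := circles_empty_add_circles_univ halt
    rw [defect, comps_univ, Finset.card_univ]
    have h' : (D.circles ∅ : ℤ) + D.circles Finset.univ =
      Fintype.card ι + 2 * Nat.card D.Piece := by exact_mod_cast h
    linarith
  have h2 := defect_mono halt (Finset.empty_subset S)
  have h3 := defect_mono halt (Finset.subset_univ S)
  linarith

theorem sameAt_iff_linkedAt (halt : D.Alternating) {a : ι} (ha : a ∉ S) :
    D.SameAt S a ↔ D.LinkedAt S a := by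
  refine ⟨linkedAt_of_sameAt, fun h => ?_⟩
  by_contra hs
  have := (defect_insert halt ha).2 h hs
  rw [defect_eq_zero halt, defect_eq_zero halt] at this
  exact lt_irrefl _ this

end LinkDiagram

/-- A bounded cochain complex over `ℚ` with a finite basis `X`, given by the matrix of
its differential. -/
structure BasedComplex (X : Type*) [Fintype X] where
  /-- the coefficient of `t` in the differential of `s` -/
  coeff : X → X → ℚ
  /-- the cohomological degree -/
  deg : X → ℤ
  deg_eq : ∀ {s t}, coeff s t ≠ 0 → deg t = deg s + 1
  sum_coeff_mul : ∀ s u, ∑ t, coeff s t * coeff t u = 0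

namespace BasedComplex

variable {X : Type*} [Fintype X] (C : BasedComplex X)

/-- A set of basis elements that spans a subquotient complex. -/
def Convex (Q : Set X) : Prop :=
  ∀ s ∈ Q, ∀ u ∈ Q, ∀ t, C.coeff s t ≠ 0 → C.coeff t u ≠ 0 → t ∈ Q

/-- The cochains of degree `i` of the subquotient complex spanned by `Q`. -/
def supp (Q : Set X) (i : ℤ) : Submodule ℚ (X → ℚ) where
  carrier := {f | ∀ x, f x ≠ 0 → x ∈ Q ∧ C.deg x = i}
  add_mem' {f g} hf hg x hx := by
    by_cases h : f x = 0
    · exact hg x (by simpa [h] using hx)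
    · exact hf x h
  zero_mem' x hx := absurd rfl hx
  smul_mem' c f hf x hx := hf x (right_ne_zero_of_mul hx)

open scoped Classical in
/-- Restriction of a function to `Q`. -/
noncomputable def res (Q : Set X) : (X → ℚ) →ₗ[ℚ] (X → ℚ) where
  toFun f x := if x ∈ Q then f x else 0
  map_add' f g := by ext x; by_cases h : x ∈ Q <;> simp [h]
  map_smul' c f := by ext x; by_cases h : x ∈ Q <;> simp [h]

/-- The differential of the subquotient complex spanned by `Q`. -/
noncomputable def dif (Q : Set X) : (X → ℚ) →ₗ[ℚ] (X → ℚ) :=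
  res Q ∘ₗ Matrix.mulVecLin (Matrix.of fun t s => C.coeff s t)

variable {C} {Q Q0 Q1 : Set X} {i : ℤ} {f g : X → ℚ}

theorem res_apply_of_mem {x : X} (hx : x ∈ Q) : res Q f x = f x := if_pos hx

theorem res_apply_of_notMem {x : X} (hx : x ∉ Q) : res Q f x = 0 := if_neg hx

theorem dif_apply_of_mem {t : X} (ht : t ∈ Q) : C.dif Q f t = ∑ s, C.coeff s t * f s :=
  (res_apply_of_mem ht).trans rfl

theorem dif_apply_of_notMem {t : X} (ht : t ∉ Q) : C.dif Q f t = 0 := res_apply_of_notMem ht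

theorem supp_mono (h : Q0 ⊆ Q) : C.supp Q0 i ≤ C.supp Q i :=
  fun _ hf x hx => ⟨h (hf x hx).1, (hf x hx).2⟩

theorem dif_mem (hf : f ∈ C.supp Q i) : C.dif Q f ∈ C.supp Q (i + 1) := by
  intro t ht
  by_cases hQ : t ∈ Q
  · refine ⟨hQ, ?_⟩
    rw [dif_apply_of_mem hQ] at ht
    obtain ⟨s, -, hs⟩ := Finset.exists_ne_zero_of_sum_ne_zero ht
    rw [C.deg_eq (left_ne_zero_of_mul hs), (hf s (right_ne_zero_of_mul hs)).2]
  · exact absurd (dif_apply_of_notMem hQ) ht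

theorem dif_mem' (hf : f ∈ C.supp Q (i - 1)) : C.dif Q f ∈ C.supp Q i := by
  simpa using dif_mem hf

theorem dif_dif (hQ : C.Convex Q) (hf : f ∈ C.supp Q i) : C.dif Q (C.dif Q f) = 0 := by
  ext u
  by_cases hu : u ∈ Q
  · rw [dif_apply_of_mem hu]
    have h1 : ∀ t, C.coeff t u * C.dif Q f t = ∑ s, C.coeff s t * C.coeff t u * f s := by
      intro t
      by_cases ht : t ∈ Q
      · rw [dif_apply_of_mem ht, Finset.mul_sum]
        exact Finset.sum_congr rfl fun s _ => by ring
      · rw [dif_apply_of_notMem ht, mul_zero]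
        refine (Finset.sum_eq_zero fun s _ => ?_).symm
        by_contra h
        exact ht (hQ s (hf s (right_ne_zero_of_mul h)).1 u hu t
          (left_ne_zero_of_mul (left_ne_zero_of_mul h))
          (right_ne_zero_of_mul (left_ne_zero_of_mul h)))
    rw [Finset.sum_congr rfl fun t _ => h1 t, Finset.sum_comm]
    refine Finset.sum_eq_zero fun s _ => ?_
    rw [← Finset.sum_mul, C.sum_coeff_mul, zero_mul]
  · exact dif_apply_of_notMem hu

variable (C Q i) in
/-- The subquotient complex spanned by `Q` is exact in degree `i`. -/
def ExactAt : Prop :=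
  ∀ f ∈ C.supp Q i, C.dif Q f = 0 → ∃ g ∈ C.supp Q (i - 1), C.dif Q g = f

theorem res_mem (hf : f ∈ C.supp Q i) : res Q0 f ∈ C.supp Q0 i := by
  intro x hx
  by_cases hx0 : x ∈ Q0
  · rw [res_apply_of_mem hx0] at hx
    exact ⟨hx0, (hf x hx).2⟩
  · exact absurd (res_apply_of_notMem hx0) hx

theorem res_eq_self (hf : f ∈ C.supp Q0 i) : res Q0 f = f := by
  ext x
  by_cases hx : x ∈ Q0
  · exact res_apply_of_mem hx
  · rw [res_apply_of_notMem hx]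
    by_contra hfx
    exact hx (hf x (Ne.symm hfx)).1

variable (C Q Q0 Q1) in
/-- `Q1` spans a subcomplex of `Q` with quotient complex spanned by `Q0`. -/
structure Split : Prop where
  union : Q = Q0 ∪ Q1
  disjoint : Disjoint Q0 Q1
  coeff : ∀ s ∈ Q1, ∀ t ∈ Q0, C.coeff s t = 0

namespace Split

variable (h : C.Split Q Q0 Q1)
include h

theorem left_subset : Q0 ⊆ Q := h.union ▸ Set.subset_union_left

theorem right_subset : Q1 ⊆ Q := h.union ▸ Set.subset_union_right

theorem mem_or {x : X} (hx : x ∈ Q) : x ∈ Q0 ∨ x ∈ Q1 := by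
  rw [h.union] at hx
  exact hx

theorem notMem_right {x : X} (hx : x ∈ Q0) : x ∉ Q1 :=
  fun hx' => Set.disjoint_left.1 h.disjoint hx hx'

theorem dif_right (hf : f ∈ C.supp Q1 i) : C.dif Q f = C.dif Q1 f := by
  ext t
  by_cases ht : t ∈ Q
  · rcases h.mem_or ht with ht0 | ht1
    · rw [dif_apply_of_mem ht, dif_apply_of_notMem (h.notMem_right ht0)]
      refine Finset.sum_eq_zero fun s _ => ?_
      by_contra hs
      exact left_ne_zero_of_mul hs (h.coeff s (hf s (right_ne_zero_of_mul hs)).1 t ht0)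
    · rw [dif_apply_of_mem ht, dif_apply_of_mem ht1]
  · rw [dif_apply_of_notMem ht, dif_apply_of_notMem fun ht' => ht (h.right_subset ht')]

theorem res_dif (hf : f ∈ C.supp Q i) : res Q0 (C.dif Q f) = C.dif Q0 (res Q0 f) := by
  ext t
  by_cases ht : t ∈ Q0
  · rw [res_apply_of_mem ht, dif_apply_of_mem ht, dif_apply_of_mem (h.left_subset ht)]
    refine Finset.sum_congr rfl fun s _ => ?_
    by_cases hs : s ∈ Q0
    · rw [res_apply_of_mem hs]
    · rw [res_apply_of_notMem hs]
      by_cases hfs : f s = 0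
      · rw [hfs]
      · rcases h.mem_or (hf s hfs).1 with h0 | h1
        · exact absurd h0 hs
        · rw [h.coeff s h1 t ht, zero_mul, zero_mul]
  · rw [res_apply_of_notMem ht, dif_apply_of_notMem ht]

theorem mem_right (hf : f ∈ C.supp Q i) (hf0 : res Q0 f = 0) : f ∈ C.supp Q1 i := by
  intro x hx
  obtain ⟨hxQ, hxi⟩ := hf x hx
  refine ⟨(h.mem_or hxQ).resolve_left fun hx0 => hx ?_, hxi⟩
  rw [← res_apply_of_mem (f := f) hx0, hf0]
  rfl

theorem res_eq_zero (hf : f ∈ C.supp Q1 i) : res Q0 f = 0 := by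
  ext x
  by_cases hx : x ∈ Q0
  · rw [res_apply_of_mem hx]
    by_contra hfx
    exact h.notMem_right hx (hf x hfx).1
  · exact res_apply_of_notMem hx

theorem sub_dif_mem_right (hf : f ∈ C.supp Q i) (hg : g ∈ C.supp Q0 (i - 1))
    (hfg : C.dif Q0 g = res Q0 f) : f - C.dif Q g ∈ C.supp Q1 i := by
  have hg' := supp_mono h.left_subset hg
  refine h.mem_right (Submodule.sub_mem _ hf (dif_mem' hg')) ?_
  rw [map_sub, h.res_dif hg', res_eq_self hg, hfg, sub_self]

theorem exactAt (hQ : C.Convex Q) (h0 : C.ExactAt Q0 i) (h1 : C.ExactAt Q1 i) :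
    C.ExactAt Q i := by
  intro f hf hdf
  obtain ⟨g, hg, hgf⟩ := h0 (res Q0 f) (res_mem hf) (by rw [← h.res_dif hf, hdf, map_zero])
  have hg' := supp_mono h.left_subset hg
  have hf1 := h.sub_dif_mem_right hf hg hgf
  obtain ⟨g1, hg1, hgf1⟩ := h1 _ hf1 (by
    rw [← h.dif_right hf1, map_sub, hdf, dif_dif hQ hg', sub_zero])
  refine ⟨g + g1, Submodule.add_mem _ hg' (supp_mono h.right_subset hg1), ?_⟩
  rw [map_add, h.dif_right hg1, hgf1]
  abel

end Split

variable (C Q i) in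
/-- The cocycles of degree `i`. -/
noncomputable def cocycles : Submodule ℚ (X → ℚ) := C.supp Q i ⊓ LinearMap.ker (C.dif Q)

variable (C Q i) in
/-- The coboundaries of degree `i`. -/
noncomputable def coboundaries : Submodule ℚ (X → ℚ) := (C.supp Q (i - 1)).map (C.dif Q)

variable (C Q i) in
/-- The cohomology of the subquotient complex spanned by `Q`. -/
abbrev cohomology : Type _ :=
  C.cocycles Q i ⧸ (C.coboundaries Q i).submoduleOf (C.cocycles Q i)

theorem coboundaries_le (hQ : C.Convex Q) : C.coboundaries Q i ≤ C.cocycles Q i := by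
  rintro _ ⟨g, hg, rfl⟩
  exact ⟨dif_mem' hg, dif_dif hQ hg⟩

theorem exactAt_iff : C.ExactAt Q i ↔ Subsingleton (C.cohomology Q i) := by
  rw [Submodule.Quotient.subsingleton_iff, Submodule.submoduleOf_eq_top]
  exact ⟨fun h f hf => h f hf.1 hf.2, fun h f hf hdf => h ⟨hf, hdf⟩⟩

theorem finrank_cohomology_eq_zero (h : C.ExactAt Q i) :
    Module.finrank ℚ (C.cohomology Q i) = 0 :=
  have := exactAt_iff.1 h
  Module.finrank_zero_of_subsingleton

namespace Split

variable (h : C.Split Q Q0 Q1)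
include h

theorem finrank_eq_left (hQ : C.Convex Q) (h1 : C.ExactAt Q1 i) (h1' : C.ExactAt Q1 (i + 1)) :
    Module.finrank ℚ (C.cohomology Q i) = Module.finrank ℚ (C.cohomology Q0 i) := by
  let r : C.cocycles Q i →ₗ[ℚ] C.cocycles Q0 i := (res Q0).restrict fun f hf =>
    ⟨res_mem hf.1, by rw [SetLike.mem_coe, LinearMap.mem_ker, ← h.res_dif hf.1, hf.2, map_zero]⟩
  let m := (Submodule.mkQ ((C.coboundaries Q0 i).submoduleOf (C.cocycles Q0 i))) ∘ₗ r
  have hm : Function.Surjective m := by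
    refine (Submodule.mkQ_surjective _).comp ?_
    rintro ⟨f, hf, hdf⟩
    have hf' := supp_mono h.left_subset hf
    have hd : C.dif Q f ∈ C.supp Q1 (i + 1) := by
      refine h.mem_right (dif_mem hf') ?_
      rw [h.res_dif hf', res_eq_self hf]
      exact hdf
    obtain ⟨g, hg, hgf⟩ := h1' _ hd (by rw [← h.dif_right hd, dif_dif hQ hf'])
    rw [add_sub_cancel_right] at hg
    refine ⟨⟨f - g, Submodule.sub_mem _ hf' (supp_mono h.right_subset hg), ?_⟩, ?_⟩
    · rw [SetLike.mem_coe, LinearMap.mem_ker, map_sub, h.dif_right hg, hgf, sub_self]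
    · refine Subtype.ext ?_
      show res Q0 (f - g) = f
      rw [map_sub, h.res_eq_zero hg, res_eq_self hf, sub_zero]
  have hk : LinearMap.ker m = (C.coboundaries Q i).submoduleOf (C.cocycles Q i) := by
    ext ⟨f, hf, hdf⟩
    rw [LinearMap.mem_ker, LinearMap.comp_apply, Submodule.mkQ_apply,
      Submodule.Quotient.mk_eq_zero]
    show res Q0 f ∈ C.coboundaries Q0 i ↔ f ∈ C.coboundaries Q i
    constructor
    · rintro ⟨g, hg, hgf⟩
      have hg' := supp_mono h.left_subset hg
      have hf1 := h.sub_dif_mem_right hf hg hgf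
      obtain ⟨g1, hg1, hgf1⟩ := h1 _ hf1 (by
        rw [← h.dif_right hf1, map_sub, hdf, dif_dif hQ hg', sub_zero])
      refine ⟨g + g1, Submodule.add_mem _ hg' (supp_mono h.right_subset hg1), ?_⟩
      rw [map_add, h.dif_right hg1, hgf1]
      abel
    · rintro ⟨g, hg, rfl⟩
      exact ⟨res Q0 g, res_mem hg, (h.res_dif hg).symm⟩
  exact ((Submodule.quotEquivOfEq _ _ hk.symm).trans (m.quotKerEquivOfSurjective hm)).finrank_eq

theorem finrank_eq_right (hQ : C.Convex Q) (h0 : C.ExactAt Q0 i)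
    (h0' : C.ExactAt Q0 (i - 1)) :
    Module.finrank ℚ (C.cohomology Q i) = Module.finrank ℚ (C.cohomology Q1 i) := by
  let r : C.cocycles Q1 i →ₗ[ℚ] C.cocycles Q i := Submodule.inclusion fun f hf =>
    ⟨supp_mono h.right_subset hf.1, by rw [SetLike.mem_coe, LinearMap.mem_ker, h.dif_right hf.1, hf.2]⟩
  let m := (Submodule.mkQ ((C.coboundaries Q i).submoduleOf (C.cocycles Q i))) ∘ₗ r
  have hm : Function.Surjective m := by
    intro z
    obtain ⟨⟨f, hf, hdf⟩, rfl⟩ := Submodule.mkQ_surjective _ z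
    obtain ⟨g, hg, hgf⟩ := h0 (res Q0 f) (res_mem hf) (by
      rw [← h.res_dif hf, hdf, map_zero])
    have hg' := supp_mono h.left_subset hg
    have hf1 := h.sub_dif_mem_right hf hg hgf
    refine ⟨⟨f - C.dif Q g, hf1, ?_⟩, ?_⟩
    · rw [SetLike.mem_coe, LinearMap.mem_ker, ← h.dif_right hf1, map_sub, hdf, dif_dif hQ hg', sub_zero]
    · refine (Submodule.Quotient.eq _).2 ?_
      show f - C.dif Q g - f ∈ C.coboundaries Q i
      refine ⟨-g, Submodule.neg_mem _ hg', ?_⟩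
      rw [map_neg]
      abel
  have hk : LinearMap.ker m = (C.coboundaries Q1 i).submoduleOf (C.cocycles Q1 i) := by
    ext ⟨f, hf, hdf⟩
    rw [LinearMap.mem_ker, LinearMap.comp_apply, Submodule.mkQ_apply,
      Submodule.Quotient.mk_eq_zero]
    show f ∈ C.coboundaries Q i ↔ f ∈ C.coboundaries Q1 i
    constructor
    · rintro ⟨g, hg, hgf⟩
      obtain ⟨u, hu, hug⟩ := h0' (res Q0 g) (res_mem hg) (by
        rw [← h.res_dif hg, hgf, h.res_eq_zero hf])
      have hu' := supp_mono h.left_subset hu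
      have hg1 := h.sub_dif_mem_right hg hu hug
      refine ⟨g - C.dif Q u, hg1, ?_⟩
      rw [← h.dif_right hg1, map_sub, hgf, dif_dif hQ hu', sub_zero]
    · rintro ⟨g, hg, rfl⟩
      exact ⟨g, supp_mono h.right_subset hg, h.dif_right hg⟩
  exact ((Submodule.quotEquivOfEq _ _ hk.symm).trans (m.quotKerEquivOfSurjective hm)).finrank_eq.symm

end Split

open scoped Classical in
/-- Cochains supported on `Q` in degree `i` are functions on the basis elements in `Q` of
degree `i`. -/
noncomputable def suppEquiv (C : BasedComplex X) (Q : Set X) (i : ℤ) :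
    C.supp Q i ≃ₗ[ℚ] ({x // x ∈ Q ∧ C.deg x = i} → ℚ) where
  toFun f x := f.1 x.1
  map_add' _ _ := rfl
  map_smul' _ _ := rfl
  invFun f := ⟨fun x => if h : x ∈ Q ∧ C.deg x = i then f ⟨x, h⟩ else 0, fun x hx => by
    by_contra h
    exact hx (dif_neg h)⟩
  left_inv f := by
    ext x
    by_cases h : x ∈ Q ∧ C.deg x = i
    · simp [h]
    · simp only [h, dite_false]
      by_contra hx
      exact h (f.2 x (Ne.symm hx))
  right_inv f := by
    ext x
    simp [x.2]

theorem finrank_supp (C : BasedComplex X) (Q : Set X) (i : ℤ) :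
    Module.finrank ℚ (C.supp Q i) = Nat.card {x // x ∈ Q ∧ C.deg x = i} := by
  classical
  rw [(C.suppEquiv Q i).finrank_eq, Module.finrank_fintype_fun_eq_card, Nat.card_eq_fintype_card]

theorem finrank_cocycles_add (C : BasedComplex X) (Q : Set X) (i : ℤ) :
    Module.finrank ℚ (C.cocycles Q i) + Module.finrank ℚ (C.coboundaries Q (i + 1)) =
      Nat.card {x // x ∈ Q ∧ C.deg x = i} := by
  have h := LinearMap.finrank_range_add_finrank_ker ((C.dif Q).domRestrict (C.supp Q i))
  rw [LinearMap.range_domRestrict, finrank_supp, LinearMap.ker_domRestrict] at h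
  rw [← h, coboundaries, add_sub_cancel_right, add_comm, cocycles,
    ← Submodule.map_comap_subtype, Submodule.finrank_map_subtype_eq]

theorem finrank_cohomology_add (hQ : C.Convex Q) (i : ℤ) :
    Module.finrank ℚ (C.cohomology Q i) + Module.finrank ℚ (C.coboundaries Q i) =
      Module.finrank ℚ (C.cocycles Q i) := by
  rw [← (Submodule.submoduleOfEquivOfLe (coboundaries_le hQ)).finrank_eq]
  exact Submodule.finrank_quotient_add_finrank _

/-- The Euler characteristic of a complex is that of its cohomology. -/
theorem sum_card_eq_sum_finrank (hQ : C.Convex Q) (h0 : ∀ x ∈ Q, 0 ≤ C.deg x) (n : ℕ)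
    (hn : ∀ x ∈ Q, C.deg x < n) :
    ∑ k ∈ Finset.range n, (-1 : ℤ) ^ k * Nat.card {x // x ∈ Q ∧ C.deg x = k} =
      ∑ k ∈ Finset.range n, (-1 : ℤ) ^ k * Module.finrank ℚ (C.cohomology Q k) := by
  have hb0 : Module.finrank ℚ (C.coboundaries Q 0) = 0 := by
    rw [Submodule.finrank_eq_zero, eq_bot_iff]
    rintro _ ⟨g, hg, rfl⟩
    have : g = 0 := by
      ext x
      by_contra hx
      have h1 := hg x hx
      have h2 := h0 x h1.1
      omega
    rw [this, map_zero]
    exact zero_mem _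
  have hbn : Module.finrank ℚ (C.coboundaries Q n) = 0 := by
    rw [Submodule.finrank_eq_zero, eq_bot_iff]
    intro f hf
    have h2 := (coboundaries_le hQ hf).1
    rw [Submodule.mem_bot]
    ext x
    by_contra hx
    have h1 := h2 x hx
    have h2 := hn x h1.1
    omega
  have key : ∀ m : ℕ,
      ∑ k ∈ Finset.range m, (-1 : ℤ) ^ k * Nat.card {x // x ∈ Q ∧ C.deg x = k} =
      ∑ k ∈ Finset.range m, (-1 : ℤ) ^ k * Module.finrank ℚ (C.cohomology Q k) -
        (-1) ^ m * Module.finrank ℚ (C.coboundaries Q m) := by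
    intro m
    induction m with
    | zero => simp [hb0]
    | succ m ih =>
      rw [Finset.sum_range_succ, Finset.sum_range_succ, ih, ← finrank_cocycles_add,
        ← finrank_cohomology_add hQ]
      push_cast
      ring
  rw [key n, hbn]
  simp

end BasedComplex

/-- The element of a monoid given by a label: the label `one` stands for `1`, the label `X` for a
given element. -/
def Label.ev {M : Type*} [One M] : Label → M → M
  | Label.one, _ => 1
  | Label.X, x => x

theorem Label.map_ev {M N F : Type*} [One M] [One N] [FunLike F M N] [OneHomClass F M N] (φ : F)
    (l : Label) (x : M) : φ (l.ev x) = l.ev (φ x) := by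
  cases l
  · exact map_one φ
  · rfl

theorem Label.sum_mulCoeff {A : Type*} [CommRing A] [Algebra ℚ A] {x : A} (hx : x * x = 0)
    (k l : Label) (p : A) :
    ∑ m, (Label.mulCoeff k l m : ℚ) • (m.ev x * p) = k.ev x * (l.ev x * p) := by
  have h : ∀ F : Label → A, ∑ m, F m = F .one + F .X := fun F => by
    rw [show (Finset.univ : Finset Label) = {.one, .X} from rfl, Finset.sum_pair (by decide)]
  rw [h]
  cases k <;> cases l <;> simp [Label.mulCoeff, Label.ev, ← mul_assoc, hx]

theorem Label.sum_comulCoeff {A : Type*} [CommRing A] [Algebra ℚ A] {x y z : A}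
    (hx : x * x = 0) (hy : y * y = 0) (hz : z = x ∨ z = y) (k : Label) (p : A) :
    ∑ l, ∑ m, (Label.comulCoeff k l m : ℚ) • (l.ev x * (m.ev y * p)) =
      (x + y) * (k.ev z * p) := by
  have h : ∀ F : Label → A, ∑ m, F m = F .one + F .X := fun F => by
    rw [show (Finset.univ : Finset Label) = {.one, .X} from rfl, Finset.sum_pair (by decide)]
  simp only [h]
  cases k
  · simp [Label.comulCoeff, Label.ev]
    ring
  · rcases hz with rfl | rfl
    · simp only [Label.comulCoeff, Label.ev, Int.cast_zero, Int.cast_one, zero_smul, one_smul]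
      linear_combination (-p) * hx
    · simp only [Label.comulCoeff, Label.ev, Int.cast_zero, Int.cast_one, zero_smul, one_smul]
      linear_combination (-p) * hy

namespace LinkDiagram

open MvPolynomial

variable {ι : Type*} [LinearOrder ι] (D : LinkDiagram ι)

/-- The polynomial ring with one variable for every point. -/
abbrev PointRing : Type _ := MvPolynomial D.Point ℚ

/-- The ideal such that the quotient is the tensor product of copies of `ℚ[X]/(X²)` over the
circles of `D(S)`. -/
noncomputable def circleIdeal (S : Finset ι) : Ideal D.PointRing :=
  Ideal.span ({p | ∃ u, p = X u * X u} ∪ {p | ∃ u v, D.circ S u = D.circ S v ∧ p = X u - X v})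

/-- The tensor product of copies of `ℚ[X]/(X²)` over the circles of `D(S)`. -/
abbrev CircleRing (S : Finset ι) : Type _ := D.PointRing ⧸ D.circleIdeal S

/-- The quotient map to the tensor product. -/
noncomputable abbrev toCircle (S : Finset ι) : D.PointRing →ₐ[ℚ] D.CircleRing S :=
  Ideal.Quotient.mkₐ ℚ (D.circleIdeal S)

open scoped Classical in
/-- The factor by which the change of the resolution of `a` multiplies: `1` if circles merge. -/
noncomputable def theta (S : Finset ι) (a : ι) : D.PointRing :=
  if D.SameAt S a then X (D.corner a 0) + X (D.corner a 2) else 1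

variable {D} {S S' : Finset ι}

theorem toCircle_eq_iff {p q : D.PointRing} :
    D.toCircle S p = D.toCircle S q ↔ p - q ∈ D.circleIdeal S := Ideal.Quotient.eq

theorem toCircle_eq_zero_iff {p : D.PointRing} :
    D.toCircle S p = 0 ↔ p ∈ D.circleIdeal S := Ideal.Quotient.eq_zero_iff_mem

theorem toCircle_X_mul_self (u : D.Point) : D.toCircle S (X u) * D.toCircle S (X u) = 0 := by
  rw [← map_mul, toCircle_eq_zero_iff]
  exact Ideal.subset_span (Or.inl ⟨u, rfl⟩)

theorem toCircle_X_eq {u v : D.Point} (h : D.circ S u = D.circ S v) :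
    D.toCircle S (X u) = D.toCircle S (X v) :=
  toCircle_eq_iff.2 (Ideal.subset_span (Or.inr ⟨u, v, h, rfl⟩))

/-- An algebra homomorphism that respects squares and circles factors through the tensor product. -/
theorem map_eq_zero_of_mem {A : Type*} [CommRing A] {φ : D.PointRing →+* A}
    (h1 : ∀ u, φ (X u) * φ (X u) = 0) (h2 : ∀ u v, D.circ S u = D.circ S v → φ (X u) = φ (X v))
    {p : D.PointRing} (hp : p ∈ D.circleIdeal S) : φ p = 0 := by
  suffices D.circleIdeal S ≤ RingHom.ker φ from this hp
  refine Ideal.span_le.2 ?_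
  rintro _ (⟨u, rfl⟩ | ⟨u, v, huv, rfl⟩)
  · rw [SetLike.mem_coe, RingHom.mem_ker, map_mul, h1]
  · rw [SetLike.mem_coe, RingHom.mem_ker, map_sub, h2 u v huv, sub_self]

section theta

variable [Fintype ι] (halt : D.Alternating)

include halt

theorem theta_mul_mem {a : ι} (ha : a ∉ S) {p : D.PointRing} (hp : p ∈ D.circleIdeal S) :
    D.theta S a * p ∈ D.circleIdeal (insert a S) := by
  by_cases hs : D.SameAt S a
  · rw [theta, if_pos hs]
    have hm := splits_insert halt ha hs
    rw [← toCircle_eq_zero_iff, map_mul]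
    induction hp using Submodule.span_induction with
    | mem x hx =>
      rw [map_add]
      have h0 := toCircle_X_mul_self (S := insert a S) (D.corner a 0)
      have h2 := toCircle_X_mul_self (S := insert a S) (D.corner a 2)
      obtain ⟨u, rfl⟩ | ⟨u, v, huv, rfl⟩ := hx
      · rw [map_mul, toCircle_X_mul_self, mul_zero]
      rw [map_sub]
      rcases (hm.eq_iff u v).1 huv with h | ⟨h | h, h' | h'⟩
      · rw [toCircle_X_eq h, sub_self, mul_zero]
      · rw [toCircle_X_eq h, toCircle_X_eq h', sub_self, mul_zero]
      · rw [toCircle_X_eq h, toCircle_X_eq h']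
        linear_combination h0 - h2
      · rw [toCircle_X_eq h, toCircle_X_eq h']
        linear_combination h2 - h0
      · rw [toCircle_X_eq h, toCircle_X_eq h', sub_self, mul_zero]
    | zero => rw [map_zero, mul_zero]
    | add x y _ _ hx hy => rw [map_add _ x y, mul_add, hx, hy, add_zero]
    | smul c x _ hx => rw [smul_eq_mul, map_mul, mul_left_comm, hx, mul_zero]
  · rw [theta, if_neg hs, one_mul, ← toCircle_eq_zero_iff]
    have hm := merges_insert halt ha hs
    exact map_eq_zero_of_mem (φ := (D.toCircle (insert a S)).toRingHom)
      (fun u => toCircle_X_mul_self u) (fun u v huv => toCircle_X_eq (hm.eq_of_eq huv)) hp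

theorem toCircle_theta_mul {a : ι} (ha : a ∉ S) {p q : D.PointRing}
    (h : D.toCircle S p = D.toCircle S q) :
    D.toCircle (insert a S) (D.theta S a * p) = D.toCircle (insert a S) (D.theta S a * q) := by
  rw [toCircle_eq_iff] at h ⊢
  rw [← mul_sub]
  exact theta_mul_mem halt ha h

theorem sameAt_insert_of_sameAt {a b : ι} (ha : a ∉ S) (hab : a ≠ b) (h : D.SameAt S a) :
    D.SameAt (insert b S) a := by
  rw [sameAt_iff_linkedAt halt (by simp [ha, hab])]
  exact (linkedAt_of_sameAt h).mono (Finset.subset_insert b S)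

/-- If the crossing `b` makes `a` a splitting one, then both join the same two circles. -/
theorem parallel {a b : ι} (ha : a ∉ S) (hb : b ∉ S) (hab : a ≠ b) (hs : ¬ D.SameAt S a)
    (hs' : D.SameAt (insert b S) a) :
    ¬ D.SameAt S b ∧ D.SameAt (insert a S) b ∧
      D.toCircle (insert a (insert b S)) (X (D.corner a 0) + X (D.corner a 2)) =
        D.toCircle (insert a (insert b S)) (X (D.corner b 0) + X (D.corner b 2)) := by
  have hbs : ¬ D.SameAt S b := by
    intro hbs
    rw [sameAt_iff_linkedAt halt ha] at hs
    rw [sameAt_iff_linkedAt halt (by simp [ha, hab])] at hs'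
    exact hs ((cmp_insert_iff (linkedAt_of_sameAt hbs) _ _).1 hs')
  have hm := merges_insert halt hb hbs
  have hma := merges_insert halt ha hs
  have hcorner := ((hm.eq_iff _ _).1 hs').resolve_left hs
  have hbs' : D.SameAt (insert a S) b := by
    have h0 : ∀ u, D.circ S (D.corner a 0) = D.circ S u →
        D.circ (insert a S) u = D.circ (insert a S) (D.corner a 0) :=
      fun u hu => hma.eq_of_eq hu.symm
    have h2 : ∀ u, D.circ S (D.corner a 2) = D.circ S u →
        D.circ (insert a S) u = D.circ (insert a S) (D.corner a 0) :=
      fun u hu => (hma.eq_of_eq hu.symm).trans hma.eq.symm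
    obtain ⟨h | h, h' | h'⟩ := hcorner
    · exact absurd (h.trans h'.symm) hs
    · exact (h0 _ h).trans (h2 _ h').symm
    · exact (h2 _ h').trans (h0 _ h).symm
    · exact absurd (h.trans h'.symm) hs
  refine ⟨hbs, hbs', ?_⟩
  have hsp := splits_insert halt (a := a) (S := insert b S) (by simp [ha, hab]) hs'
  have hsp' := splits_insert halt (a := b) (S := insert a S) (by simp [hb, hab.symm]) hbs'
  rw [Finset.insert_comm] at hsp'
  have hb0 : D.circ (insert b S) (D.corner b 0) = D.circ (insert b S) (D.corner a 0) := by
    rcases hcorner.1 with h | h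
    · exact hm.eq_of_eq h.symm
    · exact hm.eq.trans (hm.eq_of_eq h.symm)
  have hb2 : D.circ (insert b S) (D.corner b 2) = D.circ (insert b S) (D.corner a 0) :=
    hm.eq.symm.trans hb0
  rw [hsp.right_eq_iff] at hb0 hb2
  rw [map_add, map_add]
  rcases hb0 with h | h <;> rcases hb2 with h' | h'
  · exact absurd (h.trans h'.symm) hsp'.ne
  · rw [toCircle_X_eq h, toCircle_X_eq h']
  · rw [toCircle_X_eq h, toCircle_X_eq h', add_comm]
  · exact absurd (h.trans h'.symm) hsp'.ne

theorem theta_comm {a b : ι} (ha : a ∉ S) (hb : b ∉ S) (hab : a ≠ b) :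
    D.toCircle (insert a (insert b S)) (D.theta (insert b S) a * D.theta S b) =
      D.toCircle (insert a (insert b S)) (D.theta (insert a S) b * D.theta S a) := by
  by_cases h1 : D.SameAt S a
  · have h2 := sameAt_insert_of_sameAt halt ha hab h1
    by_cases h3 : D.SameAt S b
    · have h4 := sameAt_insert_of_sameAt halt hb hab.symm h3
      simp only [theta, h1, h2, h3, h4, if_true]
      rw [mul_comm]
    · have h4 : ¬ D.SameAt (insert a S) b :=
        fun h4 => (parallel halt hb ha hab.symm h3 h4).1 h1
      simp only [theta, h1, h2, h3, h4, if_true, if_false]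
      rw [mul_comm]
  · by_cases h2 : D.SameAt (insert b S) a
    · obtain ⟨h3, h4, h5⟩ := parallel halt ha hb hab h1 h2
      simp only [theta, h1, h2, h3, h4, if_true, if_false, mul_one]
      exact h5
    · have h3 : D.SameAt (insert a S) b ↔ D.SameAt S b := by
        refine ⟨fun h3 => ?_, fun h3 => sameAt_insert_of_sameAt halt hb hab.symm h3⟩
        by_contra h4
        exact h2 (parallel halt hb ha hab.symm h4 h3).2.1
      by_cases h4 : D.SameAt S b
      · simp only [theta, h1, h2, h3.2 h4, h4, if_false, mul_one, one_mul]
      · simp only [theta, h1, h2, mt h3.1 h4, h4, if_false]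

end theta

section basis

variable [Fintype ι]

noncomputable instance (S : Finset ι) : Fintype (D.Circle S) := Fintype.ofFinite _

noncomputable instance (S : Finset ι) : DecidableEq (D.Circle S) := Classical.decEq _

/-- A point on a circle. -/
noncomputable def rep (z : D.Circle S) : D.Point := Function.surjInv (D.circ_surjective S) z

theorem circ_rep (z : D.Circle S) : D.circ S (rep z) = z := Function.surjInv_eq _ z

/-- The monomial that represents a standard generator. -/
noncomputable def mono (l : D.Circle S → Label) : D.PointRing := ∏ z, (l z).ev (X (rep z))

theorem toCircle_mono (l : D.Circle S → Label) :
    D.toCircle S' (mono l) = ∏ z, (l z).ev (D.toCircle S' (X (rep z))) := by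
  rw [mono, map_prod]
  exact Finset.prod_congr rfl fun z _ => Label.map_ev (D.toCircle S') _ _

/-- The exponent vector of a standard generator. -/
noncomputable def expo (l : D.Circle S → Label) : D.Circle S →₀ ℕ :=
  Finsupp.equivFunOnFinite.symm fun z => if l z = Label.X then 1 else 0

theorem expo_apply (l : D.Circle S → Label) (z : D.Circle S) :
    expo l z = if l z = Label.X then 1 else 0 := rfl

theorem expo_injective : Function.Injective (expo : (D.Circle S → Label) → _) := by
  intro l m h
  ext z
  have hz := DFunLike.congr_fun h z
  rw [expo_apply, expo_apply] at hz
  cases h1 : l z <;> cases h2 : m z <;> simp_all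

theorem rename_mono (l : D.Circle S → Label) :
    rename (D.circ S) (mono l) = monomial (expo l) (1 : ℚ) := by
  rw [mono, map_prod, monomial_eq, C_1, one_mul, Finsupp.prod_fintype _ _ (fun _ => pow_zero _)]
  refine Finset.prod_congr rfl fun z _ => ?_
  rw [Label.map_ev, rename_X, circ_rep, expo_apply]
  cases l z <;> simp [Label.ev]

theorem coeff_rename_of_mem {p : D.PointRing} (hp : p ∈ D.circleIdeal S)
    (l : D.Circle S → Label) : coeff (expo l) (rename (D.circ S) p) = 0 := by
  let I : Ideal (MvPolynomial (D.Circle S) ℚ) :=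
    Ideal.span ((fun s => monomial s (1 : ℚ)) '' Set.range fun z => Finsupp.single z 2)
  have h : rename (D.circ S) p ∈ I := by
    rw [← Ideal.Quotient.eq_zero_iff_mem]
    refine map_eq_zero_of_mem (φ := (Ideal.Quotient.mk I).comp (rename (D.circ S)).toRingHom)
      (fun u => ?_) (fun u v huv => ?_) hp
    · rw [← map_mul, RingHom.comp_apply, Ideal.Quotient.eq_zero_iff_mem]
      refine Ideal.subset_span ⟨_, ⟨D.circ S u, rfl⟩, ?_⟩
      simp [X, monomial_mul, ← Finsupp.single_add, rename_monomial]
    · simp [huv]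
  by_contra hne
  obtain ⟨_, ⟨z, rfl⟩, hz⟩ := mem_ideal_span_monomial_image.1 h _ (mem_support_iff.2 hne)
  have := hz z
  rw [Finsupp.single_eq_same, expo_apply] at this
  split_ifs at this <;> omega

/-- The linear combination of monomials with given coefficients. -/
noncomputable def toRing (f : D.State → ℚ) (S : Finset ι) : D.PointRing :=
  ∑ l : D.Circle S → Label, f ⟨S, l⟩ • mono l

theorem eq_zero_of_toRing {f : D.State → ℚ} (h : D.toCircle S (toRing f S) = 0)
    (l : D.Circle S → Label) : f ⟨S, l⟩ = 0 := by
  have h1 := coeff_rename_of_mem (toCircle_eq_zero_iff.1 h) l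
  rw [toRing, map_sum, coeff_sum, Finset.sum_eq_single l] at h1
  · simpa [rename_mono, coeff_monomial] using h1
  · intro m _ hm
    rw [map_smul, coeff_smul, rename_mono, coeff_monomial, if_neg fun h => hm (expo_injective h),
      smul_zero]
  · simp

theorem toRing_sub (f g : D.State → ℚ) (S : Finset ι) :
    toRing (f - g) S = toRing f S - toRing g S := by
  simp [toRing, sub_smul, Finset.sum_sub_distrib]

theorem mono_mul_X_mem (l : D.Circle S → Label) (u : D.Point) :
    D.toCircle S (mono l * X u) ∈
      Submodule.span ℚ (Set.range fun m : D.Circle S → Label => D.toCircle S (mono m)) := by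
  classical
  rw [map_mul, toCircle_mono, ← Finset.mul_prod_erase _ _ (Finset.mem_univ (D.circ S u)),
    toCircle_X_eq (circ_rep (D.circ S u))]
  cases h : l (D.circ S u)
  · refine Submodule.subset_span ⟨Function.update l (D.circ S u) Label.X, ?_⟩
    dsimp only
    rw [toCircle_mono, ← Finset.mul_prod_erase _ _ (Finset.mem_univ (D.circ S u)),
      Function.update_self, toCircle_X_eq (circ_rep (D.circ S u)), Label.ev, Label.ev, one_mul,
      mul_comm]
    congr 1
    refine Finset.prod_congr rfl fun z hz => ?_
    rw [Function.update_of_ne (Finset.ne_of_mem_erase hz)]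
  · rw [Label.ev, mul_right_comm, toCircle_X_mul_self, zero_mul]
    exact zero_mem _

theorem span_mono (p : D.PointRing) : D.toCircle S p ∈
    Submodule.span ℚ (Set.range fun m : D.Circle S → Label => D.toCircle S (mono m)) := by
  induction p using MvPolynomial.induction_on with
  | C c =>
    have h : D.toCircle S (mono fun _ : D.Circle S => Label.one) = 1 := by simp [toCircle_mono, Label.ev]
    have h1 : D.toCircle S (C c) = c • 1 := by
      rw [← map_one (D.toCircle S), ← map_smul, smul_eq_C_mul, mul_one]
    rw [h1, ← h]
    exact Submodule.smul_mem _ _ (Submodule.subset_span ⟨_, rfl⟩)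
  | add p q hp hq => rw [map_add]; exact Submodule.add_mem _ hp hq
  | mul_X p u hp =>
    rw [map_mul]
    generalize D.toCircle S p = y at hp
    induction hp using Submodule.span_induction with
    | mem x hx =>
      obtain ⟨m, rfl⟩ := hx
      rw [← map_mul]
      exact mono_mul_X_mem m u
    | zero => rw [zero_mul]; exact zero_mem _
    | add x y _ _ hx hy => rw [add_mul]; exact Submodule.add_mem _ hx hy
    | smul c x _ hx => rw [smul_mul_assoc]; exact Submodule.smul_mem _ c hx

open scoped Classical in
/-- Every element of the tensor product is given by a function on the standard generators. -/
theorem exists_toRing_eq (S : Finset ι) (p : D.PointRing) :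
    ∃ f : D.State → ℚ, D.toCircle S (toRing f S) = D.toCircle S p ∧ ∀ s, s.1 ≠ S → f s = 0 := by
  obtain ⟨c, hc⟩ := (Submodule.mem_span_range_iff_exists_fun ℚ).1 (span_mono (S := S) p)
  refine ⟨fun s => if h : s.1 = S then c (h ▸ s.2) else 0, ?_, fun s hs => dif_neg hs⟩
  rw [← hc, toRing, map_sum]
  refine Finset.sum_congr rfl fun l _ => ?_
  rw [map_smul]
  simp

end basis

end LinkDiagram

namespace LinkDiagram

open MvPolynomial

variable {ι : Type*} [LinearOrder ι] {D : LinkDiagram ι} {S S' : Finset ι}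

theorem agreeAway_iff (a : ι) (s t : D.State) : D.AgreeAway a s t ↔
    ∀ u, D.circ s.1 u ≠ D.circ s.1 (D.corner a 0) → D.circ s.1 u ≠ D.circ s.1 (D.corner a 2) →
      t.2 (D.circ t.1 u) = s.2 (D.circ s.1 u) := by
  constructor
  · rintro ⟨h1, h2⟩ (d | n) h0 h0'
    · refine h1 d fun k => ?_
      rcases (respects_circ s.1).corner_eq_or a k with hk | hk
      · exact fun h => h0 (h.trans hk)
      · exact fun h => h0' (h.trans hk)
    · exact h2 n
  · intro h
    exact ⟨fun d hd => h (Sum.inl d) (hd 0) (hd 2), fun n => h (Sum.inr n) (by simp [circ, corner])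
      (by simp [circ, corner])⟩

theorem changeCoeff_of_not_sameAt {a : ι} {s : D.State} (h : ¬ D.SameAt s.1 a) (t : D.State) :
    D.changeCoeff a s t = Label.mulCoeff (s.2 (D.circ s.1 (D.corner a 0)))
      (s.2 (D.circ s.1 (D.corner a 2))) (t.2 (D.circ t.1 (D.corner a 0))) := if_pos h

theorem changeCoeff_of_sameAt {a : ι} {s t : D.State} (h : D.SameAt s.1 a)
    (h' : ¬ D.SameAt t.1 a) :
    D.changeCoeff a s t = Label.comulCoeff (s.2 (D.circ s.1 (D.corner a 0)))
      (t.2 (D.circ t.1 (D.corner a 0))) (t.2 (D.circ t.1 (D.corner a 2))) :=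
  (if_neg (not_not.2 h)).trans (if_pos h')

variable [Fintype ι]

theorem qdeg_eq (s : D.State) : s.qdeg = s.1.card + ∑ z, (s.2 z).deg := rfl

open scoped Classical in
/-- The change of the resolution of `a` is multiplication by `theta S a`. -/
theorem sum_changeCoeff (halt : D.Alternating) {a : ι} (ha : a ∉ S) (hS' : S' = insert a S)
    (l : D.Circle S → Label) :
    ∑ t : D.Circle S' → Label, (if D.AgreeAway a ⟨S, l⟩ ⟨S', t⟩ then
      (D.changeCoeff a ⟨S, l⟩ ⟨S', t⟩ : ℚ) else 0) • D.toCircle S' (mono t) =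
      D.toCircle S' (D.theta S a * mono l) := by
  subst hS'
  rw [map_mul]
  have hrep : ∀ u, D.toCircle (insert a S) (X (rep (D.circ (insert a S) u))) =
      D.toCircle (insert a S) (X u) := fun u => toCircle_X_eq (circ_rep _)
  by_cases hs : D.SameAt S a
  · have hm := splits_insert halt ha hs
    rw [theta, if_pos hs, map_add, toCircle_mono]
    obtain ⟨c, hc⟩ : ∃ c : Label → Label → D.CircleRing (insert a S), ∀ j k, c j k =
        (Label.comulCoeff (l (D.circ S (D.corner a 0))) j k : ℚ) •
          (j.ev (D.toCircle (insert a S) (X (D.corner a 0))) *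
            (k.ev (D.toCircle (insert a S) (X (D.corner a 2))) *
              ∏ z ∈ Finset.univ.erase (D.circ S (D.corner a 0)),
                (l z).ev (D.toCircle (insert a S) (X (rep z))))) := ⟨_, fun _ _ => rfl⟩
    have hterm : ∀ t : D.Circle (insert a S) → Label,
        (if D.AgreeAway a ⟨S, l⟩ ⟨insert a S, t⟩ then
          (D.changeCoeff a ⟨S, l⟩ ⟨insert a S, t⟩ : ℚ) else 0) •
            D.toCircle (insert a S) (mono t) =
        if ∀ u, D.circ (insert a S) u ≠ D.circ (insert a S) (D.corner a 0) →
            D.circ (insert a S) u ≠ D.circ (insert a S) (D.corner a 2) →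
            t (D.circ (insert a S) u) = l (D.circ S u) then
          c (t (D.circ (insert a S) (D.corner a 0))) (t (D.circ (insert a S) (D.corner a 2)))
        else 0 := by
      intro t
      have hiff : D.AgreeAway a ⟨S, l⟩ ⟨insert a S, t⟩ ↔
          ∀ u, D.circ (insert a S) u ≠ D.circ (insert a S) (D.corner a 0) →
            D.circ (insert a S) u ≠ D.circ (insert a S) (D.corner a 2) →
            t (D.circ (insert a S) u) = l (D.circ S u) := by
        rw [agreeAway_iff]
        refine forall_congr' fun u => ?_
        have h1 := hm.right_eq_iff u
        have h2 : D.circ S (D.corner a 2) = D.circ S (D.corner a 0) := hm.eq.symm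
        dsimp only
        rw [h2, Ne, h1]
        tauto
      by_cases hag : D.AgreeAway a ⟨S, l⟩ ⟨insert a S, t⟩
      · rw [if_pos hag, if_pos (hiff.1 hag), changeCoeff_of_sameAt (s := ⟨S, l⟩) (t := ⟨insert a S, t⟩) hs hm.ne, toCircle_mono,
          hm.prod_left, hm.prod_eq _ (fun z => (l z).ev (D.toCircle (insert a S) (X (rep z)))),
          hrep, hrep, hc]
        intro u hu hu'
        have hag' := hiff.1 hag u hu hu'
        rw [hag', hrep, toCircle_X_eq (hm.eq_of_right_eq hu hu' (circ_rep (D.circ S u)).symm)]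
      · rw [if_neg hag, if_neg (mt hiff.2 hag), zero_smul]
    rw [Finset.sum_congr rfl fun t _ => hterm t]
    refine Eq.trans (by convert hm.sum_left' l c) ?_
    simp only [hc]
    rw [Label.sum_comulCoeff
      (toCircle_X_mul_self _) (toCircle_X_mul_self _)
      (z := D.toCircle (insert a S) (X (rep (D.circ S (D.corner a 0)))))]
    · exact congrArg _ (Finset.mul_prod_erase Finset.univ
        (fun z => (l z).ev (D.toCircle (insert a S) (X (rep z)))) (Finset.mem_univ _))
    · rcases (hm.right_eq_iff _).1 (circ_rep (D.circ S (D.corner a 0))) with h | h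
      · exact Or.inl (toCircle_X_eq h)
      · exact Or.inr (toCircle_X_eq h)
  · have hm := merges_insert halt ha hs
    rw [theta, if_neg hs, map_one, one_mul, toCircle_mono]
    have hrep' : ∀ u, D.toCircle (insert a S) (X (rep (D.circ S u))) =
        D.toCircle (insert a S) (X u) := fun u => toCircle_X_eq (hm.eq_of_eq (circ_rep _))
    obtain ⟨c, hc⟩ : ∃ c : Label → D.CircleRing (insert a S), ∀ k, c k =
        (Label.mulCoeff (l (D.circ S (D.corner a 0))) (l (D.circ S (D.corner a 2))) k : ℚ) •
          (k.ev (D.toCircle (insert a S) (X (D.corner a 0))) *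
            ∏ z ∈ (Finset.univ.erase (D.circ S (D.corner a 0))).erase (D.circ S (D.corner a 2)),
              (l z).ev (D.toCircle (insert a S) (X (rep z)))) := ⟨_, fun _ => rfl⟩
    have hterm : ∀ t : D.Circle (insert a S) → Label,
        (if D.AgreeAway a ⟨S, l⟩ ⟨insert a S, t⟩ then
          (D.changeCoeff a ⟨S, l⟩ ⟨insert a S, t⟩ : ℚ) else 0) •
            D.toCircle (insert a S) (mono t) =
        if ∀ u, D.circ S u ≠ D.circ S (D.corner a 0) →
            D.circ S u ≠ D.circ S (D.corner a 2) →
            t (D.circ (insert a S) u) = l (D.circ S u) then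
          c (t (D.circ (insert a S) (D.corner a 0)))
        else 0 := by
      intro t
      have hiff := agreeAway_iff a (⟨S, l⟩ : D.State) ⟨insert a S, t⟩
      by_cases hag : D.AgreeAway a ⟨S, l⟩ ⟨insert a S, t⟩
      · rw [if_pos hag, if_pos (hiff.1 hag), changeCoeff_of_not_sameAt hs, toCircle_mono,
          ← Finset.mul_prod_erase _ _ (Finset.mem_univ (D.circ (insert a S) (D.corner a 0))),
          ← hm.prod_eq (fun z => (l z).ev (D.toCircle (insert a S) (X (rep z)))), hrep, hc]
        intro u hu hu'
        have hag' := hiff.1 hag u hu hu'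
        dsimp only at hag'
        rw [hag', hrep, hrep']
      · rw [if_neg hag, if_neg (mt hiff.2 hag), zero_smul]
    rw [Finset.sum_congr rfl fun t _ => hterm t]
    refine Eq.trans (by convert hm.sum_right l c) ?_
    simp only [hc]
    rw [Label.sum_mulCoeff
      (toCircle_X_mul_self _), hm.prod_left, hrep', hrep', toCircle_X_eq hm.eq]

theorem _root_.Label.deg_of_mulCoeff {j k l : Label} (h : Label.mulCoeff j k l ≠ 0) :
    j.deg + k.deg = l.deg + 1 := by
  cases j <;> cases k <;> cases l <;> simp_all [Label.mulCoeff, Label.deg]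

theorem _root_.Label.deg_of_comulCoeff {j k l : Label} (h : Label.comulCoeff j k l ≠ 0) :
    j.deg = k.deg + l.deg + 1 := by
  cases j <;> cases k <;> cases l <;> simp_all [Label.comulCoeff, Label.deg]

theorem qdeg_eq_of_changeCoeff (halt : D.Alternating) {a : ι} {s t : D.State} (ha : a ∉ s.1)
    (ht : t.1 = insert a s.1) (hag : D.AgreeAway a s t) (hc : D.changeCoeff a s t ≠ 0) :
    t.qdeg = s.qdeg := by
  obtain ⟨S, l⟩ := s
  obtain ⟨S', t⟩ := t
  dsimp only at ha ht
  subst ht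
  rw [agreeAway_iff] at hag
  rw [qdeg_eq, qdeg_eq, Finset.card_insert_of_notMem ha]
  dsimp only
  by_cases hs : D.SameAt S a
  · have hm := splits_insert halt ha hs
    rw [changeCoeff_of_sameAt (s := ⟨S, l⟩) (t := ⟨insert a S, t⟩) hs hm.ne] at hc
    have h1 := Label.deg_of_comulCoeff hc
    have h2 := hm.sum_left fun z => (t z).deg
    have h3 := hm.sum_eq (fun z => (t z).deg) (fun z => (l z).deg) (by
      intro u hu hu'
      have := hag u (by dsimp only; rw [Ne, hm.right_eq_iff]; tauto)
        (by dsimp only; rw [← hm.eq, Ne, hm.right_eq_iff]; tauto)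
      exact congrArg Label.deg this.symm)
    have h4 := Finset.add_sum_erase Finset.univ (fun z => (l z).deg)
      (Finset.mem_univ (D.circ S (D.corner a 0)))
    dsimp only at h1 h2 h3 h4
    push_cast
    linarith
  · have hm := merges_insert halt ha hs
    rw [changeCoeff_of_not_sameAt hs] at hc
    have h1 := Label.deg_of_mulCoeff hc
    have h2 := hm.sum_left fun z => (l z).deg
    have h3 := hm.sum_eq (fun z => (l z).deg) (fun z => (t z).deg) (by
      intro u hu hu'
      exact congrArg Label.deg (hag u hu hu'))
    have h4 := Finset.add_sum_erase Finset.univ (fun z => (t z).deg)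
      (Finset.mem_univ (D.circ (insert a S) (D.corner a 0)))
    dsimp only at h1 h2 h3 h4
    push_cast
    linarith

theorem exists_of_incidence_ne_zero {s t : D.State} (h : D.incidence s t ≠ 0) :
    ∃ a, a ∉ s.1 ∧ t.1 = insert a s.1 ∧ D.AgreeAway a s t ∧ D.changeCoeff a s t ≠ 0 := by
  obtain ⟨a, -, ha⟩ := Finset.exists_ne_zero_of_sum_ne_zero h
  split_ifs at ha with h1
  · exact ⟨a, h1.1, h1.2.1, h1.2.2, right_ne_zero_of_mul ha⟩
  · exact absurd rfl ha

theorem hdeg_of_incidence {s t : D.State} (h : D.incidence s t ≠ 0) : t.hdeg = s.hdeg + 1 := by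
  obtain ⟨a, ha, ht, -⟩ := exists_of_incidence_ne_zero h
  rw [State.hdeg, State.hdeg, ht, Finset.card_insert_of_notMem ha]
  push_cast
  rfl

theorem qdeg_of_incidence (halt : D.Alternating) {s t : D.State} (h : D.incidence s t ≠ 0) :
    t.qdeg = s.qdeg := by
  obtain ⟨a, ha, ht, hag, hc⟩ := exists_of_incidence_ne_zero h
  exact qdeg_eq_of_changeCoeff halt ha ht hag hc

/-- The sign of the edge of the cube from `S` to `S ∪ {a}`. -/
def sgn (S : Finset ι) (a : ι) : ℚ := (-1) ^ (S.filter fun b => a < b).card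

omit [Fintype ι] in
theorem sgn_mul_self (S : Finset ι) (a : ι) : sgn S a * sgn S a = 1 := by
  rw [sgn, ← mul_pow]
  simp

omit [Fintype ι] in
theorem sgn_insert {a b : ι} (hb : b ∉ S) :
    sgn (insert b S) a = if a < b then - sgn S a else sgn S a := by
  rw [sgn, sgn, Finset.filter_insert]
  split_ifs with h
  · rw [Finset.card_insert_of_notMem (by simp [hb]), pow_succ]
    ring
  · rfl

omit [Fintype ι] in
theorem sgn_anticomm {a b : ι} (ha : a ∉ S) (hb : b ∉ S) (hab : a ≠ b) :
    sgn (insert b S) a * sgn S b = -(sgn (insert a S) b * sgn S a) := by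
  rw [sgn_insert hb, sgn_insert ha]
  rcases lt_or_gt_of_ne hab with h | h
  · rw [if_pos h, if_neg h.not_gt]
    ring
  · rw [if_neg h.not_gt, if_pos h]
    ring

/-- The differential of the rational Khovanov complex. -/
noncomputable def diff (f : D.State → ℚ) (t : D.State) : ℚ :=
  ∑ s, (D.incidence s t : ℚ) * f s

open scoped Classical in
theorem incidence_cast (s t : D.State) : (D.incidence s t : ℚ) =
    ∑ a, if a ∉ s.1 ∧ t.1 = insert a s.1 then sgn s.1 a *
      (if D.AgreeAway a s t then (D.changeCoeff a s t : ℚ) else 0) else 0 := by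
  rw [incidence, Int.cast_sum]
  refine Finset.sum_congr rfl fun a _ => ?_
  by_cases h : a ∉ s.1 ∧ t.1 = insert a s.1 <;> by_cases h' : D.AgreeAway a s t
  · rw [if_pos ⟨h.1, h.2, h'⟩, if_pos h, if_pos h', sgn]
    push_cast
    rfl
  · rw [if_neg fun h'' => h' h''.2.2, if_pos h, if_neg h', mul_zero, Int.cast_zero]
  · rw [if_neg fun h'' => h ⟨h''.1, h''.2.1⟩, if_neg h, Int.cast_zero]
  · rw [if_neg fun h'' => h' h''.2.2, if_neg h, Int.cast_zero]

theorem toCircle_toRing_diff (halt : D.Alternating) (f : D.State → ℚ) (S' : Finset ι) :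
    D.toCircle S' (toRing (diff f) S') = ∑ a ∈ S', sgn (S'.erase a) a •
      D.toCircle S' (D.theta (S'.erase a) a * toRing f (S'.erase a)) := by
  classical
  have h1 : D.toCircle S' (toRing (diff f) S') =
      ∑ a, ∑ S : Finset ι, ∑ l : D.Circle S → Label, ∑ t : D.Circle S' → Label,
        ((if a ∉ S ∧ S' = insert a S then sgn S a *
          (if D.AgreeAway a ⟨S, l⟩ ⟨S', t⟩ then (D.changeCoeff a ⟨S, l⟩ ⟨S', t⟩ : ℚ) else 0)
          else 0) * f ⟨S, l⟩) • D.toCircle S' (mono t) := by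
    have h2 : ∀ (a : ι) (F : D.State → D.CircleRing S'),
        ∑ S : Finset ι, ∑ l : D.Circle S → Label, F ⟨S, l⟩ = ∑ s, F s :=
      fun a F => (Fintype.sum_sigma F).symm
    rw [Finset.sum_congr rfl fun a _ => h2 a fun s => ∑ t : D.Circle S' → Label,
        ((if a ∉ s.1 ∧ S' = insert a s.1 then sgn s.1 a *
          (if D.AgreeAway a s ⟨S', t⟩ then (D.changeCoeff a s ⟨S', t⟩ : ℚ) else 0)
          else 0) * f s) • D.toCircle S' (mono t)]
    rw [Finset.sum_comm, toRing, map_sum]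
    have h3 : ∀ t : D.Circle S' → Label, D.toCircle S' (diff f ⟨S', t⟩ • mono t) =
        ∑ s, ∑ a, ((if a ∉ s.1 ∧ S' = insert a s.1 then sgn s.1 a *
          (if D.AgreeAway a s ⟨S', t⟩ then (D.changeCoeff a s ⟨S', t⟩ : ℚ) else 0)
          else 0) * f s) • D.toCircle S' (mono t) := by
      intro t
      rw [map_smul, diff, Finset.sum_smul]
      refine Finset.sum_congr rfl fun s _ => ?_
      rw [incidence_cast, Finset.sum_mul, Finset.sum_smul]
    rw [Finset.sum_congr rfl fun t _ => h3 t, Finset.sum_comm]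
    exact Finset.sum_congr rfl fun s _ => Finset.sum_comm
  rw [h1, ← Finset.sum_subset (Finset.subset_univ S')]
  · refine Finset.sum_congr rfl fun a ha => ?_
    rw [Finset.sum_eq_single (S'.erase a)]
    · have h2 : ∀ l : D.Circle (S'.erase a) → Label, ∑ t : D.Circle S' → Label,
          ((if a ∉ S'.erase a ∧ S' = insert a (S'.erase a) then sgn (S'.erase a) a *
          (if D.AgreeAway a ⟨S'.erase a, l⟩ ⟨S', t⟩ then
            (D.changeCoeff a ⟨S'.erase a, l⟩ ⟨S', t⟩ : ℚ) else 0)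
          else 0) * f ⟨S'.erase a, l⟩) • D.toCircle S' (mono t) =
          sgn (S'.erase a) a • D.toCircle S'
            (D.theta (S'.erase a) a * f ⟨S'.erase a, l⟩ • mono l) := by
        intro l
        rw [mul_smul_comm, map_smul, ← sum_changeCoeff halt (Finset.notMem_erase a S')
          (Finset.insert_erase ha).symm, Finset.smul_sum, Finset.smul_sum]
        refine Finset.sum_congr rfl fun t _ => ?_
        rw [if_pos ⟨Finset.notMem_erase a S', (Finset.insert_erase ha).symm⟩, smul_smul, smul_smul]
        ring_nf
      rw [Finset.sum_congr rfl fun l _ => h2 l, ← Finset.smul_sum, ← map_sum, ← Finset.mul_sum]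
      rfl
    · intro S _ hS
      refine Finset.sum_eq_zero fun l _ => Finset.sum_eq_zero fun t _ => ?_
      rw [if_neg, zero_mul, zero_smul]
      rintro ⟨h2, rfl⟩
      exact hS (Finset.erase_insert h2).symm
    · simp
  · intro a _ ha
    refine Finset.sum_eq_zero fun S _ => Finset.sum_eq_zero fun l _ =>
      Finset.sum_eq_zero fun t _ => ?_
    rw [if_neg, zero_mul, zero_smul]
    rintro ⟨-, rfl⟩
    exact ha (Finset.mem_insert_self a S)

theorem diff_diff (halt : D.Alternating) (f : D.State → ℚ) : diff (diff f) = 0 := by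
  ext ⟨S, l⟩
  refine eq_zero_of_toRing (f := diff (diff f)) ?_ l
  have h1 : ∀ a ∈ S, sgn (S.erase a) a •
      D.toCircle S (D.theta (S.erase a) a * toRing (diff f) (S.erase a)) =
      ∑ b ∈ S.erase a, (sgn (S.erase a) a * sgn ((S.erase a).erase b) b) •
        D.toCircle S (D.theta (S.erase a) a *
          (D.theta ((S.erase a).erase b) b * toRing f ((S.erase a).erase b))) := by
    intro a ha
    have h2 := toCircle_toRing_diff halt f (S.erase a)
    simp only [← map_smul, ← map_sum] at h2
    have h3 := toCircle_theta_mul halt (Finset.notMem_erase a S) h2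
    rw [Finset.insert_erase ha] at h3
    rw [h3, Finset.mul_sum, map_sum, Finset.smul_sum]
    refine Finset.sum_congr rfl fun b _ => ?_
    rw [mul_smul_comm, map_smul, smul_smul]
  rw [toCircle_toRing_diff halt, Finset.sum_congr rfl h1]
  set F : ι → ι → D.CircleRing S := fun a b => (sgn (S.erase a) a * sgn ((S.erase a).erase b) b) •
        D.toCircle S (D.theta (S.erase a) a *
          (D.theta ((S.erase a).erase b) b * toRing f ((S.erase a).erase b))) with hF
  have hanti : ∀ a ∈ S, ∀ b ∈ S.erase a, F a b = - F b a := by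
    intro a ha b hb
    obtain ⟨hba, hbS⟩ := Finset.mem_erase.1 hb
    set U := (S.erase a).erase b with hU
    have hU' : (S.erase b).erase a = U := Finset.erase_right_comm
    have haU : a ∉ U := by simp [hU]
    have hbU : b ∉ U := by simp [hU]
    have ha' : S.erase a = insert b U := (Finset.insert_erase hb).symm
    have hb' : S.erase b = insert a U := by
      rw [← hU', Finset.insert_erase (Finset.mem_erase.2 ⟨hba.symm, ha⟩)]
    have hSU : S = insert a (insert b U) := by rw [← ha', Finset.insert_erase ha]
    have hc := theta_comm halt haU hbU hba.symm
    rw [← hSU] at hc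
    simp only [hF]
    rw [← hU, hU', ha', hb', sgn_anticomm haU hbU hba.symm, neg_smul, ← mul_assoc, map_mul, hc,
      ← map_mul, mul_assoc]
  have hswap : ∑ a ∈ S, ∑ b ∈ S.erase a, F a b = ∑ a ∈ S, ∑ b ∈ S.erase a, F b a := by
    refine Finset.sum_comm' fun a b => ?_
    simp only [Finset.mem_erase]
    tauto
  have h2 : ∑ a ∈ S, ∑ b ∈ S.erase a, F a b = - ∑ a ∈ S, ∑ b ∈ S.erase a, F a b := by
    conv_lhs => rw [Finset.sum_congr rfl fun a ha => Finset.sum_congr rfl (hanti a ha)]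
    simp only [Finset.sum_neg_distrib]
    rw [← hswap]
  have h3 : (2 : ℚ) • ∑ a ∈ S, ∑ b ∈ S.erase a, F a b = 0 := by
    rw [two_smul]
    nth_rewrite 1 [h2]
    exact neg_add_cancel _
  exact (smul_eq_zero.1 h3).resolve_left two_ne_zero

/-- The rational Khovanov complex of an alternating diagram. -/
noncomputable def complex (halt : D.Alternating) : BasedComplex D.State where
  coeff s t := D.incidence s t
  deg := State.hdeg
  deg_eq h := hdeg_of_incidence (Int.cast_ne_zero.1 h)
  sum_coeff_mul s u := by
    classical
    have h := congrFun (diff_diff halt (Pi.single s 1)) u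
    simp only [diff, Pi.single_apply, mul_ite, mul_one, mul_zero, Finset.sum_ite_eq',
      Finset.mem_univ, if_true, Pi.zero_apply] at h
    rw [← h]
    exact Finset.sum_congr rfl fun t _ => mul_comm _ _

end LinkDiagram

namespace LinkDiagram

open MvPolynomial

variable {ι : Type*} [LinearOrder ι] {D : LinkDiagram ι} {S T U : Finset ι}

/-- The standard generators over the resolutions between `D(T)` and `D(U)`. -/
def cube (D : LinkDiagram ι) (T U : Finset ι) : Set D.State := {s | T ⊆ s.1 ∧ s.1 ⊆ U}

/-- If the removal of each crossing from a set merges two classes of points, then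
some class meets exactly one crossing of the set, and it may be chosen different from a given class. -/
theorem exists_pendant {r : Finset ι → D.Point → D.Point → Prop} (hr : ∀ W, Equivalence (r W))
    {W : Finset ι} (hmono : ∀ V ⊆ W, ∀ c ∈ V, ∀ u v, r V u v → r (V.erase c) u v)
    (hne : ∀ V ⊆ W, ∀ c ∈ V, ¬ r V (D.corner c 0) (D.corner c 2))
    (hmerge : ∀ V ⊆ W, ∀ c ∈ V, r (V.erase c) (D.corner c 0) (D.corner c 2))
    (hW : W.Nonempty) (w : D.Point) :
    ∃ a ∈ W, ∃ y z, (y = D.corner a 0 ∧ z = D.corner a 2 ∨ y = D.corner a 2 ∧ z = D.corner a 0) ∧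
      ¬ r W z w ∧ ∀ b ∈ W, b ≠ a → ¬ r W (D.corner b 0) z ∧ ¬ r W (D.corner b 2) z := by
  induction hn : W.card generalizing W w with
  | zero => simp_all
  | succ n ih =>
    obtain ⟨c, hc, hcw⟩ : ∃ c ∈ W, ∀ a ∈ W,
        (r W (D.corner a 0) w ∨ r W (D.corner a 2) w) →
        (r W (D.corner c 0) w ∨ r W (D.corner c 2) w) := by
      by_cases h : ∃ c ∈ W, r W (D.corner c 0) w ∨ r W (D.corner c 2) w
      · obtain ⟨c, hc, h⟩ := h
        exact ⟨c, hc, fun _ _ _ => h⟩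
      · obtain ⟨c, hc⟩ := hW
        exact ⟨c, hc, fun a ha h' => absurd ⟨a, ha, h'⟩ h⟩
    by_cases hV : (W.erase c).Nonempty
    · obtain ⟨a, ha, y, z, hyz, hz, hb⟩ := ih (W := W.erase c)
        (fun V hVW => hmono V (hVW.trans (Finset.erase_subset _ _)))
        (fun V hVW => hne V (hVW.trans (Finset.erase_subset _ _)))
        (fun V hVW => hmerge V (hVW.trans (Finset.erase_subset _ _))) hV (D.corner c 0)
        (by rw [Finset.card_erase_of_mem hc, hn]; rfl)
      have haW := Finset.mem_of_mem_erase ha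
      have hz0 : ¬ r W (D.corner c 0) z := fun h =>
        hz ((hr _).symm (hmono W subset_rfl c hc _ _ h))
      have hz2 : ¬ r W (D.corner c 2) z := fun h =>
        hz ((hr _).symm ((hr _).trans (hmerge W subset_rfl c hc)
          (hmono W subset_rfl c hc _ _ h)))
      refine ⟨a, haW, y, z, hyz, fun h => ?_, fun b hbW hba => ?_⟩
      · rcases hcw a haW (by rcases hyz with ⟨-, rfl⟩ | ⟨-, rfl⟩ <;> simp [h]) with h' | h'
        · exact hz0 ((hr _).trans h' ((hr _).symm h))
        · exact hz2 ((hr _).trans h' ((hr _).symm h))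
      · by_cases hbc : b = c
        · subst hbc
          exact ⟨hz0, hz2⟩
        · obtain ⟨h0, h2⟩ := hb b (Finset.mem_erase.2 ⟨hbc, hbW⟩) hba
          exact ⟨fun h => h0 (hmono W subset_rfl c hc _ _ h),
            fun h => h2 (hmono W subset_rfl c hc _ _ h)⟩
    · have hall : ∀ b ∈ W, b = c := by
        intro b hb
        by_contra hbc
        exact hV ⟨b, Finset.mem_erase.2 ⟨hbc, hb⟩⟩
      by_cases h : r W (D.corner c 0) w
      · refine ⟨c, hc, _, _, Or.inl ⟨rfl, rfl⟩, fun h' => ?_,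
          fun b hb hbc => absurd (hall b hb) hbc⟩
        exact hne W subset_rfl c hc ((hr _).trans h ((hr _).symm h'))
      · exact ⟨c, hc, _, _, Or.inr ⟨rfl, rfl⟩, h, fun b hb hbc => absurd (hall b hb) hbc⟩

variable [Fintype ι] (halt : D.Alternating)

theorem incidence_subset {s t : D.State} (h : D.incidence s t ≠ 0) : s.1 ⊆ t.1 := by
  obtain ⟨a, -, ht, -⟩ := exists_of_incidence_ne_zero h
  rw [ht]
  exact Finset.subset_insert a _

omit [Fintype ι] in
theorem erase_sdiff_eq (U T : Finset ι) (a : ι) : U.erase a \ T = (U \ T).erase a := by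
  ext b
  simp only [Finset.mem_sdiff, Finset.mem_erase]
  tauto

theorem convex_cube (T U : Finset ι) : (complex halt).Convex (D.cube T U) :=
  fun _ hs _ hu _ hst htu => ⟨hs.1.trans (incidence_subset (Int.cast_ne_zero.1 hst)),
    (incidence_subset (Int.cast_ne_zero.1 htu)).trans hu.2⟩

theorem split_cube (T U : Finset ι) (a : ι) :
    (complex halt).Split (D.cube T U) (D.cube T (U.erase a)) (D.cube (insert a T) U) where
  union := by
    ext s
    simp only [cube, Set.mem_ofPred_eq, Set.mem_union, Finset.subset_erase, Finset.insert_subset_iff]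
    tauto
  disjoint := by
    rw [Set.disjoint_left]
    intro s hs hs'
    exact Finset.notMem_erase a U (hs.2 (hs'.1 (Finset.mem_insert_self a T)))
  coeff s hs t ht := by
    by_contra h
    exact Finset.notMem_erase a U
      (ht.2 (incidence_subset (Int.cast_ne_zero.1 h) (hs.1 (Finset.mem_insert_self a T))))

theorem toRing_congr {f g : D.State → ℚ} (h : ∀ l, f ⟨S, l⟩ = g ⟨S, l⟩) :
    toRing f S = toRing g S := Finset.sum_congr rfl fun l _ => by rw [h]

theorem toRing_eq_zero {f : D.State → ℚ} (h : ∀ l, f ⟨S, l⟩ = 0) : toRing f S = 0 :=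
  Finset.sum_eq_zero fun l _ => by rw [h, zero_smul]

theorem dif_cube_apply {f : D.State → ℚ} (hT : T ⊆ S) (hU : S ⊆ U) (l : D.Circle S → Label) :
    (complex halt).dif (D.cube T U) f ⟨S, l⟩ = diff f ⟨S, l⟩ :=
  BasedComplex.dif_apply_of_mem ⟨hT, hU⟩

theorem eq_of_toRing {f g : D.State → ℚ}
    (h : D.toCircle S (toRing f S) = D.toCircle S (toRing g S)) (l : D.Circle S → Label) :
    f ⟨S, l⟩ = g ⟨S, l⟩ := by
  have := eq_zero_of_toRing (f := f - g) (S := S) (by rw [toRing_sub, map_sub, h, sub_self]) l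
  exact sub_eq_zero.1 this

theorem exists_toRing_family (𝒮 : Set (Finset ι)) (q : Finset ι → D.PointRing) :
    ∃ f : D.State → ℚ, (∀ S ∈ 𝒮, D.toCircle S (toRing f S) = D.toCircle S (q S)) ∧
      ∀ s, s.1 ∉ 𝒮 → f s = 0 := by
  classical
  choose F hF _ using fun S => exists_toRing_eq S (q S)
  refine ⟨fun s => if s.1 ∈ 𝒮 then F s.1 s else 0, fun S hS => ?_, fun s hs => if_neg hs⟩
  rw [← hF S, toRing_congr (g := F S)]
  exact fun l => if_pos hS

theorem exactAt_of_forall_eq_zero {X : Type*} [Fintype X] {C : BasedComplex X} {Q : Set X} {i : ℤ}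
    (h : ∀ x ∈ Q, C.deg x ≠ i) : C.ExactAt Q i := by
  intro f hf _
  refine ⟨0, zero_mem _, ?_⟩
  rw [map_zero]
  ext x
  by_contra hx
  obtain ⟨h1, h2⟩ := hf x (Ne.symm hx)
  exact h x h1 h2

variable {halt} in
theorem not_sameAt_of_subset_erase {b : ι} (h : ¬ D.LinkedAt (U.erase b) b) (hS : S ⊆ U.erase b) :
    ¬ D.SameAt S b := fun h' => h ((linkedAt_of_sameAt h').mono hS)

open scoped Classical in
/-- The section of the merging at a pendant circle. -/
noncomputable def collapse (T : Finset ι) (y z : D.Point) : D.PointRing →ₐ[ℚ] D.PointRing :=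
  rename fun u => if D.circ T u = D.circ T z then y else u

theorem toCircle_collapse {y z : D.Point} (hTS : ∀ u, D.circ T u = D.circ T z →
    D.circ S u = D.circ S y) (p : D.PointRing) :
    D.toCircle S (collapse T y z p) = D.toCircle S p := by
  have h : (D.toCircle S).comp (collapse T y z) = D.toCircle S := by
    refine algHom_ext fun u => ?_
    rw [AlgHom.comp_apply, collapse, rename_X]
    split_ifs with hu
    · exact (toCircle_X_eq (hTS u hu)).symm
    · rfl
  exact DFunLike.congr_fun h p

theorem collapse_mem {a b : ι} {y z : D.Point}
    (hyz : y = D.corner a 0 ∧ z = D.corner a 2 ∨ y = D.corner a 2 ∧ z = D.corner a 0)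
    (hb : Merges (D.circ T) (D.circ (insert b T)) (D.corner b 0) (D.corner b 2))
    (hb0 : D.circ T (D.corner b 0) ≠ D.circ T z) (hb2 : D.circ T (D.corner b 2) ≠ D.circ T z)
    (ha : Merges (D.circ (insert b T)) (D.circ S) (D.corner a 0) (D.corner a 2))
    {p : D.PointRing} (hp : p ∈ D.circleIdeal S) :
    collapse T y z p ∈ D.circleIdeal (insert b T) := by
  rw [← toCircle_eq_zero_iff]
  refine map_eq_zero_of_mem
    (φ := ((D.toCircle (insert b T)).comp (collapse T y z)).toRingHom) (fun u => ?_)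
    (fun u v huv => ?_) hp
  · simp only [AlgHom.toRingHom_eq_coe, RingHom.coe_coe, AlgHom.comp_apply, collapse, rename_X]
    exact toCircle_X_mul_self _
  · simp only [AlgHom.toRingHom_eq_coe, RingHom.coe_coe, AlgHom.comp_apply, collapse, rename_X]
    refine toCircle_X_eq ?_
    have hT : ∀ u, D.circ T u = D.circ T z ↔ D.circ (insert b T) u = D.circ (insert b T) z := by
      intro u
      rw [hb.eq_iff]
      exact ⟨Or.inl, fun h => h.resolve_right fun h => h.2.elim (fun h => hb0 h.symm)
        fun h => hb2 h.symm⟩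
    have hne := ha.ne
    have huv := (ha.eq_iff u v).1 huv
    rw [if_congr (hT u) rfl rfl, if_congr (hT v) rfl rfl]
    rcases hyz with ⟨rfl, rfl⟩ | ⟨rfl, rfl⟩ <;> split_ifs with h1 h2 h2
    · rfl
    · rw [h1] at huv
      rcases huv with h | ⟨-, h | h⟩
      · exact absurd h.symm h2
      · exact h.symm
      · exact absurd h h2
    · rw [h2] at huv
      rcases huv with h | ⟨h | h, -⟩
      · exact absurd h h1
      · exact h
      · exact absurd h h1
    · rcases huv with h | ⟨h | h, h' | h'⟩
      · exact h
      · exact h.trans h'.symm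
      · exact absurd h' h2
      · exact absurd h h1
      · exact h.trans h'.symm
    · rfl
    · rw [h1] at huv
      rcases huv with h | ⟨-, h | h⟩
      · exact absurd h.symm h2
      · exact absurd h h2
      · exact h.symm
    · rw [h2] at huv
      rcases huv with h | ⟨h | h, -⟩
      · exact absurd h h1
      · exact absurd h h1
      · exact h
    · rcases huv with h | ⟨h | h, h' | h'⟩
      · exact h
      · exact h.trans h'.symm
      · exact absurd h h1
      · exact absurd h' h2
      · exact h.trans h'.symm

theorem toRing_eq_zero_of_mem_supp {Q : Set D.State} {i : ℤ} {f : D.State → ℚ}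
    (hf : f ∈ (complex halt).supp Q i)
    (h : ∀ l : D.Circle S → Label, ¬ ((⟨S, l⟩ : D.State) ∈ Q ∧ (S.card : ℤ) = i)) :
    toRing f S = 0 := by
  refine toRing_eq_zero fun l => ?_
  by_contra hl
  exact h l (hf _ hl)

/-- A cocycle over the resolution of a pendant bridge lifts. -/
theorem exists_lift_of_pendant {a : ι} (haU : a ∈ U) (haT : a ∉ T) (hTU : T ⊆ U)
    (hB : ∀ b ∈ U \ T, ¬ D.LinkedAt (U.erase b) b) {y z : D.Point}
    (hyz : y = D.corner a 0 ∧ z = D.corner a 2 ∨ y = D.corner a 2 ∧ z = D.corner a 0)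
    (hpend : ∀ b ∈ U \ T, b ≠ a →
      ¬ D.circ T (D.corner b 0) = D.circ T z ∧ ¬ D.circ T (D.corner b 2) = D.circ T z)
    {f : D.State → ℚ} (hf : f ∈ (complex halt).supp (D.cube (insert a T) U) (T.card + 1))
    (hdf : (complex halt).dif (D.cube (insert a T) U) f = 0) :
    ∃ g ∈ (complex halt).supp (D.cube T U) T.card,
      (complex halt).dif (D.cube T U) g = f := by
  have hcardT : (insert a T).card = T.card + 1 := Finset.card_insert_of_notMem haT
  have hm : ∀ V ⊆ U, T ⊆ V → ∀ b ∈ U, b ∉ V →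
      Merges (D.circ V) (D.circ (insert b V)) (D.corner b 0) (D.corner b 2) :=
    fun V hV hTV b hbU hbV => merges_insert halt hbV (not_sameAt_of_subset_erase
      (hB b (Finset.mem_sdiff.2 ⟨hbU, fun h => hbV (hTV h)⟩)) (Finset.subset_erase.2 ⟨hV, hbV⟩))
  have htheta : ∀ V ⊆ U, T ⊆ V → ∀ b ∈ U, b ∉ V → D.theta V b = 1 :=
    fun V hV hTV b hbU hbV => if_neg (hm V hV hTV b hbU hbV).ne
  set p := toRing f (insert a T) with hp
  have hcyc : ∀ b ∈ U, b ∉ insert a T → p ∈ D.circleIdeal (insert b (insert a T)) := by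
    intro b hbU hbT
    have h1 : toRing (diff f) (insert b (insert a T)) = 0 := by
      refine toRing_eq_zero fun l => ?_
      rw [← dif_cube_apply halt (Finset.subset_insert b _)
        (Finset.insert_subset hbU (Finset.insert_subset haU hTU)), hdf]
      rfl
    have h2 := toCircle_toRing_diff halt f (insert b (insert a T))
    rw [h1, map_zero, Finset.sum_eq_single b, Finset.erase_insert hbT,
      htheta _ (Finset.insert_subset haU hTU) (Finset.subset_insert a T) b hbU hbT, one_mul] at h2
    · rw [← toCircle_eq_zero_iff]
      exact (smul_eq_zero.1 h2.symm).resolve_left (left_ne_zero_of_mul_eq_one (sgn_mul_self _ _))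
    · intro c hc hcb
      rw [toRing_eq_zero_of_mem_supp halt hf, mul_zero, map_zero, smul_zero]
      rintro l ⟨⟨h3, -⟩, -⟩
      rcases Finset.mem_insert.1 hc with h | h
      · exact hcb h
      · exact Finset.notMem_erase c _ (h3 h)
    · exact fun h => absurd (Finset.mem_insert_self b _) h
  obtain ⟨g, hg, hg0⟩ := exists_toRing_family (D := D) {T} fun _ => sgn T a • collapse T y z p
  have hg := hg T rfl
  have hgs : g ∈ (complex halt).supp (D.cube T U) T.card := by
    intro s hs
    have h1 : s.1 = T := by
      by_contra h
      exact hs (hg0 s h)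
    exact ⟨⟨h1 ▸ subset_rfl, h1 ▸ hTU⟩, by rw [← h1]; rfl⟩
  refine ⟨g, hgs, ?_⟩
  ext ⟨S, l⟩
  by_cases hS : (T ⊆ S ∧ S ⊆ U) ∧ (S.card : ℤ) = T.card + 1
  swap
  · have h1 : (complex halt).dif (D.cube T U) g ⟨S, l⟩ = 0 := by
      by_contra h
      exact hS (BasedComplex.dif_mem hgs _ h)
    rw [h1]
    by_contra h
    obtain ⟨h2, h3⟩ := hf _ (Ne.symm h)
    exact hS ⟨⟨(Finset.subset_insert a T).trans h2.1, h2.2⟩, h3⟩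
  obtain ⟨⟨hTS, hSU⟩, hcard⟩ := hS
  obtain ⟨c, hcT, rfl⟩ : ∃ c, c ∉ T ∧ insert c T = S :=
    Finset.covBy_iff_exists_insert.1 (Finset.covBy_iff_card_sdiff_eq_one.2 ⟨hTS, by
      rw [Finset.card_sdiff_of_subset hTS]; omega⟩)
  have hcU : c ∈ U := hSU (Finset.mem_insert_self c T)
  rw [dif_cube_apply halt hTS hSU]
  refine eq_of_toRing ?_ l
  rw [toCircle_toRing_diff halt, Finset.sum_eq_single c, Finset.erase_insert hcT,
    toCircle_theta_mul halt hcT hg, htheta T hTU subset_rfl c hcU hcT, one_mul, map_smul]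
  · by_cases hca : c = a
    · subst hca
      rw [smul_smul, sgn_mul_self, one_smul, toCircle_collapse]
      have hmc := hm T hTU subset_rfl c hcU hcT
      intro u hu
      rw [hmc.eq_of_eq hu]
      rcases hyz with ⟨rfl, rfl⟩ | ⟨rfl, rfl⟩
      · exact hmc.eq.symm
      · exact hmc.eq
    · obtain ⟨h0, h2⟩ := hpend c (Finset.mem_sdiff.2 ⟨hcU, hcT⟩) hca
      have h3 := collapse_mem hyz (hm T hTU subset_rfl c hcU hcT) h0 h2
        (hm (insert c T) hSU hTS a haU (by simp [haT, Ne.symm hca]))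
        (p := p) (by
          rw [Finset.insert_comm]
          exact hcyc c hcU (by simp [hca, hcT]))
      rw [toCircle_eq_zero_iff.2 h3, smul_zero, smul_zero, toRing_eq_zero_of_mem_supp halt hf,
        map_zero]
      rintro l ⟨⟨h4, -⟩, -⟩
      rcases Finset.mem_insert.1 (h4 (Finset.mem_insert_self a T)) with h | h
      · exact hca h.symm
      · exact haT h
  · intro b hb hbc
    rw [toRing_eq_zero fun l => ?_, mul_zero, map_zero, smul_zero]
    refine hg0 _ fun h => ?_
    have h' : (insert c T).erase b = T := h
    rcases Finset.mem_insert.1 hb with h | h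
    · exact hbc h
    · rw [← h'] at h
      exact Finset.notMem_erase b _ h
  · exact fun h => absurd (Finset.mem_insert_self c T) h

/-- A cube of bridges is exact except at its initial vertex. -/
theorem exactAt_of_bridges (hTU : T ⊆ U) (hB : ∀ b ∈ U \ T, ¬ D.LinkedAt (U.erase b) b) {i : ℤ}
    (hi : i ≠ T.card) : (complex halt).ExactAt (D.cube T U) i := by
  classical
  induction hn : (U \ T).card generalizing T U i with
  | zero =>
    have hUT : U ⊆ T := by simpa [Finset.sdiff_eq_empty_iff_subset] using hn
    refine exactAt_of_forall_eq_zero fun s hs h => hi ?_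
    rw [← h]
    show (s.1.card : ℤ) = _
    rw [(hs.2.trans hUT).antisymm hs.1]
  | succ n ih =>
    have hmerge : ∀ V ⊆ U \ T, ∀ c ∈ V,
        Merges (D.circ (U \ V)) (D.circ (U \ V.erase c)) (D.corner c 0) (D.corner c 2) := by
      intro V hV c hc
      have hcU := Finset.mem_sdiff.1 (hV hc)
      have h1 : U \ V.erase c = insert c (U \ V) := by
        ext b
        simp only [Finset.mem_sdiff, Finset.mem_erase, Finset.mem_insert]
        by_cases hbc : b = c
        · subst hbc; tauto
        · tauto
      rw [h1]
      refine merges_insert halt (by simp [hc]) (not_sameAt_of_subset_erase (hB c (hV hc)) ?_)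
      intro b hb
      have hb := Finset.mem_sdiff.1 hb
      exact Finset.mem_erase.2 ⟨fun h => hb.2 (h ▸ hc), hb.1⟩
    have hne : (U \ T).Nonempty := Finset.card_pos.1 (by omega)
    obtain ⟨a, ha, y, z, hyz, -, hpend⟩ := exists_pendant
      (r := fun V u v => D.circ (U \ V) u = D.circ (U \ V) v)
      (fun V => ⟨fun _ => rfl, fun h => h.symm, fun h h' => h.trans h'⟩)
      (fun V hV c hc u v => (hmerge V hV c hc).eq_of_eq)
      (fun V hV c hc => (hmerge V hV c hc).ne)
      (fun V hV c hc => (hmerge V hV c hc).eq) hne (D.corner hne.choose 0)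
    rw [Finset.sdiff_sdiff_eq_self hTU] at hpend
    obtain ⟨haU, haT⟩ := Finset.mem_sdiff.1 ha
    have hsplit := split_cube halt T U a
    have hQ := convex_cube halt T U
    have hcardT : (insert a T).card = T.card + 1 := Finset.card_insert_of_notMem haT
    have ih0 : ∀ i : ℤ, i ≠ T.card → (complex halt).ExactAt (D.cube T (U.erase a)) i := by
      intro i hi
      refine ih (Finset.subset_erase.2 ⟨hTU, haT⟩) (fun b hb h => ?_) hi ?_
      · have hb := Finset.mem_sdiff.1 hb
        exact hB b (Finset.mem_sdiff.2 ⟨Finset.mem_of_mem_erase hb.1, hb.2⟩)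
          (h.mono (Finset.erase_subset_erase b (Finset.erase_subset a U)))
      · rw [erase_sdiff_eq, Finset.card_erase_of_mem ha, hn]
        rfl
    have ih1 : ∀ i : ℤ, i ≠ T.card + 1 → (complex halt).ExactAt (D.cube (insert a T) U) i := by
      intro i hi
      refine ih (Finset.insert_subset haU hTU) (fun b hb => ?_) ?_ ?_
      · have hb := Finset.mem_sdiff.1 hb
        exact hB b (Finset.mem_sdiff.2 ⟨hb.1, fun h => hb.2 (Finset.mem_insert_of_mem h)⟩)
      · rw [hcardT]; exact_mod_cast hi
      · rw [Finset.sdiff_insert, Finset.card_erase_of_mem ha, hn]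
        rfl
    by_cases hi1 : i ≠ T.card + 1
    · exact hsplit.exactAt hQ (ih0 i hi) (ih1 i hi1)
    obtain rfl := not_not.1 hi1
    clear hi1 ih1
    intro f hf hdf
    obtain ⟨g0, hg0, hgf0⟩ := ih0 _ hi _ (BasedComplex.res_mem hf)
      (by rw [← hsplit.res_dif hf, hdf, map_zero])
    have hf1 := hsplit.sub_dif_mem_right hf hg0 hgf0
    have hg0' := BasedComplex.supp_mono hsplit.left_subset hg0
    obtain ⟨g, hg, hgf⟩ := exists_lift_of_pendant halt haU haT hTU hB hyz hpend hf1
      (by rw [← hsplit.dif_right hf1, map_sub, hdf, BasedComplex.dif_dif hQ hg0', sub_zero])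
    refine ⟨g0 + g, Submodule.add_mem _ hg0' (by simpa using hg), ?_⟩
    rw [map_add, hgf]
    abel

end LinkDiagram

namespace LinkDiagram

open MvPolynomial

variable {ι : Type*} [LinearOrder ι] {D : LinkDiagram ι} {S T U : Finset ι}

open scoped Classical in
/-- Expansion of a polynomial with respect to the variable of the circle of `D(U)` through `z`. -/
noncomputable def expand (S U : Finset ι) (z : D.Point) :
    D.PointRing →ₐ[ℚ] TrivSqZeroExt (D.CircleRing S) (D.CircleRing S) :=
  aeval fun u => if D.circ U u = D.circ U z then TrivSqZeroExt.inr (1 : D.CircleRing S)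
    else TrivSqZeroExt.inl (D.toCircle S (X u))

theorem expand_X_of_eq {z u : D.Point} (h : D.circ U u = D.circ U z) :
    expand S U z (X u) = TrivSqZeroExt.inr (1 : D.CircleRing S) := by
  rw [expand, aeval_X, if_pos h]

theorem expand_X_of_ne {z u : D.Point} (h : D.circ U u ≠ D.circ U z) :
    expand S U z (X u) = TrivSqZeroExt.inl (D.toCircle S (X u)) := by
  rw [expand, aeval_X, if_neg h]

theorem expand_eq_zero {z : D.Point} (h : ∀ u v, D.circ U u = D.circ U v → D.circ S u = D.circ S v)
    {p : D.PointRing} (hp : p ∈ D.circleIdeal U) : expand S U z p = 0 := by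
  refine map_eq_zero_of_mem (A := TrivSqZeroExt (D.CircleRing S) (D.CircleRing S))
    (φ := (expand S U z).toRingHom) (fun u => ?_) (fun u v huv => ?_) hp
  · simp only [AlgHom.toRingHom_eq_coe, RingHom.coe_coe]
    by_cases hu : D.circ U u = D.circ U z
    · rw [expand_X_of_eq hu, TrivSqZeroExt.inr_mul_inr]
    · rw [expand_X_of_ne hu, ← TrivSqZeroExt.inl_mul, toCircle_X_mul_self, TrivSqZeroExt.inl_zero]
  · simp only [AlgHom.toRingHom_eq_coe, RingHom.coe_coe]
    by_cases hu : D.circ U u = D.circ U z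
    · rw [expand_X_of_eq hu, expand_X_of_eq (huv.symm.trans hu)]
    · rw [expand_X_of_ne hu, expand_X_of_ne (fun h' => hu (huv.trans h')), toCircle_X_eq (h u v huv)]

theorem fst_add_snd_expand {y z : D.Point} (h : ∀ u, D.circ U u = D.circ U z →
    D.circ S u = D.circ S y) (p : D.PointRing) :
    (expand S U z p).fst + D.toCircle S (X y) * (expand S U z p).snd = D.toCircle S p := by
  induction p using MvPolynomial.induction_on with
  | C c =>
    have h1 : expand S U z (C c) =
        algebraMap ℚ (TrivSqZeroExt (D.CircleRing S) (D.CircleRing S)) c := by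
      rw [expand, aeval_C]
    have h2 : D.toCircle S (C c) = algebraMap ℚ (D.CircleRing S) c := by
      rw [← MvPolynomial.algebraMap_eq, AlgHom.commutes]
    rw [h1, h2, TrivSqZeroExt.algebraMap_eq_inl']
    simp
  | add p q hp hq =>
    rw [map_add, map_add, ← hp, ← hq, TrivSqZeroExt.fst_add, TrivSqZeroExt.snd_add]
    ring
  | mul_X p u hp =>
    rw [map_mul, map_mul, ← hp, TrivSqZeroExt.fst_mul, TrivSqZeroExt.snd_mul]
    by_cases hu : D.circ U u = D.circ U z
    · have h1 := toCircle_X_mul_self (S := S) y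
      rw [expand_X_of_eq hu, toCircle_X_eq (h u hu)]
      simp only [TrivSqZeroExt.fst_inr, TrivSqZeroExt.snd_inr, smul_eq_mul,
        MulOpposite.smul_eq_mul_unop, MulOpposite.unop_op, mul_zero]
      linear_combination (-(expand S U z p).snd) * h1
    · rw [expand_X_of_ne hu]
      simp only [TrivSqZeroExt.fst_inl, TrivSqZeroExt.snd_inl, smul_eq_mul,
        MulOpposite.smul_eq_mul_unop, MulOpposite.unop_op]
      ring

theorem snd_expand_mul {z u v : D.Point} (hu : D.circ U u ≠ D.circ U z)
    (hv : D.circ U v ≠ D.circ U z) (p : D.PointRing) :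
    (expand S U z ((X u + X v) * p)).snd = D.toCircle S (X u + X v) * (expand S U z p).snd := by
  rw [map_mul, map_add, expand_X_of_ne hu, expand_X_of_ne hv, ← TrivSqZeroExt.inl_add, map_add,
    TrivSqZeroExt.snd_mul]
  simp

theorem snd_expand_mul_of_eq {y z u v : D.Point} (h : ∀ u, D.circ U u = D.circ U z →
    D.circ S u = D.circ S y) (hyz : D.circ U y ≠ D.circ U z)
    (huv : y = u ∧ z = v ∨ y = v ∧ z = u) (p : D.PointRing) :
    (expand S U z ((X u + X v) * p)).snd = D.toCircle S p := by
  have h1 : (X u + X v : D.PointRing) = X y + X z := by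
    rcases huv with ⟨rfl, rfl⟩ | ⟨rfl, rfl⟩
    · rfl
    · exact add_comm _ _
  rw [← fst_add_snd_expand h, h1, map_mul, map_add, expand_X_of_ne hyz, expand_X_of_eq rfl,
    TrivSqZeroExt.snd_mul]
  simp
  ring

variable [Fintype ι] (halt : D.Alternating)

theorem exists_primitive_of_pendant {a : ι} (haU : a ∈ U) (haT : a ∉ T) (hTU : T ⊆ U)
    (hL : ∀ b ∈ U \ T, D.LinkedAt T b) {y z : D.Point}
    (hyz : y = D.corner a 0 ∧ z = D.corner a 2 ∨ y = D.corner a 2 ∧ z = D.corner a 0)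
    (hpend : ∀ b ∈ U \ T, b ≠ a →
      ¬ D.circ U (D.corner b 0) = D.circ U z ∧ ¬ D.circ U (D.corner b 2) = D.circ U z)
    {f : D.State → ℚ} (hf : f ∈ (complex halt).supp (D.cube T U) (U.card - 1))
    (hdf : (complex halt).dif (D.cube T U) f = 0) :
    ∃ g ∈ (complex halt).supp (D.cube T (U.erase a)) (U.card - 1 - 1),
      (complex halt).dif (D.cube T (U.erase a)) g = BasedComplex.res (D.cube T (U.erase a)) f := by
  have hsame : ∀ V, T ⊆ V → ∀ b ∈ U, b ∉ V → D.SameAt V b := fun V hTV b hbU hbV =>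
    (sameAt_iff_linkedAt halt hbV).2
      ((hL b (Finset.mem_sdiff.2 ⟨hbU, fun h => hbV (hTV h)⟩)).mono hTV)
  have htheta : ∀ V, T ⊆ V → ∀ b ∈ U, b ∉ V → D.theta V b = X (D.corner b 0) + X (D.corner b 2) :=
    fun V hTV b hbU hbV => if_pos (hsame V hTV b hbU hbV)
  set S := U.erase a with hS
  have hTS : T ⊆ S := Finset.subset_erase.2 ⟨hTU, haT⟩
  have hSU : insert a S = U := Finset.insert_erase haU
  have haS : a ∉ S := Finset.notMem_erase a U
  have hcardS : (S.card : ℤ) = U.card - 1 := by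
    rw [← hSU, Finset.card_insert_of_notMem haS]
    push_cast
    ring
  have hm : Merges (D.circ U) (D.circ S) (D.corner a 0) (D.corner a 2) := by
    rw [← hSU]
    exact splits_insert halt haS (hsame S hTS a haU haS)
  have hzy : ∀ u, D.circ U u = D.circ U z → D.circ S u = D.circ S y := by
    intro u hu
    rw [hm.eq_of_eq hu]
    rcases hyz with ⟨rfl, rfl⟩ | ⟨rfl, rfl⟩
    · exact hm.eq.symm
    · exact hm.eq
  have hyz' : D.circ U y ≠ D.circ U z := by
    rcases hyz with ⟨rfl, rfl⟩ | ⟨rfl, rfl⟩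
    · exact hm.ne
    · exact hm.ne.symm
  choose q hq using fun c => Ideal.Quotient.mk_surjective (expand S U z (toRing f (U.erase c))).snd
  have hqT : ∀ c ∈ T, D.toCircle S (q c) = 0 := by
    intro c hc
    rw [show D.toCircle S (q c) = _ from hq c, toRing_eq_zero_of_mem_supp halt hf, map_zero,
      TrivSqZeroExt.snd_zero]
    rintro l ⟨⟨h, -⟩, -⟩
    exact Finset.notMem_erase c U (h hc)
  have hcyc : D.toCircle S (toRing f S) = -sgn S a • ∑ c ∈ S, sgn (U.erase c) c •
      D.toCircle S ((X (D.corner c 0) + X (D.corner c 2)) * q c) := by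
    have h1 : toRing (diff f) U = 0 := by
      refine toRing_eq_zero fun l => ?_
      rw [← dif_cube_apply halt hTU subset_rfl, hdf]
      rfl
    have h2 := toCircle_toRing_diff halt f U
    rw [h1, map_zero] at h2
    simp only [← map_smul, ← map_sum] at h2
    have h3 := congrArg TrivSqZeroExt.snd (expand_eq_zero (S := S) (z := z)
      (fun u v huv => hm.eq_of_eq huv) (toCircle_eq_zero_iff.1 h2.symm))
    rw [map_sum, TrivSqZeroExt.snd_sum, TrivSqZeroExt.snd_zero] at h3
    simp only [map_smul, TrivSqZeroExt.snd_smul] at h3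
    rw [← Finset.add_sum_erase _ _ haU, ← hS, htheta S hTS a haU haS,
      snd_expand_mul_of_eq hzy hyz' hyz] at h3
    have h4 : ∀ c ∈ S, sgn (U.erase c) c •
        (expand S U z (D.theta (U.erase c) c * toRing f (U.erase c))).snd =
        sgn (U.erase c) c • D.toCircle S ((X (D.corner c 0) + X (D.corner c 2)) * q c) := by
      intro c hc
      obtain ⟨hca, hcU⟩ := Finset.mem_erase.1 hc
      by_cases hcT : c ∈ T
      · rw [toRing_eq_zero_of_mem_supp halt hf, mul_zero, map_zero, TrivSqZeroExt.snd_zero,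
          map_mul (D.toCircle S), hqT c hcT, mul_zero]
        rintro l ⟨⟨h, -⟩, -⟩
        exact Finset.notMem_erase c U (h hcT)
      · obtain ⟨h0, h2⟩ := hpend c (Finset.mem_sdiff.2 ⟨hcU, hcT⟩) hca
        rw [htheta _ (Finset.subset_erase.2 ⟨hTU, hcT⟩) c hcU (Finset.notMem_erase c U),
          snd_expand_mul h0 h2, map_mul (D.toCircle S), show D.toCircle S (q c) = _ from hq c]
    rw [Finset.sum_congr rfl h4] at h3
    have h5 := congrArg (fun w => sgn S a • w) h3
    simp only [smul_add, smul_smul, sgn_mul_self, one_smul, smul_zero] at h5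
    rw [neg_smul, eq_neg_iff_add_eq_zero]
    exact h5
  obtain ⟨g, hg, hg0⟩ := exists_toRing_family (D := D) {V | ∃ c ∈ S, c ∉ T ∧ V = S.erase c}
    fun V => ∑ c ∈ S \ V, (-sgn S a * sgn (U.erase c) c * sgn (S.erase c) c) • q c
  have hgs : g ∈ (complex halt).supp (D.cube T S) (U.card - 1 - 1) := by
    intro s hs
    obtain ⟨c, hcS, hcT, hsc⟩ : s.1 ∈ {V | ∃ c ∈ S, c ∉ T ∧ V = S.erase c} := by
      by_contra h
      exact hs (hg0 s h)
    refine ⟨⟨?_, ?_⟩, ?_⟩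
    · rw [hsc]; exact Finset.subset_erase.2 ⟨hTS, hcT⟩
    · rw [hsc]; exact Finset.erase_subset c S
    · show (s.1.card : ℤ) = _
      rw [hsc, Finset.card_erase_of_mem hcS, ← hcardS, Nat.cast_sub (Finset.card_pos.2 ⟨c, hcS⟩)]
      rfl
  refine ⟨g, hgs, ?_⟩
  ext ⟨V, l⟩
  by_cases hV : (T ⊆ V ∧ V ⊆ S) ∧ (V.card : ℤ) = U.card - 1
  swap
  · have h1 : (complex halt).dif (D.cube T S) g ⟨V, l⟩ = 0 := by
      by_contra h
      exact hV (BasedComplex.dif_mem' hgs _ h)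
    rw [h1]
    by_contra h
    exact hV (BasedComplex.res_mem hf _ (Ne.symm h))
  obtain ⟨⟨hTV, hVS⟩, hcard⟩ := hV
  obtain rfl : V = S := Finset.eq_of_subset_of_card_le hVS (by omega)
  rw [dif_cube_apply halt hTV hVS, BasedComplex.res_apply_of_mem (show _ ∈ D.cube T S from ⟨hTV, hVS⟩)]
  refine eq_of_toRing ?_ l
  rw [toCircle_toRing_diff halt, hcyc, Finset.smul_sum]
  refine Finset.sum_congr rfl fun c hc => ?_
  by_cases hcT : c ∈ T
  · rw [toRing_eq_zero fun l => hg0 _ ?_, mul_zero, map_zero, map_mul, hqT c hcT, mul_zero,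
      smul_zero, smul_zero, smul_zero]
    rintro ⟨c', hc', hcT', h⟩
    have h' : S.erase c = S.erase c' := h
    refine Finset.notMem_erase c S (h' ▸ Finset.mem_erase.2 ⟨fun h => hcT' (h ▸ hcT), hc⟩)
  · have hcU : c ∈ U := Finset.mem_of_mem_erase hc
    have h1 := toCircle_theta_mul halt (Finset.notMem_erase c S) (hg _ ⟨c, hc, hcT, rfl⟩)
    have h2 : S \ S.erase c = {c} := by
      ext b
      simp only [Finset.mem_sdiff, Finset.mem_erase, Finset.mem_singleton]
      constructor
      · tauto
      · rintro rfl; tauto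
    rw [Finset.insert_erase hc, h2, Finset.sum_singleton, mul_smul_comm, map_smul,
      htheta _ (Finset.subset_erase.2 ⟨hTV, hcT⟩) c hcU (Finset.notMem_erase c S)] at h1
    rw [htheta _ (Finset.subset_erase.2 ⟨hTV, hcT⟩) c hcU (Finset.notMem_erase c S), h1, smul_smul,
      smul_smul]
    congr 1
    linear_combination (-sgn S a * sgn (U.erase c) c) * sgn_mul_self (S.erase c) c

/-- A cube of loops is exact except at its terminal vertex. -/
theorem exactAt_of_loops (hTU : T ⊆ U) (hL : ∀ b ∈ U \ T, D.LinkedAt T b) {i : ℤ}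
    (hi : i ≠ U.card) : (complex halt).ExactAt (D.cube T U) i := by
  induction hn : (U \ T).card generalizing T U i with
  | zero =>
    have hUT : U ⊆ T := by simpa [Finset.sdiff_eq_empty_iff_subset] using hn
    refine exactAt_of_forall_eq_zero fun s hs h => hi ?_
    rw [← h]
    show (s.1.card : ℤ) = _
    rw [hs.2.antisymm (hUT.trans hs.1)]
  | succ n ih =>
    have hmerge : ∀ V ⊆ U \ T, ∀ c ∈ V,
        Merges (D.circ (T ∪ V)) (D.circ (T ∪ V.erase c)) (D.corner c 0) (D.corner c 2) := by
      intro V hV c hc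
      have hcU := Finset.mem_sdiff.1 (hV hc)
      have hcV : c ∉ T ∪ V.erase c := by simp [hcU.2]
      rw [show T ∪ V = insert c (T ∪ V.erase c) by
        rw [← Finset.union_insert, Finset.insert_erase hc]]
      exact splits_insert halt hcV ((sameAt_iff_linkedAt halt hcV).2
        ((hL c (hV hc)).mono Finset.subset_union_left))
    have hne : (U \ T).Nonempty := Finset.card_pos.1 (by omega)
    obtain ⟨a, ha, y, z, hyz, -, hpend⟩ := exists_pendant
      (r := fun V u v => D.circ (T ∪ V) u = D.circ (T ∪ V) v)
      (fun V => ⟨fun _ => rfl, fun h => h.symm, fun h h' => h.trans h'⟩)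
      (fun V hV c hc u v => (hmerge V hV c hc).eq_of_eq)
      (fun V hV c hc => (hmerge V hV c hc).ne)
      (fun V hV c hc => (hmerge V hV c hc).eq) hne (D.corner hne.choose 0)
    rw [Finset.union_sdiff_of_subset hTU] at hpend
    obtain ⟨haU, haT⟩ := Finset.mem_sdiff.1 ha
    have hsplit := split_cube halt T U a
    have hQ := convex_cube halt T U
    have hcardU : ((U.erase a).card : ℤ) = U.card - 1 := by
      rw [Finset.card_erase_of_mem haU, Nat.cast_sub (Finset.card_pos.2 ⟨a, haU⟩)]
      rfl
    have ih0 : ∀ i : ℤ, i ≠ U.card - 1 → (complex halt).ExactAt (D.cube T (U.erase a)) i := by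
      intro i hi
      refine ih (Finset.subset_erase.2 ⟨hTU, haT⟩) (fun b hb => ?_) (by rwa [hcardU]) ?_
      · have hb := Finset.mem_sdiff.1 hb
        exact hL b (Finset.mem_sdiff.2 ⟨Finset.mem_of_mem_erase hb.1, hb.2⟩)
      · rw [erase_sdiff_eq, Finset.card_erase_of_mem ha, hn]
        rfl
    have ih1 : (complex halt).ExactAt (D.cube (insert a T) U) i := by
      refine ih (Finset.insert_subset haU hTU) (fun b hb => ?_) hi ?_
      · have hb := Finset.mem_sdiff.1 hb
        exact (hL b (Finset.mem_sdiff.2 ⟨hb.1, fun h => hb.2 (Finset.mem_insert_of_mem h)⟩)).mono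
          (Finset.subset_insert a T)
      · rw [Finset.sdiff_insert, Finset.card_erase_of_mem ha, hn]
        rfl
    by_cases hi1 : i ≠ U.card - 1
    · exact hsplit.exactAt hQ (ih0 i hi1) ih1
    obtain rfl := not_not.1 hi1
    clear hi1 ih0
    intro f hf hdf
    obtain ⟨g0, hg0, hgf0⟩ := exists_primitive_of_pendant halt haU haT hTU hL hyz hpend hf hdf
    have hf1 := hsplit.sub_dif_mem_right hf hg0 hgf0
    have hg0' := BasedComplex.supp_mono hsplit.left_subset hg0
    obtain ⟨g, hg, hgf⟩ := ih1 _ hf1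
      (by rw [← hsplit.dif_right hf1, map_sub, hdf, BasedComplex.dif_dif hQ hg0', sub_zero])
    refine ⟨g0 + g, Submodule.add_mem _ hg0' (BasedComplex.supp_mono hsplit.right_subset hg), ?_⟩
    rw [map_add, hsplit.dif_right hg, hgf]
    abel

theorem exactAt_above {L : Finset ι} (hTU : T ⊆ U) (hL : L ⊆ U \ T)
    (hB : ∀ b ∈ (U \ T) \ L, ¬ D.LinkedAt (U.erase b) b) {i : ℤ} (hi : T.card + L.card < i) :
    (complex halt).ExactAt (D.cube T U) i := by
  induction L using Finset.induction_on generalizing T U with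
  | empty =>
    refine exactAt_of_bridges halt hTU (by simpa using hB) (ne_of_gt ?_)
    simpa using hi
  | insert a L haL ih =>
    rw [Finset.card_insert_of_notMem haL] at hi
    push_cast at hi
    obtain ⟨haU, haT⟩ := Finset.mem_sdiff.1 (hL (Finset.mem_insert_self a L))
    have hL' : ∀ b ∈ L, b ≠ a ∧ b ∈ U ∧ b ∉ T := fun b hb =>
      ⟨fun h => haL (h ▸ hb), Finset.mem_sdiff.1 (hL (Finset.mem_insert_of_mem hb))⟩
    have hB' : ∀ b ∈ U, b ∉ T → b ≠ a → b ∉ L → ¬ D.LinkedAt (U.erase b) b :=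
      fun b hbU hbT hba hbL => hB b (by simp [hbU, hbT, hba, hbL])
    refine (split_cube halt T U a).exactAt (convex_cube halt T U) (ih ?_ ?_ ?_ ?_) (ih ?_ ?_ ?_ ?_)
    · exact Finset.subset_erase.2 ⟨hTU, haT⟩
    · intro b hb
      obtain ⟨h1, h2, h3⟩ := hL' b hb
      simp [h1, h2, h3]
    · intro b hb h
      simp only [Finset.mem_sdiff, Finset.mem_erase] at hb
      exact hB' b hb.1.1.2 hb.1.2 hb.1.1.1 hb.2
        (h.mono (Finset.erase_subset_erase b (Finset.erase_subset a U)))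
    · linarith
    · exact Finset.insert_subset haU hTU
    · intro b hb
      obtain ⟨h1, h2, h3⟩ := hL' b hb
      simp [h1, h2, h3]
    · intro b hb
      simp only [Finset.mem_sdiff, Finset.mem_insert, not_or] at hb
      exact hB' b hb.1.1 hb.1.2.2 hb.1.2.1 hb.2
    · rw [Finset.card_insert_of_notMem haT]
      push_cast
      linarith

theorem exactAt_below {B : Finset ι} (hTU : T ⊆ U) (hB : B ⊆ U \ T)
    (hL : ∀ b ∈ (U \ T) \ B, D.LinkedAt T b) {i : ℤ} (hi : i < U.card - B.card) :
    (complex halt).ExactAt (D.cube T U) i := by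
  induction B using Finset.induction_on generalizing T U with
  | empty =>
    refine exactAt_of_loops halt hTU (by simpa using hL) (ne_of_lt ?_)
    simpa using hi
  | insert a B haB ih =>
    rw [Finset.card_insert_of_notMem haB] at hi
    push_cast at hi
    obtain ⟨haU, haT⟩ := Finset.mem_sdiff.1 (hB (Finset.mem_insert_self a B))
    have hB' : ∀ b ∈ B, b ≠ a ∧ b ∈ U ∧ b ∉ T := fun b hb =>
      ⟨fun h => haB (h ▸ hb), Finset.mem_sdiff.1 (hB (Finset.mem_insert_of_mem hb))⟩
    have hL' : ∀ b ∈ U, b ∉ T → b ≠ a → b ∉ B → D.LinkedAt T b :=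
      fun b hbU hbT hba hbL => hL b (by simp [hbU, hbT, hba, hbL])
    refine (split_cube halt T U a).exactAt (convex_cube halt T U) (ih ?_ ?_ ?_ ?_) (ih ?_ ?_ ?_ ?_)
    · exact Finset.subset_erase.2 ⟨hTU, haT⟩
    · intro b hb
      obtain ⟨h1, h2, h3⟩ := hB' b hb
      simp [h1, h2, h3]
    · intro b hb
      simp only [Finset.mem_sdiff, Finset.mem_erase] at hb
      exact hL' b hb.1.1.2 hb.1.2 hb.1.1.1 hb.2
    · rw [Finset.card_erase_of_mem haU, Nat.cast_sub (Finset.card_pos.2 ⟨a, haU⟩)]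
      push_cast
      linarith
    · exact Finset.insert_subset haU hTU
    · intro b hb
      obtain ⟨h1, h2, h3⟩ := hB' b hb
      simp [h1, h2, h3]
    · intro b hb
      simp only [Finset.mem_sdiff, Finset.mem_insert, not_or] at hb
      exact (hL' b hb.1.1 hb.1.2.2 hb.1.2.1 hb.2).mono (Finset.subset_insert a T)
    · linarith

end LinkDiagram

namespace Label

/-- The coefficient of `q ^ k` in `(q + q⁻¹) ^ n`. -/
def count (n : ℕ) (k : ℤ) : ℤ :=
  ∑ l : Fin n → Label, if ∑ i, (l i).deg = k then 1 else 0

theorem count_zero (k : ℤ) : count 0 k = if 0 = k then 1 else 0 := by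
  simp [count]

theorem sum_univ {M : Type*} [AddCommMonoid M] (f : Label → M) : ∑ x, f x = f one + f X := by
  show ∑ x ∈ ({one, X} : Finset Label), f x = _
  rw [Finset.sum_insert (by simp), Finset.sum_singleton]

theorem count_succ (n : ℕ) (k : ℤ) : count (n + 1) k = count n (k - 1) + count n (k + 1) := by
  rw [count, ← (Fin.consEquiv fun _ => Label).sum_comp, Fintype.sum_prod_type, sum_univ, count, count]
  congr 1 <;> refine Finset.sum_congr rfl fun l _ => ?_ <;>
    simp only [Fin.consEquiv, Equiv.coe_fn_mk, Fin.sum_univ_succ, Fin.cons_zero, Fin.cons_succ, deg]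
  · exact if_congr ⟨fun h => by linarith, fun h => by linarith⟩ rfl rfl
  · exact if_congr ⟨fun h => by linarith, fun h => by linarith⟩ rfl rfl

theorem sum_ite_deg {α : Type*} [Fintype α] [DecidableEq α] (k : ℤ) :
    (∑ l : α → Label, if ∑ z, (l z).deg = k then (1 : ℤ) else 0) = count (Fintype.card α) k := by
  rw [count, ← ((Fintype.equivFin α).arrowCongr (Equiv.refl Label)).sum_comp]
  refine Finset.sum_congr rfl fun l _ => ?_
  rw [← (Fintype.equivFin α).sum_comp]
  simp

end Label

namespace BasedComplex

variable {X : Type*} [Fintype X] {C : BasedComplex X} {Q Q0 Q1 P : Set X} {i : ℤ}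

theorem Split.inter (h : C.Split Q Q0 Q1) (P : Set X) : C.Split (Q ∩ P) (Q0 ∩ P) (Q1 ∩ P) where
  union := by rw [h.union, Set.union_inter_distrib_right]
  disjoint := h.disjoint.mono Set.inter_subset_left Set.inter_subset_left
  coeff s hs t ht := h.coeff s hs.1 t ht.1

theorem Convex.inter (hQ : C.Convex Q) (hP : ∀ s t, C.coeff s t ≠ 0 → (s ∈ P ↔ t ∈ P)) :
    C.Convex (Q ∩ P) := fun s hs u hu t hst htu =>
  ⟨hQ s hs.1 u hu.1 t hst htu, (hP s t hst).1 hs.2⟩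

theorem ExactAt.inter (h : C.ExactAt Q i) (hP : ∀ s t, C.coeff s t ≠ 0 → (s ∈ P ↔ t ∈ P)) :
    C.ExactAt (Q ∩ P) i := by
  have key : ∀ f, C.dif (Q ∩ P) (res P f) = res P (C.dif Q f) := by
    intro f
    ext t
    by_cases ht : t ∈ P
    · rw [res_apply_of_mem ht]
      by_cases htQ : t ∈ Q
      · rw [dif_apply_of_mem (Set.mem_inter htQ ht), dif_apply_of_mem htQ]
        refine Finset.sum_congr rfl fun s _ => ?_
        by_cases hst : C.coeff s t = 0
        · rw [hst, zero_mul, zero_mul]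
        · rw [res_apply_of_mem ((hP s t hst).2 ht)]
      · rw [dif_apply_of_notMem htQ, dif_apply_of_notMem fun h => htQ h.1]
    · rw [res_apply_of_notMem ht, dif_apply_of_notMem fun h => ht h.2]
  intro f hf hdf
  have hfP : res P f = f := by
    ext x
    by_cases hx : x ∈ P
    · exact res_apply_of_mem hx
    · rw [res_apply_of_notMem hx]
      by_contra hfx
      exact hx (hf x (Ne.symm hfx)).1.2
  have hdf' : C.dif Q f = 0 := by
    ext t
    by_cases ht : t ∈ P
    · have := congrFun (key f) t
      rw [hfP, hdf, res_apply_of_mem ht] at this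
      exact this.symm
    · by_cases htQ : t ∈ Q
      · rw [dif_apply_of_mem htQ]
        refine Finset.sum_eq_zero fun s _ => ?_
        by_contra hs
        exact ht ((hP s t (left_ne_zero_of_mul hs)).1 (hf s (right_ne_zero_of_mul hs)).1.2)
      · exact dif_apply_of_notMem htQ
  obtain ⟨g, hg, hgf⟩ := h f (supp_mono Set.inter_subset_left hf) hdf'
  refine ⟨res P g, fun x hx => ?_, by rw [key, hgf, hfP]⟩
  by_cases hxP : x ∈ P
  · rw [res_apply_of_mem hxP] at hx
    exact ⟨⟨(hg x hx).1, hxP⟩, (hg x hx).2⟩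
  · exact absurd (res_apply_of_notMem hxP) hx

theorem exactAt_of_finrank_eq_zero (h : Module.finrank ℚ (C.cohomology Q i) = 0) :
    C.ExactAt Q i :=
  exactAt_iff.2 (Module.finrank_zero_iff.1 h)

open scoped Classical in
theorem sum_eq_of_exactAt (hQ : C.Convex Q) (h0 : ∀ x ∈ Q, 0 ≤ C.deg x) {i : ℕ}
    (h : ∀ k : ℤ, k ≠ i → C.ExactAt Q k) :
    (∑ x, if x ∈ Q then (-1 : ℤ) ^ (C.deg x).toNat else 0) =
      (-1) ^ i * Module.finrank ℚ (C.cohomology Q i) := by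
  obtain ⟨n, hn⟩ : ∃ n : ℕ, i < n ∧ ∀ x, C.deg x < n := by
    obtain ⟨N, hN⟩ := (Set.finite_range fun x => (C.deg x).toNat).bddAbove
    refine ⟨max N i + 1, by omega, fun x => ?_⟩
    have := hN (Set.mem_range_self x)
    change (C.deg x).toNat ≤ N at this
    omega
  have h1 := sum_card_eq_sum_finrank hQ h0 n fun x _ => hn.2 x
  rw [Finset.sum_eq_single (s := Finset.range n) (f := fun k : ℕ =>
    (-1 : ℤ) ^ k * Module.finrank ℚ (C.cohomology Q k)) i (fun k _ hk => by
      rw [finrank_cohomology_eq_zero (h k (by exact_mod_cast hk)), Nat.cast_zero, mul_zero])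
    (fun hi => absurd (Finset.mem_range.2 hn.1) hi)] at h1
  rw [← h1]
  have h2 : ∀ k : ℕ, (-1 : ℤ) ^ k * Nat.card {x // x ∈ Q ∧ C.deg x = k} =
      ∑ x, if x ∈ Q ∧ C.deg x = k then (-1) ^ k else 0 := by
    intro k
    rw [Nat.card_eq_fintype_card, Fintype.card_subtype, Finset.sum_ite, Finset.sum_const_zero,
      add_zero, Finset.sum_const, nsmul_eq_mul, mul_comm]
  rw [Finset.sum_congr rfl fun k _ => h2 k, Finset.sum_comm]
  refine Finset.sum_congr rfl fun x _ => ?_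
  by_cases hx : x ∈ Q
  · have hx0 := h0 x hx
    have hxn := hn.2 x
    rw [if_pos hx, Finset.sum_eq_single (C.deg x).toNat, if_pos ⟨hx, (Int.toNat_of_nonneg hx0).symm⟩]
    · intro k _ hk
      rw [if_neg fun h => hk (by omega)]
    · intro hi
      exact absurd (Finset.mem_range.2 (by omega)) hi
  · simp [hx]

end BasedComplex

namespace LinkDiagram

variable {ι : Type*} [LinearOrder ι] {D : LinkDiagram ι} {S T U L : Finset ι} {j : ℤ}

theorem comps_eq_add (hTU : T ⊆ U) (hL : L ⊆ U \ T) (hl : ∀ b ∈ L, D.LinkedAt T b)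
    [Fintype ι] (hb : ∀ b ∈ (U \ T) \ L, ¬ D.LinkedAt (U.erase b) b) :
    D.comps T + T.card + L.card = D.comps U + U.card := by
  induction hn : (U \ T).card generalizing U L with
  | zero =>
    have hUT : U ⊆ T := by simpa [Finset.sdiff_eq_empty_iff_subset] using hn
    obtain rfl := hTU.antisymm hUT
    have : L = ∅ := by simpa using hL
    rw [this, Finset.card_empty]
    rfl
  | succ n ih =>
    obtain ⟨a, ha⟩ : (U \ T).Nonempty := Finset.card_pos.1 (by omega)
    obtain ⟨haU, haT⟩ := Finset.mem_sdiff.1 ha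
    have hcard : (U.erase a).card + 1 = U.card := Finset.card_erase_add_one haU
    have hn' : (U.erase a \ T).card = n := by
      rw [erase_sdiff_eq, Finset.card_erase_of_mem ha, hn]
      rfl
    have hTU' : T ⊆ U.erase a := Finset.subset_erase.2 ⟨hTU, haT⟩
    have hb' : ∀ b ∈ U, b ∉ T → b ≠ a → b ∉ L → ¬ D.LinkedAt ((U.erase a).erase b) b :=
      fun b hbU hbT hba hbL h => hb b (by simp [hbU, hbT, hbL])
        (h.mono (Finset.erase_subset_erase b (Finset.erase_subset a U)))
    by_cases haL : a ∈ L
    · have h1 := ih hTU' (L := L.erase a) (fun b hb => by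
          have h1 := Finset.mem_sdiff.1 (hL (Finset.mem_of_mem_erase hb))
          simp [h1.1, h1.2, Finset.ne_of_mem_erase hb])
        (fun b hb => hl b (Finset.mem_of_mem_erase hb)) (fun b hb => by
          simp only [Finset.mem_sdiff, Finset.mem_erase, not_and] at hb
          exact hb' b hb.1.1.2 hb.1.2 hb.1.1.1 (hb.2 hb.1.1.1)) hn'
      have h2 := comps_insert_of_linkedAt ((hl a haL).mono hTU')
      rw [Finset.insert_erase haU] at h2
      have := Finset.card_erase_add_one haL
      omega
    · have h1 := ih hTU' (L := L) (fun b hb => by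
          have h1 := Finset.mem_sdiff.1 (hL hb)
          exact Finset.mem_sdiff.2 ⟨Finset.mem_erase.2 ⟨fun h => haL (h ▸ hb), h1.1⟩, h1.2⟩)
        hl (fun b hb => by
          simp only [Finset.mem_sdiff, Finset.mem_erase] at hb
          exact hb' b hb.1.1.2 hb.1.2 hb.1.1.1 hb.2) hn'
      have h2 := comps_insert_of_not_linkedAt (hb a (Finset.mem_sdiff.2 ⟨ha, haL⟩))
      rw [Finset.insert_erase haU] at h2
      omega

variable [Fintype ι]

/-- The standard generators of quantum degree `j` over the resolutions between `D(T)` and `D(U)`. -/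
def slice (D : LinkDiagram ι) (T U : Finset ι) (j : ℤ) : Set D.State :=
  D.cube T U ∩ {s | s.qdeg = j}

variable (halt : D.Alternating)

theorem qdeg_iff_of_coeff (j : ℤ) (s t : D.State) (h : (complex halt).coeff s t ≠ 0) :
    s ∈ {s : D.State | s.qdeg = j} ↔ t ∈ {s : D.State | s.qdeg = j} := by
  rw [Set.mem_ofPred_eq, Set.mem_ofPred_eq, qdeg_of_incidence halt (Int.cast_ne_zero.1 h)]

theorem convex_slice (T U : Finset ι) (j : ℤ) : (complex halt).Convex (D.slice T U j) :=
  (convex_cube halt T U).inter (qdeg_iff_of_coeff halt j)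

theorem split_slice (T U : Finset ι) (j : ℤ) (a : ι) : (complex halt).Split (D.slice T U j)
    (D.slice T (U.erase a) j) (D.slice (insert a T) U j) :=
  (split_cube halt T U a).inter _

variable (D) in
open scoped Classical in
/-- The Euler characteristic in quantum degree `j` of the part of the cube between `T` and `U`. -/
noncomputable def euler (T U : Finset ι) (j : ℤ) : ℤ :=
  ∑ s : D.State, if s ∈ D.slice T U j then (-1) ^ s.1.card else 0

include halt in
theorem euler_eq_add (T U : Finset ι) (j : ℤ) (a : ι) :
    D.euler T U j = D.euler T (U.erase a) j + D.euler (insert a T) U j := by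
  rw [euler, euler, euler, ← Finset.sum_add_distrib]
  refine Finset.sum_congr rfl fun s _ => ?_
  have h := split_slice halt T U j a
  by_cases hs : s ∈ D.slice T U j
  · rcases h.mem_or hs with h0 | h1
    · rw [if_pos hs, if_pos h0, if_neg (h.notMem_right h0), add_zero]
    · rw [if_pos hs, if_pos h1, if_neg fun h0 => h.notMem_right h0 h1, zero_add]
  · rw [if_neg hs, if_neg fun h0 => hs (h.left_subset h0),
      if_neg fun h1 => hs (h.right_subset h1), add_zero]

theorem euler_self (T : Finset ι) (j : ℤ) :
    D.euler T T j = (-1) ^ T.card * Label.count (D.circles T) (j - T.card) := by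
  classical
  rw [euler, Fintype.sum_sigma, Finset.sum_eq_single T]
  · rw [circles, Nat.card_eq_fintype_card, ← Label.sum_ite_deg, Finset.mul_sum]
    refine Finset.sum_congr rfl fun l _ => ?_
    rw [mul_ite, mul_one, mul_zero]
    refine if_congr ?_ rfl rfl
    have hq : State.qdeg (⟨T, l⟩ : D.State) = T.card + ∑ z, (l z).deg := qdeg_eq _
    constructor
    · rintro ⟨-, h⟩
      rw [Set.mem_ofPred_eq, hq] at h
      linarith
    · intro h
      refine ⟨⟨subset_rfl, subset_rfl⟩, ?_⟩
      rw [Set.mem_ofPred_eq, hq]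
      linarith
  · intro S _ hS
    exact Finset.sum_eq_zero fun l _ => if_neg fun h => hS (h.1.2.antisymm h.1.1)
  · exact fun h => absurd (Finset.mem_univ T) h

include halt in
theorem euler_eq {n : ℕ} (hTU : T ⊆ U) (hL : L ⊆ U \ T) (hl : ∀ b ∈ L, D.LinkedAt T b)
    (hb : ∀ b ∈ (U \ T) \ L, ¬ D.LinkedAt (U.erase b) b)
    (hn : D.circles T + T.card + L.card = n + U.card) :
    D.euler T U j = (-1) ^ (T.card + L.card) *
      Label.count n (j - (2 * T.card + 3 * L.card - U.card)) := by
  induction hm : (U \ T).card generalizing T U L n with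
  | zero =>
    have hUT : U ⊆ T := by simpa [Finset.sdiff_eq_empty_iff_subset] using hm
    obtain rfl := hTU.antisymm hUT
    obtain rfl : L = ∅ := by simpa using hL
    obtain rfl : D.circles T = n := by simpa using hn
    rw [euler_self, Finset.card_empty]
    congr 2
    push_cast
    ring
  | succ m ih =>
    obtain ⟨a, ha⟩ : (U \ T).Nonempty := Finset.card_pos.1 (by omega)
    obtain ⟨haU, haT⟩ := Finset.mem_sdiff.1 ha
    have hcardU : (U.erase a).card + 1 = U.card := Finset.card_erase_add_one haU
    have hcardT : (insert a T).card = T.card + 1 := Finset.card_insert_of_notMem haT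
    have hm0 : (U.erase a \ T).card = m := by
      rw [erase_sdiff_eq, Finset.card_erase_of_mem ha, hm]
      rfl
    have hm1 : (U \ insert a T).card = m := by
      rw [Finset.sdiff_insert, Finset.card_erase_of_mem ha, hm]
      rfl
    have hTU0 : T ⊆ U.erase a := Finset.subset_erase.2 ⟨hTU, haT⟩
    have hTU1 : insert a T ⊆ U := Finset.insert_subset haU hTU
    have hb0 : ∀ b ∈ (U.erase a \ T) \ L.erase a, ¬ D.LinkedAt ((U.erase a).erase b) b := by
      intro b hbm h
      simp only [Finset.mem_sdiff, Finset.mem_erase, not_and] at hbm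
      exact hb b (by simp [hbm.1.1.2, hbm.1.2, hbm.2 hbm.1.1.1])
        (h.mono (Finset.erase_subset_erase b (Finset.erase_subset a U)))
    have hb1 : ∀ b ∈ (U \ insert a T) \ L.erase a, ¬ D.LinkedAt (U.erase b) b := by
      intro b hbm
      simp only [Finset.mem_sdiff, Finset.mem_erase, Finset.mem_insert, not_and, not_or] at hbm
      exact hb b (by simp [hbm.1.1, hbm.1.2.2, hbm.2 hbm.1.2.1])
    have hL0 : L.erase a ⊆ U.erase a \ T := by
      rw [erase_sdiff_eq]
      exact Finset.erase_subset_erase a hL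
    have hL1 : L.erase a ⊆ U \ insert a T := by
      rw [Finset.sdiff_insert]
      exact Finset.erase_subset_erase a hL
    have hl0 : ∀ b ∈ L.erase a, D.LinkedAt T b := fun b hb => hl b (Finset.mem_of_mem_erase hb)
    have hl1 : ∀ b ∈ L.erase a, D.LinkedAt (insert a T) b :=
      fun b hb => (hl0 b hb).mono (Finset.subset_insert a T)
    rw [euler_eq_add halt T U j a]
    by_cases haL : a ∈ L
    · have hcardL : (L.erase a).card + 1 = L.card := Finset.card_erase_add_one haL
      have hc := circles_insert_of_sameAt halt haT ((sameAt_iff_linkedAt halt haT).2 (hl a haL))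
      rw [ih (n := n) hTU0 hL0 hl0 hb0 (by omega) hm0,
        ih (n := n + 1) hTU1 hL1 hl1 hb1 (by omega) hm1, hcardT, ← hcardL, ← hcardU,
        Label.count_succ]
      push_cast
      ring_nf
    · have hc := circles_insert_of_not_sameAt halt haT fun h => hb a (Finset.mem_sdiff.2 ⟨ha, haL⟩)
        (LinkedAt.mono hTU0 (linkedAt_of_sameAt h))
      rw [Finset.erase_eq_of_notMem haL] at hb0 hb1 hL0 hL1 hl0 hl1
      rw [ih (n := n + 1) hTU0 hL0 hl0 hb0 (by omega) hm0,
        ih (n := n) hTU1 hL1 hl1 hb1 (by omega) hm1, hcardT, ← hcardU, Label.count_succ]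
      push_cast
      ring_nf

theorem exactAt_slice_of_ne (hTU : T ⊆ U) (hL : L ⊆ U \ T) (hl : ∀ b ∈ L, D.LinkedAt T b)
    (hb : ∀ b ∈ (U \ T) \ L, ¬ D.LinkedAt (U.erase b) b) {i : ℤ} (hi : i ≠ T.card + L.card) :
    (complex halt).ExactAt (D.slice T U j) i := by
  refine BasedComplex.ExactAt.inter ?_ (qdeg_iff_of_coeff halt j)
  rcases lt_or_gt_of_ne hi with hi | hi
  · refine exactAt_below halt hTU (B := (U \ T) \ L) Finset.sdiff_subset (fun b hb => hl b ?_) ?_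
    · simp only [Finset.mem_sdiff, not_and, not_not] at hb
      exact hb.2 hb.1
    · rw [Finset.card_sdiff_of_subset hL, Finset.card_sdiff_of_subset hTU]
      have h1 := Finset.card_le_card hL
      rw [Finset.card_sdiff_of_subset hTU] at h1
      have h2 := Finset.card_le_card hTU
      omega
  · exact exactAt_above halt hTU hL hb hi

theorem finrank_slice {n : ℕ} (hTU : T ⊆ U) (hL : L ⊆ U \ T) (hl : ∀ b ∈ L, D.LinkedAt T b)
    (hb : ∀ b ∈ (U \ T) \ L, ¬ D.LinkedAt (U.erase b) b)
    (hn : D.circles T + T.card + L.card = n + U.card) :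
    (Module.finrank ℚ ((complex halt).cohomology (D.slice T U j) (T.card + L.card)) : ℤ) =
      Label.count n (j - (2 * T.card + 3 * L.card - U.card)) := by
  have h1 := BasedComplex.sum_eq_of_exactAt (convex_slice halt T U j)
    (fun x _ => Int.natCast_nonneg _) (i := T.card + L.card)
    fun k hk => exactAt_slice_of_ne halt hTU hL hl hb (by exact_mod_cast hk)
  have h2 := euler_eq halt (j := j) hTU hL hl hb hn
  rw [show D.euler T U j = _ from h1, Nat.cast_add] at h2
  exact mul_left_cancel₀ (pow_ne_zero _ (by norm_num)) h2

end LinkDiagram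

namespace Label

theorem count_one (k : ℤ) : count 1 k = if k = 1 ∨ k = -1 then 1 else 0 := by
  rw [count_succ, count_zero, count_zero]
  by_cases h1 : k = 1
  · subst h1; norm_num
  · by_cases h2 : k = -1
    · subst h2; norm_num
    · rw [if_neg (by omega), if_neg (by omega), if_neg (by omega), add_zero]

end Label

namespace LinkDiagram

variable {ι : Type*} [LinearOrder ι] {D : LinkDiagram ι} {S T U L : Finset ι} {i j : ℤ}

variable (D) in
open scoped Classical in
/-- The least cohomological degree that occurs between `T` and `U`. -/
noncomputable def lower (T U : Finset ι) : ℕ :=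
  T.card + ((U \ T).filter fun a => D.LinkedAt T a).card

variable (D) in
open scoped Classical in
/-- The greatest cohomological degree that occurs between `T` and `U`. -/
noncomputable def upper (T U : Finset ι) : ℕ :=
  T.card + ((U \ T).filter fun a => D.LinkedAt (U.erase a) a).card

theorem linkedAt_erase {a : ι} (hTU : T ⊆ U) (ha : a ∉ T) (h : D.LinkedAt T a) :
    D.LinkedAt (U.erase a) a := h.mono (Finset.subset_erase.2 ⟨hTU, ha⟩)

theorem lower_le_upper (hTU : T ⊆ U) : D.lower T U ≤ D.upper T U := by
  classical
  refine Nat.add_le_add_left (Finset.card_le_card ?_) _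
  intro a ha
  rw [Finset.mem_filter] at ha ⊢
  exact ⟨ha.1, linkedAt_erase hTU (Finset.mem_sdiff.1 ha.1).2 ha.2⟩

section

variable {a : ι} (haU : a ∈ U) (haT : a ∉ T)

include haU haT

theorem lower_erase (h : ¬ D.LinkedAt T a) : D.lower T (U.erase a) = D.lower T U := by
  unfold lower
  congr 2
  ext b
  simp only [Finset.mem_filter, Finset.mem_sdiff, Finset.mem_erase]
  refine ⟨fun hb => ⟨⟨hb.1.1.2, hb.1.2⟩, hb.2⟩, fun hb => ⟨⟨⟨?_, hb.1.1⟩, hb.1.2⟩, hb.2⟩⟩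
  rintro rfl
  exact h hb.2

theorem lower_insert (h : ¬ D.LinkedAt T a) : D.lower T U + 1 ≤ D.lower (insert a T) U := by
  classical
  rw [lower, lower, Finset.card_insert_of_notMem haT, add_right_comm]
  refine Nat.add_le_add_left (Finset.card_le_card ?_) _
  intro b hb
  rw [Finset.mem_filter, Finset.mem_sdiff] at hb ⊢
  refine ⟨⟨hb.1.1, fun hba => ?_⟩, hb.2.mono (Finset.subset_insert a T)⟩
  rcases Finset.mem_insert.1 hba with rfl | hbT
  · exact h hb.2
  · exact hb.1.2 hbT

theorem upper_erase (h : D.LinkedAt (U.erase a) a) :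
    D.upper T (U.erase a) + 1 ≤ D.upper T U := by
  classical
  rw [upper, upper, add_assoc]
  refine Nat.add_le_add_left ?_ _
  have ha : a ∈ (U \ T).filter fun b => D.LinkedAt (U.erase b) b :=
    Finset.mem_filter.2 ⟨Finset.mem_sdiff.2 ⟨haU, haT⟩, h⟩
  rw [← Finset.card_erase_add_one ha]
  refine Nat.add_le_add_right (Finset.card_le_card ?_) _
  intro b hb
  simp only [Finset.mem_filter, Finset.mem_sdiff, Finset.mem_erase] at hb ⊢
  exact ⟨hb.1.1.1, ⟨hb.1.1.2, hb.1.2⟩,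
    hb.2.mono (Finset.erase_subset_erase b (Finset.erase_subset a U))⟩

theorem upper_insert (h : D.LinkedAt (U.erase a) a) : D.upper (insert a T) U = D.upper T U := by
  classical
  rw [upper, upper, Finset.card_insert_of_notMem haT, add_assoc]
  congr 1
  have ha : a ∈ (U \ T).filter fun b => D.LinkedAt (U.erase b) b :=
    Finset.mem_filter.2 ⟨Finset.mem_sdiff.2 ⟨haU, haT⟩, h⟩
  rw [← Finset.card_erase_add_one ha, add_comm]
  congr 2
  ext b
  simp only [Finset.mem_filter, Finset.mem_sdiff, Finset.mem_erase, Finset.mem_insert]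
  tauto

end

variable [Fintype ι] (halt : D.Alternating)

/-- The cohomology between `T` and `U` is thin, with the diagonals determined by `s`, and
its first and last groups lie on different diagonals. -/
structure ThinBetween (T U : Finset ι) (s : ℤ) : Prop where
  thin : ∀ i j, ¬ (complex halt).ExactAt (D.slice T U j) i →
    D.lower T U ≤ i ∧ i ≤ D.upper T U ∧ (j = 2 * i - s - 1 ∨ j = 2 * i - s + 1)
  first : Module.finrank ℚ
    ((complex halt).cohomology (D.slice T U (2 * D.lower T U - s - 1)) (D.lower T U)) = 1
  last : Module.finrank ℚ
    ((complex halt).cohomology (D.slice T U (2 * D.upper T U - s + 1)) (D.upper T U)) = 1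

theorem thinBetween_of_forall (hTU : T ⊆ U) (hT : D.circles T + T.card = D.circles ∅)
    (hU : D.comps U = 1)
    (h : ∀ a ∈ U \ T, D.LinkedAt (U.erase a) a → D.LinkedAt T a) :
    ThinBetween halt T U (D.circles ∅ - 1) := by
  classical
  set L := (U \ T).filter fun a => D.LinkedAt T a with hLdef
  have hL : L ⊆ U \ T := Finset.filter_subset _ _
  have hl : ∀ b ∈ L, D.LinkedAt T b := fun b hb => (Finset.mem_filter.1 hb).2
  have hb : ∀ b ∈ (U \ T) \ L, ¬ D.LinkedAt (U.erase b) b := by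
    intro b hb hlb
    obtain ⟨hb1, hb2⟩ := Finset.mem_sdiff.1 hb
    exact hb2 (Finset.mem_filter.2 ⟨hb1, h b hb1 hlb⟩)
  have hlower : D.lower T U = T.card + L.card := by
    unfold lower
    congr 2
  have hupper : D.upper T U = T.card + L.card := by
    unfold upper
    congr 2
    ext b
    rw [hLdef, Finset.mem_filter, Finset.mem_filter]
    exact ⟨fun hb => ⟨hb.1, h b hb.1 hb.2⟩,
      fun hb => ⟨hb.1, linkedAt_erase hTU (Finset.mem_sdiff.1 hb.1).2 hb.2⟩⟩
  have hcomps := comps_eq_add hTU hL hl hb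
  have hdef := defect_eq_zero halt T
  rw [defect] at hdef
  have hn : D.circles T + T.card + L.card = 1 + U.card := by omega
  have hfin : ∀ j : ℤ, (Module.finrank ℚ ((complex halt).cohomology (D.slice T U j)
      (T.card + L.card)) : ℤ) =
      if j = 2 * (T.card + L.card) - (D.circles ∅ - 1) - 1 ∨
        j = 2 * (T.card + L.card) - (D.circles ∅ - 1) + 1 then 1 else 0 := by
    intro j
    rw [finrank_slice halt hTU hL hl hb hn, Label.count_one]
    refine if_congr ?_ rfl rfl
    omega
  constructor
  · intro i j hij
    have hi : i = T.card + L.card := by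
      by_contra hi
      exact hij (exactAt_slice_of_ne halt hTU hL hl hb hi)
    subst hi
    rw [hlower, hupper]
    refine ⟨by push_cast; rfl, by push_cast; rfl, ?_⟩
    by_contra hj
    have h1 := hfin j
    rw [if_neg hj] at h1
    exact hij (BasedComplex.exactAt_of_finrank_eq_zero (by exact_mod_cast h1))
  · rw [hlower, Nat.cast_add]
    have h1 := hfin (2 * (T.card + L.card) - (D.circles ∅ - 1) - 1)
    rw [if_pos (Or.inl rfl)] at h1
    exact_mod_cast h1
  · rw [hupper, Nat.cast_add]
    have h1 := hfin (2 * (T.card + L.card) - (D.circles ∅ - 1) + 1)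
    rw [if_pos (Or.inr rfl)] at h1
    exact_mod_cast h1

theorem ThinBetween.of_split {s : ℤ} {a : ι} (haU : a ∈ U) (haT : a ∉ T)
    (h0 : ¬ D.LinkedAt T a) (h1 : D.LinkedAt (U.erase a) a)
    (ht0 : ThinBetween halt T (U.erase a) s) (ht1 : ThinBetween halt (insert a T) U s) :
    ThinBetween halt T U s := by
  have e1 := lower_erase haU haT h0
  have e2 := lower_insert haU haT h0
  have e3 := upper_erase haU haT h1
  have e4 := upper_insert haU haT h1
  constructor
  · intro i j hij
    by_cases hx : (complex halt).ExactAt (D.slice T (U.erase a) j) i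
    · have hy : ¬ (complex halt).ExactAt (D.slice (insert a T) U j) i := fun hy =>
        hij ((split_slice halt T U j a).exactAt (convex_slice halt T U j) hx hy)
      have := ht1.thin i j hy
      omega
    · have := ht0.thin i j hx
      omega
  · rw [(split_slice halt T U _ a).finrank_eq_left (convex_slice halt T U _), ← e1]
    · exact ht0.first
    · by_contra hx
      have := ht1.thin _ _ hx
      omega
    · by_contra hx
      have := ht1.thin _ _ hx
      omega
  · rw [(split_slice halt T U _ a).finrank_eq_right (convex_slice halt T U _), ← e4]
    · exact ht1.last
    · by_contra hx
      have := ht0.thin _ _ hx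
      omega
    · by_contra hx
      have := ht0.thin _ _ hx
      omega

theorem thinBetween (hTU : T ⊆ U) (hT : D.circles T + T.card = D.circles ∅) (hU : D.comps U = 1) :
    ThinBetween halt T U (D.circles ∅ - 1) := by
  induction hn : (U \ T).card generalizing T U with
  | zero =>
    refine thinBetween_of_forall halt hTU hT hU fun a ha => ?_
    rw [Finset.card_eq_zero.1 hn] at ha
    exact absurd ha (Finset.notMem_empty a)
  | succ n ih =>
    by_cases h : ∀ a ∈ U \ T, D.LinkedAt (U.erase a) a → D.LinkedAt T a
    · exact thinBetween_of_forall halt hTU hT hU h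
    push Not at h
    obtain ⟨a, ha, h1, h0⟩ := h
    obtain ⟨haU, haT⟩ := Finset.mem_sdiff.1 ha
    refine ThinBetween.of_split halt haU haT h0 h1 (ih ?_ hT ?_ ?_) (ih ?_ ?_ hU ?_)
    · exact Finset.subset_erase.2 ⟨hTU, haT⟩
    · rw [← comps_insert_of_linkedAt h1, Finset.insert_erase haU, hU]
    · rw [erase_sdiff_eq, Finset.card_erase_of_mem ha, hn]
      rfl
    · exact Finset.insert_subset haU hTU
    · rw [← hT, circles_insert_of_not_sameAt halt haT fun h => h0 (linkedAt_of_sameAt h),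
        Finset.card_insert_of_notMem haT]
      ring
    · rw [Finset.sdiff_insert, Finset.card_erase_of_mem ha, hn]
      rfl

end LinkDiagram

theorem nonempty_tensor_quotient_equiv {Z V : Type*} [AddCommGroup Z] [hZ : Module ℤ Z]
    {N : Submodule ℤ Z} [AddCommGroup V] [Module ℚ V] (ψ : Z →+ V) (h0 : ∀ x ∈ N, ψ x = 0)
    (hsurj : ∀ v, ∃ n : ℤ, n ≠ 0 ∧ ∃ x, ψ x = n • v)
    (hinj : ∀ x, ψ x = 0 → ∃ n : ℤ, n ≠ 0 ∧ n • x ∈ N) :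
    Nonempty (ℚ ⊗[ℤ] (Z ⧸ N) ≃ₗ[ℚ] V) := by
  obtain rfl : hZ = AddCommGroup.toIntModule Z := Subsingleton.elim _ _
  let ψ' : Z →ₗ[ℤ] V := { ψ with map_smul' := fun n x => by simp }
  let φ : (Z ⧸ N) →ₗ[ℤ] V := N.liftQ ψ' h0
  have hφ : ∀ x, φ (N.mkQ x) = ψ x := fun x => rfl
  have : IsLocalizedModule (nonZeroDivisors ℤ) φ := by
    refine ⟨fun n => ?_, fun v => ?_, fun {x y} hxy => ?_⟩
    · have hn : ((n : ℤ) : ℚ) ≠ 0 := by exact_mod_cast nonZeroDivisors.ne_zero n.2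
      rw [Module.End.isUnit_iff]
      constructor
      · intro x y hxy
        have h : (n : ℤ) • x = (n : ℤ) • y := hxy
        rw [← Int.cast_smul_eq_zsmul ℚ, ← Int.cast_smul_eq_zsmul ℚ] at h
        exact smul_right_injective V hn h
      · intro y
        refine ⟨((n : ℤ) : ℚ)⁻¹ • y, ?_⟩
        show (n : ℤ) • ((n : ℤ) : ℚ)⁻¹ • y = y
        rw [← Int.cast_smul_eq_zsmul ℚ, smul_smul, mul_inv_cancel₀ hn, one_smul]
    · obtain ⟨n, hn, x, hx⟩ := hsurj v
      exact ⟨⟨N.mkQ x, ⟨n, mem_nonZeroDivisors_of_ne_zero hn⟩⟩, hx.symm⟩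
    · obtain ⟨x, rfl⟩ := N.mkQ_surjective x
      obtain ⟨y, rfl⟩ := N.mkQ_surjective y
      rw [hφ, hφ, ← sub_eq_zero, ← map_sub] at hxy
      obtain ⟨n, hn, hx⟩ := hinj _ hxy
      refine ⟨⟨n, mem_nonZeroDivisors_of_ne_zero hn⟩, ?_⟩
      have h : N.mkQ (n • x) = N.mkQ (n • y) := by
        rw [← sub_eq_zero, ← map_sub, ← zsmul_sub, Submodule.mkQ_apply,
          Submodule.Quotient.mk_eq_zero]
        exact hx
      rw [map_zsmul, map_zsmul] at h
      exact h
  exact ⟨(IsLocalizedModule.isBaseChange (nonZeroDivisors ℤ) ℚ φ).equiv⟩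

theorem exists_int_mul {X : Type*} [Finite X] (f : X → ℚ) :
    ∃ n : ℤ, n ≠ 0 ∧ ∀ x, ∃ k : ℤ, (k : ℚ) = n * f x := by
  obtain ⟨b, hb⟩ := IsLocalization.exist_integer_multiples_of_finite (nonZeroDivisors ℤ) f
  refine ⟨b, nonZeroDivisors.ne_zero b.2, fun x => ?_⟩
  obtain ⟨k, hk⟩ := hb x
  refine ⟨k, ?_⟩
  have h : (k : ℚ) = (b : ℤ) • f x := hk
  rw [h, zsmul_eq_mul]

namespace LinkDiagram

variable {ι : Type*} [LinearOrder ι] [Fintype ι] {D : LinkDiagram ι} {i i' j : ℤ}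

open scoped Classical in
/-- Integral cochains as rational cochains. -/
noncomputable def extend (i j : ℤ) : D.Cochain i j →+ (D.State → ℚ) where
  toFun f s := if h : s.hdeg = i ∧ s.qdeg = j then (f ⟨s, h⟩ : ℚ) else 0
  map_zero' := by ext s; simp
  map_add' f g := by
    ext s
    by_cases h : s.hdeg = i ∧ s.qdeg = j <;> simp [h]

theorem extend_apply (f : D.Cochain i j) (s : D.Generator i j) : extend i j f s.1 = f s :=
  dif_pos s.2

theorem extend_apply_of_not (f : D.Cochain i j) {s : D.State} (h : ¬ (s.hdeg = i ∧ s.qdeg = j)) :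
    extend i j f s = 0 := dif_neg h

theorem extend_injective : Function.Injective (extend (D := D) i j) := by
  intro f g h
  ext s
  have := congrFun h s.1
  rw [extend_apply, extend_apply] at this
  exact_mod_cast this

variable (halt : D.Alternating)

theorem mem_slice_univ {s : D.State} : s ∈ D.slice ∅ Finset.univ j ↔ s.qdeg = j :=
  ⟨fun h => h.2, fun h => ⟨⟨Finset.empty_subset _, Finset.subset_univ _⟩, h⟩⟩

theorem extend_mem (f : D.Cochain i j) :
    extend i j f ∈ (complex halt).supp (D.slice ∅ Finset.univ j) i := by
  intro s hs
  by_cases h : s.hdeg = i ∧ s.qdeg = j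
  · exact ⟨mem_slice_univ.2 h.2, h.1⟩
  · exact absurd (extend_apply_of_not f h) hs

theorem exists_extend_eq {f : D.State → ℚ}
    (hf : f ∈ (complex halt).supp (D.slice ∅ Finset.univ j) i) :
    ∃ n : ℤ, n ≠ 0 ∧ ∃ g, extend i j g = n • f := by
  obtain ⟨n, hn, h⟩ := exists_int_mul f
  choose k hk using h
  refine ⟨n, hn, fun s => k s.1, ?_⟩
  ext s
  rw [Pi.smul_apply, zsmul_eq_mul, ← hk]
  by_cases hs : s.hdeg = i ∧ s.qdeg = j
  · exact extend_apply _ ⟨s, hs⟩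
  · rw [extend_apply_of_not _ hs, hk]
    by_contra h
    obtain ⟨h1, h2⟩ := hf s (right_ne_zero_of_mul (Ne.symm h))
    exact hs ⟨h2, mem_slice_univ.1 h1⟩

theorem extend_d (hi : i' = i + 1) (f : D.Cochain i j) :
    extend i' j (D.d i i' j f) =
      (complex halt).dif (D.slice ∅ Finset.univ j) (extend i j f) := by
  subst hi
  ext t
  by_cases ht : t.hdeg = i + 1 ∧ t.qdeg = j
  · rw [extend_apply _ ⟨t, ht⟩, BasedComplex.dif_apply_of_mem (mem_slice_univ.2 ht.2)]
    have h1 : D.d i (i + 1) j f ⟨t, ht⟩ = ∑ s : D.Generator i j, D.incidence s.1 t * f s := rfl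
    rw [h1, Int.cast_sum]
    symm
    rw [← Finset.sum_subset (Finset.subset_univ
      (Finset.univ.filter fun s : D.State => s.hdeg = i ∧ s.qdeg = j)),
      ← Finset.sum_subtype_eq_sum_filter, Finset.subtype_univ]
    · refine Finset.sum_congr rfl fun s _ => ?_
      rw [extend_apply f s, Int.cast_mul]
      rfl
    · intro s _ hs
      rw [extend_apply_of_not f (by simpa using hs), mul_zero]
  · rw [extend_apply_of_not _ ht]
    by_contra h
    obtain ⟨h1, h2⟩ := BasedComplex.dif_mem (extend_mem halt f) t (Ne.symm h)
    exact ht ⟨h2, mem_slice_univ.1 h1⟩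

theorem nonempty_khBar_equiv (i j : ℤ) : Nonempty (ℚ ⊗[ℤ] D.KhBar i j ≃ₗ[ℚ]
    (complex halt).cohomology (D.slice ∅ Finset.univ j) i) := by
  have hker : ∀ f : LinearMap.ker (D.d i (i + 1) j), extend i j f.1 ∈
      (complex halt).cocycles (D.slice ∅ Finset.univ j) i := fun f =>
    ⟨extend_mem halt f.1, by
      rw [SetLike.mem_coe, LinearMap.mem_ker, ← extend_d halt rfl, LinearMap.mem_ker.1 f.2, map_zero]⟩
  let ψ : LinearMap.ker (D.d i (i + 1) j) →+
      (complex halt).cohomology (D.slice ∅ Finset.univ j) i :=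
    { toFun := fun f => Submodule.Quotient.mk ⟨extend i j f.1, hker f⟩
      map_zero' := by
        rw [Submodule.Quotient.mk_eq_zero]
        refine ⟨0, Submodule.zero_mem _, ?_⟩
        rw [map_zero]
        exact (map_zero (extend i j)).symm
      map_add' := fun f g => by
        rw [← Submodule.Quotient.mk_add]
        congr 1
        exact Subtype.ext (map_add (extend i j) f.1 g.1) }
  have hψ : ∀ f, ψ f = 0 ↔ extend i j f.1 ∈
      (complex halt).coboundaries (D.slice ∅ Finset.univ j) i := fun f =>
    Submodule.Quotient.mk_eq_zero _
  refine nonempty_tensor_quotient_equiv ψ ?_ ?_ ?_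
  · rintro f ⟨g, hg⟩
    rw [hψ]
    refine ⟨extend (i - 1) j g, extend_mem halt g, ?_⟩
    rw [← extend_d halt (sub_add_cancel i 1).symm, hg]
    rfl
  · intro v
    obtain ⟨⟨f, hf⟩, rfl⟩ := Submodule.Quotient.mk_surjective _ v
    obtain ⟨n, hn, g, hg⟩ := exists_extend_eq halt hf.1
    refine ⟨n, hn, ⟨g, ?_⟩, ?_⟩
    · rw [LinearMap.mem_ker]
      apply extend_injective
      rw [extend_d halt rfl, hg, map_zsmul, hf.2, smul_zero, map_zero]
    · have : (⟨extend i j g, hg ▸ zsmul_mem hf n⟩ :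
          (complex halt).cocycles (D.slice ∅ Finset.univ j) i) = n • ⟨f, hf⟩ := Subtype.ext hg
      exact congrArg Submodule.Quotient.mk this
  · intro f hf
    obtain ⟨g, hg, hgf⟩ := (hψ f).1 hf
    obtain ⟨n, hn, k, hk⟩ := exists_extend_eq halt hg
    refine ⟨n, hn, k, ?_⟩
    apply extend_injective
    rw [extend_d halt (sub_add_cancel i 1).symm, hk, map_zsmul, hgf]
    exact (map_zsmul (extend i j) n f.1).symm

end LinkDiagram

theorem mainTheorem2 {ι : Type*} [Fintype ι] [LinearOrder ι] (D : LinkDiagram ι)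
    (hns : D.Nonsplit) (halt : D.Alternating) :
    ∃ s p m : ℤ, p ≤ m ∧
      (∀ i j : ℤ, Nontrivial (ℚ ⊗[ℤ] D.KhBar i j) →
        p ≤ i ∧ i ≤ m ∧ (j = 2 * i - s - 1 ∨ j = 2 * i - s + 1)) ∧
      Module.finrank ℚ (ℚ ⊗[ℤ] D.KhBar p (2 * p - s - 1)) = 1 ∧
      Module.finrank ℚ (ℚ ⊗[ℤ] D.KhBar m (2 * m - s + 1)) = 1 := by
  have hthin := LinkDiagram.thinBetween halt (Finset.empty_subset Finset.univ)
    (by rw [Finset.card_empty, add_zero]) (LinkDiagram.comps_univ.trans hns)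
  refine ⟨D.circles ∅ - 1, D.lower ∅ Finset.univ, D.upper ∅ Finset.univ, ?_, ?_, ?_, ?_⟩
  · exact_mod_cast LinkDiagram.lower_le_upper (Finset.empty_subset _)
  · intro i j hij
    refine hthin.thin i j fun h => ?_
    have e := (LinkDiagram.nonempty_khBar_equiv halt i j).some
    have := BasedComplex.exactAt_iff.1 h
    exact not_subsingleton (ℚ ⊗[ℤ] D.KhBar i j) e.toEquiv.subsingleton
  · rw [(LinkDiagram.nonempty_khBar_equiv halt _ _).some.finrank_eq]
    exact hthin.first
  · rw [(LinkDiagram.nonempty_khBar_equiv halt _ _).some.finrank_eq]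
    exact hthin.last
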